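/- Let $l,n\ge 0$ and let $G=\mathrm{Sp}_n(\mathbb C)$ with $n=2l$ (resp. $G=\mathrm{SO}_n(\mathbb C)$ with $n\in\{2l,2l+1\}$) be the group preserving the bilinear form on $\mathbb C^n$ with matrix $\begin{pmatrix}0&J_l\\-J_l&0\end{pmatrix}$ (resp. $J_n$), where $J_m$ is the $m\times m$ anti-diagonal matrix of ones; let $\mathfrak g$ be its Lie algebra. Let $0\ne V_1\subsetneq\dots\subsetneq V_k$ be a totally isotropic flag in $\mathbb C^n$ with $\dim V_k=l$ (with $k=0$ if $l=0$) whose stabilizer $P\subseteq G$ contains the Borel subgroup of upper-triangular matrices of $G$. Put $V_0=0$ and $b_i=\dim V_i-\dim V_{i-1}$. An enhanced symplectic (resp. orthogonal) oriented link pattern of type $(b_1,\dots,b_k)$ consists of vertices $1,\dots,k$ and, with multiplicities, oriented arrows between different vertices, unoriented loops, oriented arrows with dots between different vertices, and loops with dots, oriented clockwise or counterclockwise, such that for every vertex $i$ $$x_i+y_i+2z_i-l_i\le b_i\qquad(\text{resp. } x_i+y_i+2z_i\le b_i),$$ where $x_i$ (resp. $y_i$) is the number of sources (resp. targets) at $i$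 of oriented arrows with or without dots, a loop with dot counting once as a source and once as a target, $z_i$ is the number of unoriented loops and $l_i$ the number of loops with dots at $i$. An enhanced symplectic (resp. orthogonal) link pattern is obtained from such a pattern in which every arrow points from right to left and every loop with dot is counterclockwise, by forgetting the orientation. Then: (a) The $P$-orbits in $\mathfrak n_P(2)=\{x\in\mathfrak n_P\mid x^2=0\}$, where $\mathfrak n_P$ is the nilradical of $\mathrm{Lie}(P)$ (the Lie algebra of the unipotent radical of $P$), are in bijection with the enhanced symplectic (resp. orthogonal) link patterns of type $(b_1,\dots,b_k)$ in which every loop is oriented before the orientation is forgotten, i.e. which have no loops without dots. (b) The $P$-orbits through the upper-triangular matrices $x\in\mathfrak g$ with $x^2=0$ are in bijection with all enhanced symplectic (resp. orthogonal) link patterns of type $(b_1,\dots,b_k)$. Both bijections are natural in the following sense. For every $x$ in such an orbit there are vectors $e_1,\dots,e_l,f_1,\dots,f_l\in\mathbb C^n$ with $\langle e_s,f_t\rangle=\delta_{st}$, $\langle e_s,e_t\rangle=\langle f_s,f_t\rangle=0$ and $V_i=\langle e_1,\dots,e_{\dim V_i}\rangle$, such that $x$ kills every vector orthogonal to all $e_t,f_t$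 and acts on the $e_t,f_t$ as the sum of the following contributions of pairwise disjoint links on the points $1,\dots,l$: a link without dot between $s<t$ gives $e_t\mapsto e_s$, $f_s\mapsto -f_t$; a link with dot between $s<t$ (in the symplectic case only if $s,t$ lie in different blocks) gives $f_t\mapsto e_s$, $f_s\mapsto e_t$ (resp. $f_s\mapsto -e_t$); and, only in the symplectic case, a loop with dot at $t$ gives $f_t\mapsto e_t$. The orbit corresponds to a pattern if and only if the pattern arises from such a basis for $x$ by gluing all points $t$ with $\dim V_{i-1}<t\le\dim V_i$ to the vertex $i$. -/

import Mathlib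

open Module

namespace NilradicalOrbits

/-- The two kinds of bilinear forms. -/
inductive FormKind
  | symplectic
  | orthogonal

/-- The Gram matrix of the standard form on `ℂⁿ`. It is anti-diagonal; in the orthogonal case
all anti-diagonal entries are `1`, in the symplectic case (used for `n = 2 * l`) the upper half of
the anti-diagonal entries are `1` and the lower half are `-1`. -/
def gram (κ : FormKind) (n : ℕ) : Matrix (Fin n) (Fin n) ℂ :=
  Matrix.of fun i j =>
    if j = i.rev then
      match κ with
      | .orthogonal => 1
      | .symplectic => if i < j then 1 else -1
    else 0

/-- The standard bilinear form `⟨v, w⟩ = vᵀ F w`. -/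
def pairing (κ : FormKind) {n : ℕ} (v w : Fin n → ℂ) : ℂ :=
  v ⬝ᵥ (gram κ n).mulVec w

/-- The matrices in `GLₙ(ℂ)` which preserve the standard form. -/
def isometryGroup (κ : FormKind) (n : ℕ) : Subgroup (GL (Fin n) ℂ) where
  carrier := {g | g.1.transpose * gram κ n * g.1 = gram κ n}
  one_mem' := by simp
  mul_mem' := by
    intro a b ha hb
    simp only [Set.mem_ofPred_eq, Units.val_mul, Matrix.transpose_mul] at *
    calc b.1.transpose * a.1.transpose * gram κ n * (a.1 * b.1)
        = b.1.transpose * (a.1.transpose * gram κ n * a.1) * b.1 := by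
          simp only [Matrix.mul_assoc]
      _ = gram κ n := by rw [ha, hb]
  inv_mem' := by
    intro a ha
    simp only [Set.mem_ofPred_eq] at *
    have h1 : a.1 * (a⁻¹).1 = 1 := by simp
    have h2 : (a⁻¹).1.transpose * a.1.transpose = 1 := by
      rw [← Matrix.transpose_mul, h1, Matrix.transpose_one]
    calc (a⁻¹).1.transpose * gram κ n * (a⁻¹).1
        = (a⁻¹).1.transpose * (a.1.transpose * gram κ n * a.1) * (a⁻¹).1 := by rw [ha]
      _ = ((a⁻¹).1.transpose * a.1.transpose) * gram κ n * (a.1 * (a⁻¹).1) := by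
          simp only [Matrix.mul_assoc]
      _ = gram κ n := by rw [h1, h2]; simp

/-- The classical group: `Spₙ(ℂ)` in the symplectic case and `SOₙ(ℂ)` in the orthogonal case. -/
def classicalGroup (κ : FormKind) (n : ℕ) : Subgroup (GL (Fin n) ℂ) :=
  match κ with
  | .symplectic => isometryGroup .symplectic n
  | .orthogonal => isometryGroup .orthogonal n ⊓ (Matrix.GeneralLinearGroup.det).ker

/-- The classical Lie algebra `𝔰𝔭ₙ` or `𝔬ₙ`. -/
def classicalLie (κ : FormKind) (n : ℕ) : Set (Matrix (Fin n) (Fin n) ℂ) :=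
  {a | a.transpose * gram κ n + gram κ n * a = 0}

/-- The stabilizer in `GLₙ(ℂ)` of a family of subspaces of `ℂⁿ`. -/
def flagStabilizer {n k : ℕ} (V : Fin k → Submodule ℂ (Fin n → ℂ)) :
    Subgroup (GL (Fin n) ℂ) where
  carrier := {g | ∀ i, (V i).map (Matrix.toLin' g.1) = V i}
  one_mem' := by
    intro i
    simp
  mul_mem' := by
    intro a b ha hb i
    rw [Units.val_mul, Matrix.toLin'_mul, Submodule.map_comp, hb i, ha i]
  inv_mem' := by
    intro a ha i
    have h : (a⁻¹).1 * a.1 = 1 := by simp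
    conv_lhs => rw [← ha i]
    rw [← Submodule.map_comp, ← Matrix.toLin'_mul, h, Matrix.toLin'_one, Submodule.map_id]

/-- The parabolic subgroup `P = Stab_G(V)` of `G = Spₙ` or `SOₙ`. -/
def parabolic (κ : FormKind) {n k : ℕ} (V : Fin k → Submodule ℂ (Fin n → ℂ)) :
    Subgroup (GL (Fin n) ℂ) :=
  classicalGroup κ n ⊓ flagStabilizer V

/-- `0 ≠ V₁ ⊊ ⋯ ⊊ V_k` is a totally isotropic flag whose stabilizer in `G` contains the standard
Borel subgroup (the upper-triangular matrices in `G`). -/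
structure IsStandardIsotropicFlag (κ : FormKind) {n k : ℕ}
    (V : Fin k → Submodule ℂ (Fin n → ℂ)) : Prop where
  ne_bot : ∀ i, V i ≠ ⊥
  strictMono : StrictMono V
  isotropic : ∀ i, ∀ v ∈ V i, ∀ w ∈ V i, pairing κ v w = 0
  borel_le : ∀ g ∈ classicalGroup κ n, Matrix.BlockTriangular g.1 id → g ∈ parabolic κ V

/-- The previous step `V_{i-1}` of the flag (with `V₀ = 0`). -/
def prevStep {n k : ℕ} (V : Fin k → Submodule ℂ (Fin n → ℂ)) (i : Fin k) :
    Submodule ℂ (Fin n → ℂ) :=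
  ⨆ j, ⨆ _ : j < i, V j

/-- The block sizes `b_i = dim V_i - dim V_{i-1}`. -/
noncomputable def blockSize {n k : ℕ} (V : Fin k → Submodule ℂ (Fin n → ℂ)) (i : Fin k) : ℕ :=
  finrank ℂ (V i) - finrank ℂ (prevStep V i)

/-- The nilradical (Lie algebra of the unipotent radical) of `Lie P`: the elements of the classical
Lie algebra which shift the self-dual flag `0 ⊂ V₁ ⊂ ⋯ ⊂ V_k ⊆ V_kᗮ ⊂ ⋯ ⊂ V₁ᗮ ⊂ ℂⁿ` down by one
step. The conditions `x V_{i-1}ᗮ ⊆ V_iᗮ` follow from `x V_i ⊆ V_{i-1}` by skew-adjointness. -/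
def parabolicNilradical (κ : FormKind) {n k : ℕ} (V : Fin k → Submodule ℂ (Fin n → ℂ)) :
    Set (Matrix (Fin n) (Fin n) ℂ) :=
  {x | x ∈ classicalLie κ n ∧
    (∀ i, ∀ v ∈ V i, x.mulVec v ∈ prevStep V i) ∧
    ∀ v, (∀ w ∈ ⨆ i, V i, pairing κ v w = 0) → x.mulVec v ∈ ⨆ i, V i}

/-- The `2`-nilpotent elements of the nilradical of `Lie P`. -/
def nilradicalTwo (κ : FormKind) {n k : ℕ} (V : Fin k → Submodule ℂ (Fin n → ℂ)) :
    Set (Matrix (Fin n) (Fin n) ℂ) :=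
  {x | x ∈ parabolicNilradical κ V ∧ x ^ 2 = 0}

/-- The `2`-nilpotent upper-triangular elements of the classical Lie algebra. -/
def upperTriangularTwo (κ : FormKind) (n : ℕ) : Set (Matrix (Fin n) (Fin n) ℂ) :=
  {x | x ∈ classicalLie κ n ∧ Matrix.BlockTriangular x id ∧ x ^ 2 = 0}

/-- The conjugation orbit of a matrix `x` under a subgroup `P` of `GLₙ(ℂ)`. -/
def conjOrbit {n : ℕ} (P : Subgroup (GL (Fin n) ℂ)) (x : Matrix (Fin n) (Fin n) ℂ) :
    Set (Matrix (Fin n) (Fin n) ℂ) :=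
  {y | ∃ g ∈ P, y = g.1 * x * (g⁻¹).1}

/-- The `P`-orbits of the elements of a set `S` of matrices. -/
def orbitsOf {n : ℕ} (P : Subgroup (GL (Fin n) ℂ)) (S : Set (Matrix (Fin n) (Fin n) ℂ)) :
    Set (Set (Matrix (Fin n) (Fin n) ℂ)) :=
  {O | ∃ x ∈ S, O = conjOrbit P x}

/-! ### Enhanced patterns -/

/-- A pattern on `k` vertices: oriented arrows without dots between different vertices, unoriented
loops without dots, oriented arrows with dots between different vertices, and loops with dots, which
are oriented counterclockwise or clockwise. All of them come with multiplicities; `arrow i j` is the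
number of arrows with source `i` and target `j`. -/
structure OrientedPattern (k : ℕ) where
  arrow : Fin k → Fin k → ℕ
  arrow_self : ∀ i, arrow i i = 0
  loop : Fin k → ℕ
  dotArrow : Fin k → Fin k → ℕ
  dotArrow_self : ∀ i, dotArrow i i = 0
  dotLoopCCW : Fin k → ℕ
  dotLoopCW : Fin k → ℕ

namespace OrientedPattern

variable {k : ℕ} (p : OrientedPattern k)

/-- The number of loops with dots at a vertex. -/
def dotLoops (i : Fin k) : ℕ := p.dotLoopCCW i + p.dotLoopCW i

/-- The number of sources of oriented arrows (with or without dots, including loops with dots). -/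
def sources (i : Fin k) : ℕ := ∑ j, p.arrow i j + ∑ j, p.dotArrow i j + p.dotLoops i

/-- The number of targets of oriented arrows (with or without dots, including loops with dots). -/
def targets (i : Fin k) : ℕ := ∑ j, p.arrow j i + ∑ j, p.dotArrow j i + p.dotLoops i

/-- Enhanced symplectic / orthogonal oriented link patterns of type `b`: in the symplectic case
`x_i + y_i + 2 z_i - l_i ≤ b_i`, in the orthogonal case `x_i + y_i + 2 z_i ≤ b_i`. -/
def IsEnhanced (κ : FormKind) (b : Fin k → ℕ) : Prop :=
  ∀ i,
    match κ with
    | .symplectic => p.sources i + p.targets i + 2 * p.loop i ≤ b i + p.dotLoops i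
    | .orthogonal => p.sources i + p.targets i + 2 * p.loop i ≤ b i

/-- Every arrow is oriented from right to left and every loop with a dot counterclockwise. -/
def IsRightToLeft : Prop :=
  (∀ i j, p.arrow i j ≠ 0 → j < i) ∧ (∀ i j, p.dotArrow i j ≠ 0 → j < i) ∧
    ∀ i, p.dotLoopCW i = 0

end OrientedPattern

/-- An unoriented pattern: the multiplicities of the links (with and without dots) joining each
unordered pair of (possibly equal) vertices. -/
@[ext]
structure Pattern (k : ℕ) where
  link : Sym2 (Fin k) → ℕ
  dotLink : Sym2 (Fin k) → ℕ

/-- Delete the orientation. -/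
def OrientedPattern.forget {k : ℕ} (p : OrientedPattern k) : Pattern k where
  link := Sym2.lift
    ⟨fun i j => if i = j then p.loop i else p.arrow i j + p.arrow j i, by
      intro i j
      by_cases h : i = j
      · subst h; rfl
      · simp only [if_neg h, if_neg (Ne.symm h), add_comm]⟩
  dotLink := Sym2.lift
    ⟨fun i j => if i = j then p.dotLoops i else p.dotArrow i j + p.dotArrow j i, by
      intro i j
      by_cases h : i = j
      · subst h; rfl
      · simp only [if_neg h, if_neg (Ne.symm h), add_comm]⟩

/-- The enhanced symplectic / orthogonal link patterns of size `k` and type `b`. -/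
def linkPatterns (κ : FormKind) {k : ℕ} (b : Fin k → ℕ) : Set (Pattern k) :=
  OrientedPattern.forget '' {p | p.IsEnhanced κ b ∧ p.IsRightToLeft}

/-- The enhanced link patterns all of whose loops are oriented (counterclockwise) before the
orientation is deleted, that is, which have no loops without dots. -/
def linkPatternsNoPlainLoops (κ : FormKind) {k : ℕ} (b : Fin k → ℕ) : Set (Pattern k) :=
  OrientedPattern.forget '' {p | p.IsEnhanced κ b ∧ p.IsRightToLeft ∧ ∀ i, p.loop i = 0}

open Classical in
/-- The matrix `x` is in normal form of pattern `q` with respect to a basis of `ℂⁿ` adapted to the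
form and to the flag.

The basis consists of `e_t, f_t` (`t < l`) with `⟨e_s, f_t⟩ = δ_{st}`, `⟨e_s, e_t⟩ = 0`,
`⟨f_s, f_t⟩ = 0`, where `V_i` is spanned by the `e_t` with `β t ≤ i`, and, for `n = 2l + 1`, of one
further vector orthogonal to these, which is killed by `x`. The involution `m` and the set `D`
describe a link pattern on `l` points: the point `t ∈ D` is linked to `m t` with a dot, the point
`t ∉ D` is linked to `m t ≠ t` without dot, or is free if `m t = t`. A link without dot from
`t` to `s < t` stands for `E_{s,t} - E_{t*,s*}`, a link with dot joining `s < t` stands for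
`E_{s,t*} ± E_{t,s*}` (`+` symplectic, `-` orthogonal), a symplectic loop with dot at `t`
for `E_{t,t*}`. Points `t` with the same `β t` are glued to one vertex, and `q` is the result. -/
def HasNormalForm (κ : FormKind) (l : ℕ) {n k : ℕ} (V : Fin k → Submodule ℂ (Fin n → ℂ))
    (x : Matrix (Fin n) (Fin n) ℂ) (q : Pattern k) : Prop :=
  ∃ (e f : Fin l → Fin n → ℂ) (β : Fin l → Fin k) (m : Fin l → Fin l) (D : Set (Fin l)),
    (∀ s t, pairing κ (e s) (e t) = 0) ∧ (∀ s t, pairing κ (f s) (f t) = 0) ∧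
    (∀ s t, pairing κ (e s) (f t) = if s = t then 1 else 0) ∧
    Monotone β ∧ (∀ i, V i = Submodule.span ℂ (e '' {t | β t ≤ i})) ∧
    (∀ t, m (m t) = t) ∧ (∀ t, m t ∈ D ↔ t ∈ D) ∧
    (match κ with
      | .symplectic => ∀ t ∈ D, m t ≠ t → β (m t) ≠ β t
      | .orthogonal => ∀ t ∈ D, m t ≠ t) ∧
    (∀ t, x.mulVec (e t) = if t ∉ D ∧ m t < t then e (m t) else 0) ∧
    (∀ t, x.mulVec (f t) =
      if t ∈ D then
        (match κ with
          | .symplectic => e (m t)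
          | .orthogonal => if m t < t then e (m t) else -e (m t))
      else if t < m t then -f (m t) else 0) ∧
    (∀ u, (∀ t, pairing κ (e t) u = 0 ∧ pairing κ (f t) u = 0) → x.mulVec u = 0) ∧
    (∀ a : Sym2 (Fin k),
      q.link a = (Finset.univ.filter fun t => t ∉ D ∧ m t < t ∧ s(β t, β (m t)) = a).card) ∧
    (∀ a : Sym2 (Fin k),
      q.dotLink a = (Finset.univ.filter fun t => t ∈ D ∧ m t ≤ t ∧ s(β t, β (m t)) = a).card)

/-- The natural bijection between the `P`-orbits of the elements of `S` and the set `Q` of patterns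
exists: an orbit corresponds to the pattern of the normal form of its elements. -/
def NaturallyParametrizedBy (κ : FormKind) (l : ℕ) {n k : ℕ}
    (V : Fin k → Submodule ℂ (Fin n → ℂ)) (S : Set (Matrix (Fin n) (Fin n) ℂ))
    (Q : Set (Pattern k)) : Prop :=
  ∃ Φ : orbitsOf (parabolic κ V) S ≃ Q,
    ∀ (O : orbitsOf (parabolic κ V) S) (q : Q), ∀ x ∈ O.1, Φ O = q ↔ HasNormalForm κ l V x q.1

end NilradicalOrbits

/-! Every `x` with `x² = 0` that stabilizes the flag has a normal form, and the pattern of that form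
is a complete invariant of its `P`-orbit.

Existence (`NilFlag.exists_normalForm`). Because `x² = 0`, the flag refines to a complete `x`-stable
isotropic flag `A 0 ⊂ ... ⊂ A l`. Pairs `e_t, f_t` are then split off greedily. Let `U` be the span
of the pairs already found (nondegenerate and `x`-stable), `a` the least missing point, and `v ∈ A
(a+1) \ A a` orthogonal to `U`; then `x v = 0`. The place where `v` enters the chain `U ⊆ x(A 1) + U
⊆ ... ⊆ x(A l) + U ⊆ x(A l)ᗮ + U ⊆ ... ⊆ x(A 0)ᗮ + U` decides the link at `a`: never means a free
point, the first half a link without dot, the second half a dot. Nothing enters at the middle step,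
since `(A l)ᗮ / A l` is at most a line. In the symplectic case a dot inside one block is a
hyperbolic plane, which splits over `ℂ` into two loops (`LinkBasis.exists_dotsSeparated`).

Completeness. For steps `F, F'` of the flag the dimensions of `x F + F'` and `x Fᗮ + F'` count links
by blocks, so the multiplicities are determined by `x` (`LinkBasis.counts_eq`). Conversely, link
patterns with equal multiplicities differ by a block-preserving permutation (`exists_perm`), and the
linear map between the adapted bases is an isometry conjugating one matrix to the other
(`LinkBasis.exists_conj`). Its determinant is `1` for `n = 2l` because it stabilizes a Lagrangian;
for `n = 2l + 1` its sign can be changed.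

Realization. The inequalities say that every vertex has enough points (`isEnhanced_iff`), so each
pattern comes from gluing. A Borel-stable isotropic flag is spanned by coordinate vectors, in which
the normal form is upper triangular (`exists_upperTriangular`). Finally, a normal form lies in the
nilradical exactly when no link without dot stays inside a block
(`HasNormalForm.mem_nilradicalTwo_iff`). -/

namespace NilradicalOrbits

/-- The sign `ε` with `⟨v, w⟩ = ε ⟨w, v⟩`. -/
def FormKind.sgn : FormKind → ℂ
  | .symplectic => -1
  | .orthogonal => 1

lemma FormKind.sgn_mul_self (κ : FormKind) : κ.sgn * κ.sgn = 1 := by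
  cases κ <;> simp [FormKind.sgn]

lemma FormKind.sgn_ne_zero (κ : FormKind) : κ.sgn ≠ 0 := by
  cases κ <;> simp [FormKind.sgn]

/-! ### Hyperbolic pairs adapted to a complete isotropic flag, and the projection away from them. -/

section Links

variable {W : Type*} [AddCommGroup W] [Module ℂ W] {l : ℕ}

open Classical in
/-- The image of `e t` under the endomorphism attached to a link pattern. -/
noncomputable def linkE (e : Fin l → W) (m : Fin l → Fin l) (D : Set (Fin l)) (t : Fin l) : W :=
  if t ∉ D ∧ m t < t then e (m t) else 0

open Classical in
/-- The image of `f t` under the endomorphism attached to a link pattern. -/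
noncomputable def linkF (κ : FormKind) (e f : Fin l → W) (m : Fin l → Fin l) (D : Set (Fin l))
    (t : Fin l) : W :=
  if t ∈ D then
    (match κ with
      | .symplectic => e (m t)
      | .orthogonal => if m t < t then e (m t) else -e (m t))
  else if t < m t then -f (m t) else 0

/-- A `2`-nilpotent skew endomorphism stabilizing a complete flag of isotropic subspaces. -/
structure NilFlag (κ : FormKind) (l : ℕ) (B : LinearMap.BilinForm ℂ W) (x : W →ₗ[ℂ] W)
    (A : ℕ → Submodule ℂ W) : Prop where
  symm : ∀ u v, B u v = κ.sgn * B v u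
  nondeg : B.Nondegenerate
  skew : ∀ u v, B (x u) v = -B u (x v)
  sq : ∀ v, x (x v) = 0
  mono : Monotone A
  finrank : ∀ j, finrank ℂ (A j) = min j l
  iso : ∀ j, ∀ u ∈ A j, ∀ v ∈ A j, B u v = 0
  stable : ∀ j, ∀ v ∈ A j, x v ∈ A j
  card_le : Module.finrank ℂ W ≤ 2 * l + 1

/-- A system of pairs `e t, f t`, for `t` in `S`, adapted to the flag `A`, on which `x` acts by the
link pattern given by `m` and `D`. -/
structure PartialNF (κ : FormKind) (B : LinearMap.BilinForm ℂ W) (x : W →ₗ[ℂ] W)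
    (A : ℕ → Submodule ℂ W) (S : Finset (Fin l)) (e f : Fin l → W) (m : Fin l → Fin l)
    (D : Set (Fin l)) : Prop where
  ee : ∀ s ∈ S, ∀ t ∈ S, B (e s) (e t) = 0
  ff : ∀ s ∈ S, ∀ t ∈ S, B (f s) (f t) = 0
  ef : ∀ s ∈ S, ∀ t ∈ S, B (e s) (f t) = if s = t then 1 else 0
  e_mem : ∀ t ∈ S, e t ∈ A (t + 1)
  f_perp : ∀ t ∈ S, ∀ v ∈ A t, B v (f t) = 0
  m_mem : ∀ t ∈ S, m t ∈ S
  m_m : ∀ t ∈ S, m (m t) = t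
  m_D : ∀ t ∈ S, (m t ∈ D ↔ t ∈ D)
  orth : κ = .orthogonal → ∀ t ∈ S, t ∈ D → m t ≠ t
  xe : ∀ t ∈ S, x (e t) = linkE e m D t
  xf : ∀ t ∈ S, x (f t) = linkF κ e f m D t

/-- The component of a vector orthogonal to the pairs `e s, f s`. -/
noncomputable def residual (B : LinearMap.BilinForm ℂ W) (S : Finset (Fin l)) (e f : Fin l → W) :
    W →ₗ[ℂ] W :=
  LinearMap.id - ∑ s ∈ S, ((B.flip (f s)).smulRight (e s) + (B (e s)).smulRight (f s))

lemma residual_apply (B : LinearMap.BilinForm ℂ W) (S : Finset (Fin l)) (e f : Fin l → W) (w : W) :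
    residual B S e f w = w - ∑ s ∈ S, (B w (f s) • e s + B (e s) w • f s) := by
  simp [residual]

variable {κ : FormKind} {B : LinearMap.BilinForm ℂ W} {x : W →ₗ[ℂ] W} {A : ℕ → Submodule ℂ W}

namespace NilFlag

variable (h : NilFlag κ l B x A)
include h

lemma swap {u v : W} (huv : B u v = 0) : B v u = 0 := by
  rw [h.symm, huv, mul_zero]

lemma isRefl : B.IsRefl := fun _ _ huv => h.swap huv

lemma eq_zero {v : W} (hv : ∀ w, B w v = 0) : v = 0 := h.nondeg.2 v hv

/-- Nondegeneracy gives `N = Nᗮᗮ`, so some vector of `Nᗮ` pairs nontrivially with `v`. This is the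
source of all the vectors `f` below. -/
lemma exists_dual [FiniteDimensional ℂ W] {N : Submodule ℂ W} {v : W} (hv : v ∉ N) :
    ∃ f, B v f = 1 ∧ ∀ u ∈ N, B u f = 0 := by
  rw [← LinearMap.BilinForm.orthogonal_orthogonal h.nondeg h.isRefl N,
    LinearMap.BilinForm.mem_orthogonal_iff] at hv
  push Not at hv
  obtain ⟨f, hf, hfv⟩ := hv
  have hvf : B v f ≠ 0 := fun h0 => hfv (h.swap h0)
  refine ⟨(B v f)⁻¹ • f, by simp [hvf], fun u hu => ?_⟩
  rw [map_smul, (LinearMap.BilinForm.mem_orthogonal_iff.1 hf) u hu, smul_zero]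

lemma le_succ_sup [FiniteDimensional ℂ W] {j : ℕ} {v : W} (hv : v ∈ A (j + 1)) (hv' : v ∉ A j) :
    A (j + 1) = A j ⊔ Submodule.span ℂ {v} := by
  symm
  apply Submodule.eq_of_le_of_finrank_le
  · exact sup_le (h.mono (Nat.le_succ j)) ((Submodule.span_singleton_le_iff_mem _ _).2 hv)
  · have hlt : A j < A j ⊔ Submodule.span ℂ {v} := by
      refine lt_of_le_of_ne le_sup_left fun heq => hv' ?_
      rw [heq]
      exact Submodule.mem_sup_right (Submodule.mem_span_singleton_self v)
    have := Submodule.finrank_lt_finrank_of_lt hlt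
    rw [h.finrank] at this ⊢
    omega

lemma exists_mem_succ {j : ℕ} (hj : j < l) : ∃ v ∈ A (j + 1), v ∉ A j := by
  by_contra! hc
  have : A (j + 1) = A j := le_antisymm hc (h.mono (Nat.le_succ j))
  have h1 := h.finrank (j + 1)
  rw [this, h.finrank j] at h1
  omega

lemma iso' {i j : ℕ} {u v : W} (hu : u ∈ A i) (hv : v ∈ A j) : B u v = 0 :=
  h.iso (max i j) u (h.mono (le_max_left i j) hu) v (h.mono (le_max_right i j) hv)

variable {S : Finset (Fin l)} {e f : Fin l → W} {m : Fin l → Fin l} {D : Set (Fin l)}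
  (hP : PartialNF κ B x A S e f m D)
include hP

lemma fe {s t : Fin l} (hs : s ∈ S) (ht : t ∈ S) : B (f s) (e t) = if s = t then κ.sgn else 0 := by
  rw [h.symm, hP.ef t ht s hs]
  simp [eq_comm]

omit h in
lemma residual_e {t : Fin l} (ht : t ∈ S) : residual B S e f (e t) = 0 := by
  rw [residual_apply, sub_eq_zero]
  rw [Finset.sum_eq_single_of_mem t ht]
  · simp [hP.ef t ht t ht, hP.ee t ht t ht]
  · intro s hs hst
    simp [hP.ef t ht s hs, hP.ee s hs t ht, Ne.symm hst]

omit h in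
lemma residual_f {t : Fin l} (ht : t ∈ S) : residual B S e f (f t) = 0 := by
  rw [residual_apply, sub_eq_zero]
  rw [Finset.sum_eq_single_of_mem t ht]
  · simp [hP.ef t ht t ht, hP.ff t ht t ht]
  · intro s hs hst
    simp [hP.ef s hs t ht, hP.ff t ht s hs, hst]

omit h in
lemma residual_perp_e (w : W) {t : Fin l} (ht : t ∈ S) : B (e t) (residual B S e f w) = 0 := by
  rw [residual_apply, map_sub, map_sum, Finset.sum_eq_single_of_mem t ht]
  · simp [hP.ef t ht t ht, hP.ee t ht t ht]
  · intro s hs hst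
    simp [hP.ef t ht s hs, hP.ee t ht s hs, Ne.symm hst]

lemma residual_perp_f (w : W) {t : Fin l} (ht : t ∈ S) : B (f t) (residual B S e f w) = 0 := by
  rw [residual_apply, map_sub, map_sum, Finset.sum_eq_single_of_mem t ht]
  · simp only [map_add, map_smul, h.fe hP ht ht, hP.ff t ht t ht, smul_eq_mul, if_true]
    rw [h.symm (f t) w]
    ring
  · intro s hs hst
    simp [h.fe hP ht hs, hP.ff t ht s hs, Ne.symm hst]

end NilFlag

/-- The span of the pairs `e s, f s`, as the kernel of the complementary projection. -/
noncomputable def pairSpan (B : LinearMap.BilinForm ℂ W) (S : Finset (Fin l)) (e f : Fin l → W) :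
    Submodule ℂ W := LinearMap.ker (residual B S e f)

namespace NilFlag

variable (h : NilFlag κ l B x A)
variable {S : Finset (Fin l)} {e f : Fin l → W} {m : Fin l → Fin l} {D : Set (Fin l)}

omit h in
lemma pairSpan_repr {u : W} (hu : u ∈ pairSpan B S e f) :
    u = ∑ s ∈ S, (B u (f s) • e s + B (e s) u • f s) := by
  have := LinearMap.mem_ker.1 hu
  rwa [residual_apply, sub_eq_zero] at this

variable (hP : PartialNF κ B x A S e f m D)
include h hP

omit h in
lemma e_mem_pairSpan {t : Fin l} (ht : t ∈ S) : e t ∈ pairSpan B S e f := residual_e hP ht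

omit h in
lemma f_mem_pairSpan {t : Fin l} (ht : t ∈ S) : f t ∈ pairSpan B S e f := residual_f hP ht

omit h in
lemma sub_residual_mem (w : W) : w - residual B S e f w ∈ pairSpan B S e f := by
  have : w - residual B S e f w = ∑ s ∈ S, (B w (f s) • e s + B (e s) w • f s) := by
    rw [residual_apply]; abel
  rw [this]
  exact Submodule.sum_mem _ fun s hs => Submodule.add_mem _
    (Submodule.smul_mem _ _ (e_mem_pairSpan hP hs))
    (Submodule.smul_mem _ _ (f_mem_pairSpan hP hs))

omit h hP in
lemma perp_of {w : W} (he : ∀ s ∈ S, B (e s) w = 0) (hf : ∀ s ∈ S, B (f s) w = 0) :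
    ∀ u ∈ pairSpan B S e f, B u w = 0 := by
  intro u hu
  rw [pairSpan_repr hu]
  simp only [map_sum, map_add, map_smul, LinearMap.sum_apply, LinearMap.add_apply,
    LinearMap.smul_apply]
  exact Finset.sum_eq_zero fun s hs => by rw [he s hs, hf s hs]; simp

lemma residual_perp (w : W) : ∀ u ∈ pairSpan B S e f, B u (residual B S e f w) = 0 :=
  perp_of (fun _ hs => residual_perp_e hP w hs) (fun _ hs => h.residual_perp_f hP w hs)

/-- The span of the pairs is nondegenerate: the coefficients of `w` are its pairings with the `e s`
and `f s`. -/
lemma eq_zero_of_mem_of_perp {w : W} (hw : w ∈ pairSpan B S e f)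
    (hw' : ∀ u ∈ pairSpan B S e f, B u w = 0) : w = 0 := by
  rw [pairSpan_repr hw]
  refine Finset.sum_eq_zero fun s hs => ?_
  rw [hw' _ (e_mem_pairSpan hP hs), h.swap (hw' _ (f_mem_pairSpan hP hs))]
  simp

lemma x_mem_pairSpan {u : W} (hu : u ∈ pairSpan B S e f) : x u ∈ pairSpan B S e f := by
  rw [pairSpan_repr hu, map_sum]
  refine Submodule.sum_mem _ fun s hs => ?_
  rw [map_add, map_smul, map_smul, hP.xe s hs, hP.xf s hs]
  have he := e_mem_pairSpan hP (hP.m_mem s hs)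
  have hf := f_mem_pairSpan hP (hP.m_mem s hs)
  refine Submodule.add_mem _ (Submodule.smul_mem _ _ ?_) (Submodule.smul_mem _ _ ?_)
  · unfold linkE; split_ifs
    exacts [he, Submodule.zero_mem _]
  · unfold linkF
    cases κ <;> simp only <;> split_ifs <;>
      first | exact he | exact Submodule.neg_mem _ he | exact Submodule.neg_mem _ hf
            | exact Submodule.zero_mem _

lemma x_perp {w : W} (hw : ∀ u ∈ pairSpan B S e f, B u w = 0) :
    ∀ u ∈ pairSpan B S e f, B u (x w) = 0 := by
  intro u hu
  have := h.skew u w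
  rw [hw _ (h.x_mem_pairSpan hP hu)] at this
  exact neg_eq_zero.1 this.symm

/-- Compatibility of the pairs with the flag: points are numbered from `0`, so `e s` appears in `A
(s+1)` while `f s` kills `A s`. This dichotomy makes the projection preserve `A j` and its
orthogonal. -/
lemma coeff_cases {j : ℕ} {w : W} (hw : w ∈ A j) {s : Fin l} (hs : s ∈ S) :
    B w (f s) = 0 ∨ e s ∈ A j := by
  rcases le_or_gt j s with hjs | hjs
  · exact Or.inl (hP.f_perp s hs w (h.mono hjs hw))
  · exact Or.inr (h.mono hjs (hP.e_mem s hs))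

lemma residual_mem {j : ℕ} {w : W} (hw : w ∈ A j) : residual B S e f w ∈ A j := by
  rw [residual_apply]
  refine Submodule.sub_mem _ hw (Submodule.sum_mem _ fun s hs => ?_)
  rw [h.iso' (hP.e_mem s hs) hw, zero_smul, add_zero]
  rcases h.coeff_cases hP hw hs with h0 | h0
  · rw [h0, zero_smul]; exact Submodule.zero_mem _
  · exact Submodule.smul_mem _ _ h0

lemma residual_mem_orthogonal {j : ℕ} {w : W} (hw : w ∈ B.orthogonal (A j)) :
    residual B S e f w ∈ B.orthogonal (A j) := by
  rw [LinearMap.BilinForm.mem_orthogonal_iff] at hw ⊢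
  intro v hv
  rw [residual_apply, map_sub, hw v hv, zero_sub, neg_eq_zero, map_sum]
  refine Finset.sum_eq_zero fun s hs => ?_
  rw [map_add, map_smul, map_smul, h.iso' hv (hP.e_mem s hs), smul_zero, zero_add]
  rcases h.coeff_cases hP hv hs with h0 | h0
  · rw [h0, smul_zero]
  · rw [hw _ h0, zero_smul]

/-- A vector orthogonal to the pairs which lies in `x N + U` is the image of a vector of `N`
orthogonal to the pairs. -/
lemma exists_of_mem_map_sup {N : Submodule ℂ W}
    (hN : ∀ w ∈ N, residual B S e f w ∈ N) {v : W} (hv : ∀ u ∈ pairSpan B S e f, B u v = 0)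
    (hv' : v ∈ N.map x ⊔ pairSpan B S e f) :
    ∃ w ∈ N, (∀ u ∈ pairSpan B S e f, B u w = 0) ∧ x w = v := by
  obtain ⟨y, hy, u, hu, rfl⟩ := Submodule.mem_sup.1 hv'
  obtain ⟨w, hw, rfl⟩ := hy
  refine ⟨_, hN w hw, h.residual_perp hP w, ?_⟩
  -- This difference lies in the span of the pairs and is also orthogonal to it, hence vanishes.
  have h1 : x w + u - x (residual B S e f w) ∈ pairSpan B S e f := by
    have := Submodule.add_mem _ (h.x_mem_pairSpan hP (sub_residual_mem hP w)) hu
    rw [map_sub] at this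
    convert this using 1
    abel
  have h2 := h.eq_zero_of_mem_of_perp hP h1 (fun u' hu' => by
    rw [map_sub, hv u' hu', h.x_perp hP (h.residual_perp hP w) u' hu', sub_zero])
  exact (sub_eq_zero.1 h2).symm

/-- Since `f s` kills `A s` but not `e s`, each `e s` is the new direction of `A (s+1)`; thus `A a`
is spanned by the `e s` with `s < a`. -/
lemma flag_le_pairSpan [FiniteDimensional ℂ W] {a : ℕ} (ha : a ≤ l)
    (hS : ∀ s : Fin l, s.1 < a → s ∈ S) : A a ≤ pairSpan B S e f := by
  induction a with
  | zero =>
    have : A 0 = ⊥ := Submodule.finrank_eq_zero.1 (by rw [h.finrank]; simp)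
    rw [this]; exact bot_le
  | succ a ih =>
    have hs := hS ⟨a, ha⟩ (Nat.lt_succ_self a)
    rw [h.le_succ_sup (hP.e_mem _ hs)]
    · refine sup_le (ih (by omega) fun s hs => hS s (by omega)) ?_
      rw [Submodule.span_singleton_le_iff_mem]
      exact e_mem_pairSpan hP hs
    · intro hmem
      have h1 := hP.f_perp _ hs _ hmem
      rw [hP.ef _ hs _ hs] at h1
      simp at h1

end NilFlag
end Links
-- Elementary link patterns, and splitting off a free point or a link without dot.
section Existence

variable {W : Type*} [AddCommGroup W] [Module ℂ W] {l : ℕ}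
variable {κ : FormKind} {B : LinearMap.BilinForm ℂ W} {x : W →ₗ[ℂ] W} {A : ℕ → Submodule ℂ W}

namespace PartialNF

lemma single_free {a : Fin l} {e f : W} (hee : B e e = 0) (hff : B f f = 0) (hef : B e f = 1)
    (he : e ∈ A (a + 1)) (hf : ∀ v ∈ A a, B v f = 0) (hxe : x e = 0) (hxf : x f = 0) :
    PartialNF κ B x A {a} (fun _ => e) (fun _ => f) (fun _ => a) ∅ := by
  constructor <;> simp_all [linkE, linkF]

lemma single_loop {a : Fin l} {e f : W} (hκ : κ = .symplectic) (hee : B e e = 0)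
    (hff : B f f = 0) (hef : B e f = 1)
    (he : e ∈ A (a + 1)) (hf : ∀ v ∈ A a, B v f = 0) (hxe : x e = 0) (hxf : x f = e) :
    PartialNF κ B x A {a} (fun _ => e) (fun _ => f) (fun _ => a) Set.univ := by
  subst hκ
  constructor <;> simp_all [linkE, linkF]

lemma pair_plain {a t : Fin l} (hat : a < t) {e e' f f' : W} (hee : B e e = 0)
    (hee' : B e e' = 0) (he'e : B e' e = 0) (he'e' : B e' e' = 0) (hff : B f f = 0)
    (hff' : B f f' = 0) (hf'f : B f' f = 0) (hf'f' : B f' f' = 0) (hef : B e f = 1)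
    (hef' : B e f' = 0) (he'f : B e' f = 0) (he'f' : B e' f' = 1)
    (he : e ∈ A (a + 1)) (hf : ∀ v ∈ A a, B v f = 0)
    (he' : e' ∈ A (t + 1)) (hf' : ∀ v ∈ A t, B v f' = 0)
    (hxe : x e = 0) (hxe' : x e' = e) (hxf : x f = -f') (hxf' : x f' = 0) :
    PartialNF κ B x A {a, t} (fun s => if s = a then e else e') (fun s => if s = a then f else f')
      (fun s => if s = a then t else a) ∅ := by
  have hne : t ≠ a := hat.ne'
  have hlt : ¬ t < a := hat.not_gt
  constructor <;> simp_all [linkE, linkF, hat.ne]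

/-- The sign in `x f` is forced by skewness: `⟨x f, f'⟩ = -⟨f, e⟩ = -κ.sgn`. It gives `e'` in the
symplectic and `-e'` in the orthogonal case. -/
lemma pair_dot {a t : Fin l} (hat : a < t) {e e' f f' : W} (hee : B e e = 0)
    (hee' : B e e' = 0) (he'e : B e' e = 0) (he'e' : B e' e' = 0) (hff : B f f = 0)
    (hff' : B f f' = 0) (hf'f : B f' f = 0) (hf'f' : B f' f' = 0) (hef : B e f = 1)
    (hef' : B e f' = 0) (he'f : B e' f = 0) (he'f' : B e' f' = 1)
    (he : e ∈ A (a + 1)) (hf : ∀ v ∈ A a, B v f = 0)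
    (he' : e' ∈ A (t + 1)) (hf' : ∀ v ∈ A t, B v f' = 0)
    (hxe : x e = 0) (hxe' : x e' = 0) (hxf : x f = -κ.sgn • e') (hxf' : x f' = e) :
    PartialNF κ B x A {a, t} (fun s => if s = a then e else e') (fun s => if s = a then f else f')
      (fun s => if s = a then t else a) Set.univ := by
  have hne : t ≠ a := hat.ne'
  have hlt : ¬ t < a := hat.not_gt
  constructor <;> cases κ <;> simp_all [linkE, linkF, hat.ne, FormKind.sgn]

open Classical in
/-- Two partial normal forms on disjoint sets, orthogonal to each other, can be combined. -/
lemma union (h : NilFlag κ l B x A) {S S' : Finset (Fin l)} (hS : Disjoint S S')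
    {e f e' f' : Fin l → W} {m m' : Fin l → Fin l} {D D' : Set (Fin l)}
    (hP : PartialNF κ B x A S e f m D) (hP' : PartialNF κ B x A S' e' f' m' D')
    (hperp : ∀ s ∈ S', ∀ u ∈ pairSpan B S e f, B u (e' s) = 0 ∧ B u (f' s) = 0) :
    PartialNF κ B x A (S ∪ S') (fun s => if s ∈ S then e s else e' s)
      (fun s => if s ∈ S then f s else f' s) (fun s => if s ∈ S then m s else m' s)
      {s | if s ∈ S then s ∈ D else s ∈ D'} := by
  have hdis : ∀ {s}, s ∈ S' → s ∉ S := fun hs hs' => Finset.disjoint_left.1 hS hs' hs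
  have hU : ∀ {s}, s ∈ S → ∀ {t}, t ∈ S' → B (e s) (e' t) = 0 ∧ B (e s) (f' t) = 0 ∧
      B (f s) (e' t) = 0 ∧ B (f s) (f' t) = 0 := fun hs _ ht =>
    ⟨(hperp _ ht _ (NilFlag.e_mem_pairSpan hP hs)).1, (hperp _ ht _ (NilFlag.e_mem_pairSpan hP hs)).2,
      (hperp _ ht _ (NilFlag.f_mem_pairSpan hP hs)).1, (hperp _ ht _ (NilFlag.f_mem_pairSpan hP hs)).2⟩
  have key : ∀ {p : Fin l → Prop}, (∀ s ∈ S, p s) → (∀ s ∈ S', p s) → ∀ s ∈ S ∪ S', p s :=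
    fun h1 h2 s hs => (Finset.mem_union.1 hs).elim (h1 s) (h2 s)
  constructor
  · refine key (fun s hs => key (fun t ht => ?_) fun t ht => ?_)
      fun s hs => key (fun t ht => ?_) fun t ht => ?_
    · simp [hs, ht, hP.ee s hs t ht]
    · simp [hs, hdis ht, (hU hs ht).1]
    · simp [ht, hdis hs, h.swap (hU ht hs).1]
    · simp [hdis hs, hdis ht, hP'.ee s hs t ht]
  · refine key (fun s hs => key (fun t ht => ?_) fun t ht => ?_)
      fun s hs => key (fun t ht => ?_) fun t ht => ?_
    · simp [hs, ht, hP.ff s hs t ht]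
    · simp [hs, hdis ht, (hU hs ht).2.2.2]
    · simp [ht, hdis hs, h.swap (hU ht hs).2.2.2]
    · simp [hdis hs, hdis ht, hP'.ff s hs t ht]
  · refine key (fun s hs => key (fun t ht => ?_) fun t ht => ?_)
      fun s hs => key (fun t ht => ?_) fun t ht => ?_
    · simp [hs, ht, hP.ef s hs t ht]
    · have : s ≠ t := fun hst => hdis ht (hst ▸ hs)
      simp [hs, hdis ht, (hU hs ht).2.1, this]
    · have : s ≠ t := fun hst => hdis hs (hst ▸ ht)
      simp [ht, hdis hs, h.swap (hU ht hs).2.2.1, this]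
    · simp [hdis hs, hdis ht, hP'.ef s hs t ht]
  · exact key (fun s hs => by simpa [hs] using hP.e_mem s hs)
      fun s hs => by simpa [hdis hs] using hP'.e_mem s hs
  · exact key (fun s hs => by simpa [hs] using hP.f_perp s hs)
      fun s hs => by simpa [hdis hs] using hP'.f_perp s hs
  · exact key (fun s hs => by simp [hs, hP.m_mem s hs])
      fun s hs => by simp [hdis hs, hP'.m_mem s hs]
  · exact key (fun s hs => by simp [hs, hP.m_mem s hs, hP.m_m s hs])
      fun s hs => by simp [hdis hs, hdis (hP'.m_mem s hs), hP'.m_m s hs]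
  · exact key (fun s hs => by simp [hs, hP.m_mem s hs, hP.m_D s hs])
      fun s hs => by simp [hdis hs, hdis (hP'.m_mem s hs), hP'.m_D s hs]
  · exact fun hκ => key (fun s hs => by simpa [hs] using hP.orth hκ s hs)
      fun s hs => by simpa [hdis hs] using hP'.orth hκ s hs
  · exact key (fun s hs => by simp [hs, hP.m_mem s hs, hP.xe s hs, linkE])
      fun s hs => by simp [hdis hs, hdis (hP'.m_mem s hs), hP'.xe s hs, linkE]
  · refine key (fun s hs => ?_) fun s hs => ?_
    · simp [hs, hP.m_mem s hs, hP.xf s hs, linkF]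
    · simp [hdis hs, hdis (hP'.m_mem s hs), hP'.xf s hs, linkF]

end PartialNF

namespace NilFlag

variable [FiniteDimensional ℂ W] (h : NilFlag κ l B x A)
variable {S : Finset (Fin l)} {e f : Fin l → W} {m : Fin l → Fin l} {D : Set (Fin l)}
  (hP : PartialNF κ B x A S e f m D)

/-- There is a partial normal form on a nonempty set disjoint from `S`, orthogonal to the given
one. -/
def Extends (κ : FormKind) (B : LinearMap.BilinForm ℂ W) (x : W →ₗ[ℂ] W)
    (A : ℕ → Submodule ℂ W) (S : Finset (Fin l)) (U : Submodule ℂ W) : Prop :=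
  ∃ (S' : Finset (Fin l)) (e' f' : Fin l → W) (m' : Fin l → Fin l) (D' : Set (Fin l)),
    S'.Nonempty ∧ Disjoint S S' ∧ PartialNF κ B x A S' e' f' m' D' ∧
    ∀ s ∈ S', ∀ u ∈ U, B u (e' s) = 0 ∧ B u (f' s) = 0

include h hP

/-- The first vector of the flag orthogonal to the pairs. -/
lemma exists_first {a : Fin l} (ha : a ∉ S) (hmin : ∀ s < a, s ∈ S) :
    ∃ v ∈ A (a + 1), v ≠ 0 ∧ v ∉ A a ∧ (∀ u ∈ pairSpan B S e f, B u v = 0) ∧ x v = 0 := by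
  obtain ⟨w, hw, hw'⟩ := h.exists_mem_succ a.2
  have hAU : A a ≤ pairSpan B S e f := h.flag_le_pairSpan hP a.2.le fun s hs => hmin s hs
  set v := residual B S e f w with hv
  have hvA : v ∈ A (a + 1) := h.residual_mem hP hw
  have hperp := h.residual_perp hP w
  have hv0 : v ≠ 0 := by
    intro h0
    apply hw'
    -- If the projection vanished, `w` would be a combination of the `e s`. Those with `s < a` lie
    -- in `A a`; for `s > a` the coefficient is zero because `f s` kills `A (a+1)`.
    rw [pairSpan_repr (show w ∈ pairSpan B S e f from h0)]
    refine Submodule.sum_mem _ fun s hs => ?_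
    rw [h.iso' (hP.e_mem s hs) hw, zero_smul, add_zero]
    rcases lt_or_ge s.1 a.1 with hsa | hsa
    · exact Submodule.smul_mem _ _ (h.mono hsa (hP.e_mem s hs))
    · have hne : s.1 ≠ a.1 := fun heq => ha (Fin.ext heq ▸ hs)
      rw [hP.f_perp s hs w (h.mono (by omega) hw), zero_smul]
      exact Submodule.zero_mem _
  have hvn : v ∉ A a := fun hmem => hv0 (h.eq_zero_of_mem_of_perp hP (hAU hmem) hperp)
  refine ⟨v, hvA, hv0, hvn, hperp, ?_⟩
  -- Here `A (a+1) = A a + ℂ v`, and `x v` is orthogonal to the pairs, whose span contains `A a`. So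
  -- `x v = c v`, and nilpotency gives `c = 0`.
  have hxv := h.stable _ v hvA
  rw [h.le_succ_sup hvA hvn] at hxv
  obtain ⟨y, hy, z, hz, hyz⟩ := Submodule.mem_sup.1 hxv
  obtain ⟨c, rfl⟩ := Submodule.mem_span_singleton.1 hz
  have hy0 : y = 0 := by
    refine h.eq_zero_of_mem_of_perp hP (hAU hy) fun u hu => ?_
    rw [eq_sub_of_add_eq hyz, map_sub, h.x_perp hP hperp u hu, map_smul, hperp u hu]
    simp
  rw [hy0, zero_add] at hyz
  have h2 := h.sq v
  rw [← hyz, map_smul, ← hyz, smul_smul] at h2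
  rcases smul_eq_zero.1 h2 with hc | hc
  · rw [← hyz, mul_self_eq_zero.1 hc, zero_smul]
  · exact absurd hc hv0

variable {a : Fin l} (ha : a ∉ S) (hmin : ∀ s < a, s ∈ S) {v : W} (hvA : v ∈ A (a + 1))
  (hvn : v ∉ A a) (hvp : ∀ u ∈ pairSpan B S e f, B u v = 0) (hxv : x v = 0)
include ha hmin hvA hvp

omit ha hvA hvp in
lemma perp_flag {w : W} (hw : ∀ u ∈ pairSpan B S e f, B u w = 0) : ∀ u ∈ A a, B u w = 0 :=
  fun u hu => hw u (h.flag_le_pairSpan hP a.2.le (fun s hs => hmin s hs) hu)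

include hxv

/-- A vector `g` with `⟨v, g⟩ = 1` that is orthogonal to the image of `x` is killed by `x`, by
skewness. Adding a multiple of `v` makes it isotropic, so `v` and the corrected `g` form a free
pair. -/
lemma extends_free (hv : v ∉ LinearMap.range x ⊔ pairSpan B S e f) :
    Extends κ B x A S (pairSpan B S e f) := by
  obtain ⟨g, hg, hgp⟩ := h.exists_dual hv
  have hxg : x g = 0 := h.eq_zero fun w => by
    have := h.skew w g
    rw [hgp _ (Submodule.mem_sup_left ⟨w, rfl⟩)] at this
    exact neg_eq_zero.1 this.symm
  have hgU : ∀ u ∈ pairSpan B S e f, B u g = 0 := fun u hu => hgp u (Submodule.mem_sup_right hu)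
  have hvv : B v v = 0 := h.iso' hvA hvA
  have hgv : B g v = κ.sgn := by rw [h.symm, hg, mul_one]
  -- The equation for `⟨g + c v, g + c v⟩ = 0`; an alternating form needs no correction.
  obtain ⟨c, hc⟩ : ∃ c : ℂ, B g g + c + c * κ.sgn = 0 := by
    cases κ
    · have := h.symm g g
      simp only [FormKind.sgn] at this ⊢
      exact ⟨0, by linear_combination (1/2) * this⟩
    · exact ⟨-(B g g) / 2, by simp only [FormKind.sgn]; ring⟩
  have hUg' : ∀ u ∈ pairSpan B S e f, B u (g + c • v) = 0 := fun u hu => by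
    rw [map_add, hgU u hu, map_smul, hvp u hu]; simp
  refine ⟨{a}, _, _, _, _, by simp, by simpa using ha,
    PartialNF.single_free (e := v) (f := g + c • v) hvv ?_ ?_ hvA
      (h.perp_flag hP hmin hUg') hxv ?_, fun s _ u hu => ⟨hvp u hu, hUg' u hu⟩⟩
  · simp only [map_add, map_smul, LinearMap.add_apply, LinearMap.smul_apply, smul_eq_mul, hg, hvv,
      hgv]
    linear_combination hc
  · simp [hg, hvv]
  · simp [hxg, hxv]

include hvn

/-- With `t` the step at which `v` becomes an image, write `v = x w` with `w ∈ A (t+1) \ A t`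
orthogonal to the pairs. A dual vector `g` of `v` that kills `x (A t)` is corrected to `F`, and `(v,
F)`, `(w, -x F)` are linked without dot. -/
lemma extends_plain {t : ℕ} (htl : t < l) (hv : v ∈ (A (t + 1)).map x ⊔ pairSpan B S e f)
    (hv' : v ∉ (A t).map x ⊔ pairSpan B S e f) :
    Extends κ B x A S (pairSpan B S e f) := by
  have hv0 : v ≠ 0 := fun h0 => hvn (h0 ▸ Submodule.zero_mem _)
  obtain ⟨w, hwA, hwp, hxw⟩ :=
    h.exists_of_mem_map_sup hP (fun w hw => h.residual_mem hP hw) hvp hv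
  have hwn : w ∉ A t := fun hmem => hv' (hxw ▸ Submodule.mem_sup_left ⟨w, hmem, rfl⟩)
  -- If `t` were already used, then `A (t+1) = A t + ℂ e_t`, and orthogonality of `w` to `f_t` would
  -- put `w` into `A t`.
  have htS : (⟨t, htl⟩ : Fin l) ∉ S := by
    intro ht
    have het := hP.e_mem _ ht
    have het' : e ⟨t, htl⟩ ∉ A t := fun hmem => by
      have h1 := hP.f_perp _ ht _ hmem
      rw [hP.ef _ ht _ ht] at h1
      simp at h1
    rw [h.le_succ_sup het het'] at hwA
    obtain ⟨y, hy, z, hz, hyz⟩ := Submodule.mem_sup.1 hwA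
    obtain ⟨c, rfl⟩ := Submodule.mem_span_singleton.1 hz
    have h2 := h.swap (hwp _ (f_mem_pairSpan hP ht))
    rw [← hyz, map_add, LinearMap.add_apply, hP.f_perp _ ht y hy, map_smul, LinearMap.smul_apply,
      hP.ef _ ht _ ht] at h2
    have hc : c = 0 := by simpa using h2
    rw [hc, zero_smul, add_zero] at hyz
    exact hwn (hyz ▸ hy)
  have hat : a.1 ≤ t := by
    by_contra hlt
    exact htS (hmin ⟨t, htl⟩ (by simpa [Fin.lt_def] using hlt))
  -- For `t = a` the vector `w` would be a multiple of `v`, contradicting `x w = v ≠ 0 = x v`.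
  have hat' : a.1 ≠ t := by
    intro heq
    have hwA' : w ∈ A (a.1 + 1) := by rw [heq]; exact hwA
    rw [h.le_succ_sup hvA hvn] at hwA'
    obtain ⟨y, hy, z, hz, hyz⟩ := Submodule.mem_sup.1 hwA'
    obtain ⟨c, rfl⟩ := Submodule.mem_span_singleton.1 hz
    have hy0 : y = 0 := by
      refine h.eq_zero_of_mem_of_perp hP
        (h.flag_le_pairSpan hP a.2.le (fun s hs => hmin s hs) hy) fun u hu => ?_
      rw [eq_sub_of_add_eq hyz, map_sub, hwp u hu, map_smul, hvp u hu]
      simp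
    rw [← hyz, hy0, zero_add, map_smul, hxv, smul_zero] at hxw
    exact hv0 hxw.symm
  have hlt : a < ⟨t, htl⟩ := by rw [Fin.lt_def]; exact lt_of_le_of_ne hat hat'
  obtain ⟨g, hg, hgp⟩ := h.exists_dual hv'
  have hgU : ∀ u ∈ pairSpan B S e f, B u g = 0 := fun u hu => hgp u (Submodule.mem_sup_right hu)
  have hgA : ∀ u ∈ A t, B u (x g) = 0 := fun u hu => by
    have := h.skew u g
    rw [hgp _ (Submodule.mem_sup_left ⟨u, hu, rfl⟩)] at this
    exact neg_eq_zero.1 this.symm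
  have hxgU := h.x_perp hP hgU
  have hvv : B v v = 0 := h.iso' hvA hvA
  have hvw : B v w = 0 := h.iso' hvA hwA
  have hwv : B w v = 0 := h.iso' hwA hvA
  have hww : B w w = 0 := h.iso' hwA hwA
  have hgv : B g v = κ.sgn := by rw [h.symm, hg, mul_one]
  have hwxg : B w (x g) = -1 := by
    have := h.skew w g
    rw [hxw, hg] at this
    linear_combination this
  have hxgw : B (x g) w = -κ.sgn := by rw [h.symm, hwxg]; ring
  have hvxg : B v (x g) = 0 := by
    have := h.skew v g
    rw [hxv] at this
    simpa using this.symm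
  have hxgv := h.swap hvxg
  have hxgxg : B (x g) (x g) = 0 := by rw [h.skew, h.sq]; simp
  have hgw := h.symm g w
  have hxgg := h.symm (x g) g
  have hskg := h.skew g g
  have hs2 := κ.sgn_mul_self
  -- The multiple of `w` that achieves `⟨F, x F⟩ = 0`. In the orthogonal case `⟨g, x g⟩ = 0` already
  -- holds by skewness.
  obtain ⟨c, hc⟩ : ∃ c : ℂ, B g (x g) + c * κ.sgn - c = 0 := by
    cases κ
    · exact ⟨B g (x g) / 2, by simp only [FormKind.sgn]; ring⟩
    · simp only [FormKind.sgn] at hxgg ⊢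
      exact ⟨0, by linear_combination (1/2) * hskg - (1/2) * hxgg⟩
  -- Since `⟨w, x g⟩ = -1`, adding `b • x g` makes `g` orthogonal to `w`.
  set b : ℂ := B w g with hb
  -- The last correction, by `v`, makes `F` isotropic without disturbing the other conditions,
  -- because `v` is orthogonal to `v`, `w` and `x G`.
  obtain ⟨d, hd⟩ : ∃ d : ℂ, ∀ G, G = g + c • w + b • x g → B G G + d + d * κ.sgn = 0 := by
    cases κ
    · refine ⟨0, fun G _ => ?_⟩
      have := h.symm G G
      simp only [FormKind.sgn] at this ⊢
      linear_combination (1/2) * this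
    · refine ⟨-(B (g + c • w + b • x g) (g + c • w + b • x g)) / 2, fun G hG => ?_⟩
      rw [hG]; simp only [FormKind.sgn]; ring
  set G := g + c • w + b • x g with hG
  have hGG := hd G rfl
  set F := G + d • v with hF
  have hxG : x G = x g + c • v := by
    simp only [hG, map_add, map_smul, hxw, h.sq]; simp
  have hvG : B v G = 1 := by
    simp only [hG, map_add, map_smul, smul_eq_mul, hg, hvw, hvxg]; ring
  have hGv : B G v = κ.sgn := by rw [h.symm, hvG, mul_one]
  have hwG : B w G = 0 := by
    simp only [hG, map_add, map_smul, smul_eq_mul, hww, hwxg]; ring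
  have hGF' : B G (x G) = 0 := by
    rw [hxG, map_add, map_smul, hGv]
    simp only [hG, map_add, map_smul, LinearMap.add_apply, LinearMap.smul_apply, smul_eq_mul, hwxg,
      hxgxg]
    linear_combination hc
  have hxF : x F = x G := by simp [hF, hxv]
  have hFU : ∀ u ∈ pairSpan B S e f, B u F = 0 := fun u hu => by
    simp only [hF, hG, map_add, map_smul, hgU u hu, hwp u hu, hxgU u hu, hvp u hu]; simp
  have hxFU := h.x_perp hP hFU
  have hvF : B v F = 1 := by simp [hF, hvG, hvv]
  have hwF : B w F = 0 := by simp [hF, hwG, hwv]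
  have hFF : B F F = 0 := by
    simp only [hF, map_add, map_smul, LinearMap.add_apply, LinearMap.smul_apply, smul_eq_mul, hvG,
      hvv, hGv]
    linear_combination hGG
  have hvxG : B v (x G) = 0 := by rw [hxG]; simp [hvxg, hvv]
  have hFxF : B F (x F) = 0 := by
    rw [hxF, hF, map_add, LinearMap.add_apply, hGF', map_smul, LinearMap.smul_apply, hvxG]; simp
  have hxFA : ∀ u ∈ A t, B u (x F) = 0 := fun u hu => by
    rw [hxF, hxG, map_add, hgA u hu, map_smul, h.iso' hu hvA]; simp
  have hxFxF : B (x F) (x F) = 0 := by rw [h.skew, h.sq]; simp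
  have hwxF : B w (x F) = -1 := by
    rw [hxF, hxG, map_add, hwxg, map_smul, hwv]; simp
  refine ⟨{a, ⟨t, htl⟩}, _, _, _, _, by simp, by simp [ha, htS],
    PartialNF.pair_plain hlt (e := v) (e' := w) (f := F) (f' := -x F) hvv hvw hwv hww hFF
      (by simp [hFxF]) (by simp [h.swap hFxF]) (by simp [hxFxF]) hvF (by simp [hxF, hvxG]) hwF
      (by simp [hwxF]) hvA (h.perp_flag hP hmin hFU) hwA
      (fun u hu => by simp [hxFA u hu]) hxv hxw (by simp) (by simp [h.sq]), fun s hs u hu => ?_⟩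
  by_cases hsa : s = a
  · simp [hsa, hvp u hu, hFU u hu]
  · simp [hsa, hwp u hu, hxFU u hu]

end NilFlag
end Existence
-- Splitting off links and loops with dots; the normal form for a complete flag.
section Existence2

variable {W : Type*} [AddCommGroup W] [Module ℂ W] {l : ℕ}
variable {κ : FormKind} {B : LinearMap.BilinForm ℂ W} {x : W →ₗ[ℂ] W} {A : ℕ → Submodule ℂ W}

namespace NilFlag

variable [FiniteDimensional ℂ W] (h : NilFlag κ l B x A)
variable {S : Finset (Fin l)} {e f : Fin l → W} {m : Fin l → Fin l} {D : Set (Fin l)}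
  (hP : PartialNF κ B x A S e f m D)

include h

lemma finrank_orthogonal_le : Module.finrank ℂ (B.orthogonal (A l)) ≤ l + 1 := by
  have := h.card_le
  rw [LinearMap.BilinForm.finrank_orthogonal h.nondeg, h.finrank]
  omega

include hP

/-- Otherwise `v = x w` with `w ∈ (A l)ᗮ \ A l`, so that `(A l)ᗮ = A l + ℂ w` for dimension reasons.
A dual vector `g` then has `x g = y + c w` with `y ∈ A l`. If `c = 0`, this contradicts `⟨w, x g⟩ =
-1`; if `c ≠ 0`, applying `x` gives `v = x (-c⁻¹ y)`. -/
lemma not_mem_map_orthogonal {v : W} (hvp : ∀ u ∈ pairSpan B S e f, B u v = 0)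
    (hv : v ∈ (B.orthogonal (A l)).map x ⊔ pairSpan B S e f) :
    v ∈ (A l).map x ⊔ pairSpan B S e f := by
  by_contra hv'
  obtain ⟨w, hwA, hwp, hxw⟩ :=
    h.exists_of_mem_map_sup hP (fun w hw => h.residual_mem_orthogonal hP hw) hvp hv
  have hwn : w ∉ A l := fun hmem => hv' (hxw ▸ Submodule.mem_sup_left ⟨w, hmem, rfl⟩)
  obtain ⟨g, hg, hgp⟩ := h.exists_dual hv'
  have hxg : x g ∈ B.orthogonal (A l) := by
    rw [LinearMap.BilinForm.mem_orthogonal_iff]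
    intro u hu
    have := h.skew u g
    rw [hgp _ (Submodule.mem_sup_left ⟨u, hu, rfl⟩)] at this
    exact neg_eq_zero.1 this.symm
  have hle : A l ≤ B.orthogonal (A l) := fun u hu =>
    LinearMap.BilinForm.mem_orthogonal_iff.2 fun u' hu' => h.iso' hu' hu
  have hsup : A l ⊔ Submodule.span ℂ {w} = B.orthogonal (A l) := by
    apply Submodule.eq_of_le_of_finrank_le
    · exact sup_le hle ((Submodule.span_singleton_le_iff_mem _ _).2 hwA)
    · have hlt : A l < A l ⊔ Submodule.span ℂ {w} := by
        refine lt_of_le_of_ne le_sup_left fun heq => hwn ?_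
        rw [heq]
        exact Submodule.mem_sup_right (Submodule.mem_span_singleton_self w)
      have h1 := Submodule.finrank_lt_finrank_of_lt hlt
      have h2 := h.finrank_orthogonal_le
      rw [h.finrank] at h1
      omega
  have hwxg : B w (x g) = -1 := by
    have := h.skew w g
    rw [hxw, hg] at this
    linear_combination this
  rw [← hsup] at hxg
  obtain ⟨y, hy, z, hz, hyz⟩ := Submodule.mem_sup.1 hxg
  obtain ⟨c, rfl⟩ := Submodule.mem_span_singleton.1 hz
  by_cases hc : c = 0
  · rw [hc, zero_smul, add_zero] at hyz
    rw [← hyz, h.swap (LinearMap.BilinForm.mem_orthogonal_iff.1 hwA y hy)] at hwxg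
    norm_num at hwxg
  · have h2 := h.sq g
    rw [← hyz, map_add, map_smul, hxw] at h2
    apply hv'
    refine Submodule.mem_sup_left ⟨-c⁻¹ • y, Submodule.smul_mem _ _ hy, ?_⟩
    rw [map_smul, eq_neg_of_add_eq_zero_left h2, smul_neg, neg_smul, neg_neg, smul_smul,
      inv_mul_cancel₀ hc, one_smul]

variable {a : Fin l} (ha : a ∉ S) (hmin : ∀ s < a, s ∈ S) {v : W} (hvA : v ∈ A (a + 1))
  (hvn : v ∉ A a) (hvp : ∀ u ∈ pairSpan B S e f, B u v = 0) (hxv : x v = 0)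
include ha hmin hvA hvp hxv hvn

/-- Here `⟨x w, w⟩ ≠ 0`, which skewness allows only for an alternating form. Rescaling `v` and `w`
by the same square root of `⟨v, w⟩⁻¹` normalizes the pair and keeps `x w = v`. -/
lemma extends_loop {w : W} (hwp : ∀ u ∈ pairSpan B S e f, B u w = 0) (hxw : x w = v)
    (hwn : w ∉ B.orthogonal (A (a + 1))) :
    Extends κ B x A S (pairSpan B S e f) := by
  have hvw : B v w ≠ 0 := by
    intro h0
    apply hwn
    rw [LinearMap.BilinForm.mem_orthogonal_iff]
    intro u hu
    rw [h.le_succ_sup hvA hvn] at hu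
    obtain ⟨y, hy, z, hz, rfl⟩ := Submodule.mem_sup.1 hu
    obtain ⟨c, rfl⟩ := Submodule.mem_span_singleton.1 hz
    rw [map_add, LinearMap.add_apply, h.perp_flag hP hmin hwp y hy, map_smul,
      LinearMap.smul_apply, h0]
    simp
  have hκ : κ = .symplectic := by
    cases κ
    · rfl
    · exfalso
      apply hvw
      have h1 := h.skew w w
      have h2 := h.symm v w
      simp only [FormKind.sgn] at h2
      rw [hxw] at h1
      linear_combination (1/2) * h1 + (1/2) * h2
  have hww : B w w = 0 := by
    have := h.symm w w
    simp only [hκ, FormKind.sgn] at this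
    linear_combination (1/2) * this
  obtain ⟨c, hc⟩ := IsAlgClosed.exists_pow_nat_eq (B v w)⁻¹ (n := 2) (by norm_num)
  have hcw : ∀ u ∈ pairSpan B S e f, B u (c • w) = 0 := fun u hu => by simp [hwp u hu]
  refine ⟨{a}, _, _, _, _, by simp, by simpa using ha,
    PartialNF.single_loop hκ (e := c • v) (f := c • w) ?_ ?_ ?_
      (Submodule.smul_mem _ _ hvA) (h.perp_flag hP hmin hcw) ?_ ?_,
    fun s _ u hu => ⟨by simp [hvp u hu], hcw u hu⟩⟩
  · simp [h.iso' hvA hvA]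
  · simp [hww]
  · simp only [map_smul, LinearMap.smul_apply, smul_eq_mul]
    rw [← mul_assoc, ← pow_two, hc, inv_mul_cancel₀ hvw]
  · simp [hxv]
  · simp [hxw]

/-- Now `v = x w` with `w ∈ (A t)ᗮ \ (A (t+1))ᗮ`. For `t = a` this is a loop. For `t > a` a
corrected dual vector `F` of `v` gives the link between `(v, F)` and `(e', w')`, where `e'` is `x F`
up to sign and `w'` is a correction of `w`. -/
lemma extends_dot {t : ℕ} (htl : t < l)
    (hv : v ∈ (B.orthogonal (A t)).map x ⊔ pairSpan B S e f)
    (hv' : v ∉ (B.orthogonal (A (t + 1))).map x ⊔ pairSpan B S e f) :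
    Extends κ B x A S (pairSpan B S e f) := by
  obtain ⟨w, hwA, hwp, hxw⟩ :=
    h.exists_of_mem_map_sup hP (fun w hw => h.residual_mem_orthogonal hP hw) hvp hv
  have hwn : w ∉ B.orthogonal (A (t + 1)) :=
    fun hmem => hv' (hxw ▸ Submodule.mem_sup_left ⟨w, hmem, rfl⟩)
  rw [LinearMap.BilinForm.mem_orthogonal_iff] at hwA
  have htS : (⟨t, htl⟩ : Fin l) ∉ S := by
    intro ht
    have het := hP.e_mem _ ht
    have het' : e ⟨t, htl⟩ ∉ A t := fun hmem => by
      have h1 := hP.f_perp _ ht _ hmem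
      rw [hP.ef _ ht _ ht] at h1
      simp at h1
    apply hwn
    rw [LinearMap.BilinForm.mem_orthogonal_iff]
    intro u hu
    rw [h.le_succ_sup het het'] at hu
    obtain ⟨y, hy, z, hz, rfl⟩ := Submodule.mem_sup.1 hu
    obtain ⟨c, rfl⟩ := Submodule.mem_span_singleton.1 hz
    rw [map_add, LinearMap.add_apply, hwA y hy, map_smul,
      LinearMap.smul_apply, hwp _ (e_mem_pairSpan hP ht)]
    simp
  have hat : a.1 ≤ t := by
    by_contra hlt
    exact htS (hmin ⟨t, htl⟩ (by simpa [Fin.lt_def] using hlt))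
  rcases eq_or_lt_of_le hat with rfl | hat'
  · exact h.extends_loop hP ha hmin hvA hvn hvp hxv hwp hxw hwn
  have hlt : a < ⟨t, htl⟩ := by rwa [Fin.lt_def]
  obtain ⟨g, hg, hgp⟩ := h.exists_dual hv'
  have hgU : ∀ u ∈ pairSpan B S e f, B u g = 0 := fun u hu => hgp u (Submodule.mem_sup_right hu)
  have hvAt : v ∈ A (t + 1) := h.mono (by omega) hvA
  -- `g` kills `x (A (t+1))ᗮ`, so by skewness `x g` lies in `(A (t+1))ᗮᗮ`.
  have hxgA : x g ∈ A (t + 1) := by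
    rw [← LinearMap.BilinForm.orthogonal_orthogonal h.nondeg h.isRefl (A (t + 1)),
      LinearMap.BilinForm.mem_orthogonal_iff]
    intro u hu
    have := h.skew u g
    rw [hgp _ (Submodule.mem_sup_left ⟨u, hu, rfl⟩)] at this
    exact neg_eq_zero.1 this.symm
  have hvv : B v v = 0 := h.iso' hvA hvA
  have hvw : B v w = 0 := hwA v (h.mono (by omega) hvA)
  have hwv : B w v = 0 := h.swap hvw
  have hwxg : B w (x g) = -1 := by
    have := h.skew w g
    rw [hxw, hg] at this
    linear_combination this
  have hxgw : B (x g) w = -κ.sgn := by rw [h.symm, hwxg]; ring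
  have hxgg := h.symm (x g) g
  have hskg := h.skew g g
  have hs2 := κ.sgn_mul_self
  -- The multiple of `w` that makes `F1` orthogonal to `x F1`, hence to `e'`; in the orthogonal case
  -- skewness already gives this.
  obtain ⟨p, hp⟩ : ∃ p : ℂ, B (x g) g - p * κ.sgn + p = 0 := by
    cases κ
    · exact ⟨-B (x g) g / 2, by simp only [FormKind.sgn]; ring⟩
    · simp only [FormKind.sgn] at hxgg ⊢
      exact ⟨0, by linear_combination (1/2) * hskg + (1/2) * hxgg⟩
  set F1 := g + p • w with hF1
  have hxF1 : x F1 = x g + p • v := by simp [hF1, hxw]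
  have hF1U : ∀ u ∈ pairSpan B S e f, B u F1 = 0 := fun u hu => by
    simp [hF1, hgU u hu, hwp u hu]
  set e' := -κ.sgn • x F1 with he'
  have he'A : e' ∈ A (t + 1) := by
    rw [he', hxF1]
    exact Submodule.smul_mem _ _ (Submodule.add_mem _ hxgA (Submodule.smul_mem _ _ hvAt))
  have hxe' : x e' = 0 := by rw [he', map_smul, h.sq, smul_zero]
  have he'U : ∀ u ∈ pairSpan B S e f, B u e' = 0 := fun u hu => by
    rw [he', map_smul, h.x_perp hP hF1U u hu, smul_zero]
  have he'F1 : B e' F1 = 0 := by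
    rw [he', hxF1, hF1]
    simp only [map_add, map_smul, LinearMap.add_apply, LinearMap.smul_apply, smul_eq_mul, hxgw, hg,
      hvw]
    linear_combination -κ.sgn * hp
  have he'w : B e' w = 1 := by
    rw [he', hxF1]
    simp only [map_add, map_smul, LinearMap.add_apply, LinearMap.smul_apply, smul_eq_mul, hxgw,
      hvw]
    linear_combination hs2
  have hwe' : B w e' = κ.sgn := by rw [h.symm, he'w, mul_one]
  have he'e' : B e' e' = 0 := h.iso' he'A he'A
  have hve' : B v e' = 0 := h.iso' hvA he'A
  have he'v : B e' v = 0 := h.iso' he'A hvA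
  have hvF1 : B v F1 = 1 := by simp [hF1, hg, hvw]
  -- Correction making `w'` isotropic, using `⟨e', w⟩ = 1`.
  obtain ⟨q, hq⟩ : ∃ q : ℂ, B w w + q + q * κ.sgn = 0 := by
    cases κ
    · have := h.symm w w
      simp only [FormKind.sgn] at this ⊢
      exact ⟨0, by linear_combination (1/2) * this⟩
    · exact ⟨-(B w w) / 2, by simp only [FormKind.sgn]; ring⟩
  set w' := w + q • e' with hw'
  have hw'w' : B w' w' = 0 := by
    simp only [hw', map_add, map_smul, LinearMap.add_apply, LinearMap.smul_apply, smul_eq_mul,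
      he'w, hwe', he'e']
    linear_combination hq
  have he'w' : B e' w' = 1 := by simp [hw', he'w, he'e']
  have hvw' : B v w' = 0 := by simp [hw', hvw, hve']
  have hw'U : ∀ u ∈ pairSpan B S e f, B u w' = 0 := fun u hu => by
    simp [hw', hwp u hu, he'U u hu]
  have hxw' : x w' = v := by simp [hw', hxw, hxe']
  have hw'A : ∀ u ∈ A t, B u w' = 0 := fun u hu => by simp [hw', hwA u hu, h.iso' hu he'A]
  -- Makes `F2` orthogonal to `w'`; the value of `x` does not change because `x e' = 0`. The later
  -- correction by `v` makes it isotropic.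
  set F2 := F1 + (-B F1 w') • e' with hF2
  have hF2w' : B F2 w' = 0 := by
    simp only [hF2, map_add, map_smul, LinearMap.add_apply, LinearMap.smul_apply, smul_eq_mul,
      he'w']
    ring
  have hvF2 : B v F2 = 1 := by simp [hF2, hvF1, hve']
  have hF2v : B F2 v = κ.sgn := by rw [h.symm, hvF2, mul_one]
  obtain ⟨s, hs⟩ : ∃ s : ℂ, B F2 F2 + s + s * κ.sgn = 0 := by
    cases κ
    · have := h.symm F2 F2
      simp only [FormKind.sgn] at this ⊢
      exact ⟨0, by linear_combination (1/2) * this⟩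
    · exact ⟨-(B F2 F2) / 2, by simp only [FormKind.sgn]; ring⟩
  set F := F2 + s • v with hF
  have hFF : B F F = 0 := by
    simp only [hF, map_add, map_smul, LinearMap.add_apply, LinearMap.smul_apply, smul_eq_mul,
      hvF2, hF2v, hvv]
    linear_combination hs
  have hvF : B v F = 1 := by simp [hF, hvF2, hvv]
  have hFw' : B F w' = 0 := by simp [hF, hF2w', hvw']
  have he'F : B e' F = 0 := by simp [hF, hF2, he'F1, he'e', he'v]
  have hFU : ∀ u ∈ pairSpan B S e f, B u F = 0 := fun u hu => by
    simp [hF, hF2, hF1U u hu, he'U u hu, hvp u hu]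
  have hxF : x F = -κ.sgn • e' := by
    have : x F = x F1 := by simp [hF, hF2, hxe', hxv]
    rw [this, he', smul_smul, neg_mul_neg, hs2, one_smul]
  refine ⟨{a, ⟨t, htl⟩}, _, _, _, _, by simp, by simp [ha, htS],
    PartialNF.pair_dot hlt (e := v) (e' := e') (f := F) (f' := w') hvv hve' he'v he'e' hFF
      hFw' (h.swap hFw') hw'w' hvF hvw' he'F he'w' hvA (h.perp_flag hP hmin hFU) he'A
      hw'A hxv hxe' hxF hxw', fun s hs u hu => ?_⟩
  by_cases hsa : s = a
  · simp [hsa, hvp u hu, hFU u hu]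
  · simp [hsa, he'U u hu, hw'U u hu]

omit ha hmin hvA hvn hvp hxv a v

/-- The place where `v` enters the chain `x (A j) + U`, followed by `x (A j)ᗮ + U` with decreasing
`j`, selects the case. It is not `U` itself, as `U` meets `Uᗮ` only in zero, and
`not_mem_map_orthogonal` excludes the passage from `A l` to `(A l)ᗮ`. -/
lemma extends_of_ne_univ (hS : S ≠ Finset.univ) : Extends κ B x A S (pairSpan B S e f) := by
  classical
  obtain ⟨b, hb⟩ : ∃ b, b ∉ S := by
    by_contra! hc
    exact hS (Finset.eq_univ_iff_forall.2 hc)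
  obtain ⟨a, ha, hmin⟩ : ∃ a, a ∉ S ∧ ∀ s < a, s ∈ S := by
    have hne : (Sᶜ).Nonempty := ⟨b, by simpa using hb⟩
    refine ⟨Sᶜ.min' hne, by simpa using Finset.min'_mem _ hne, fun s hs => ?_⟩
    by_contra hs'
    exact absurd (Finset.min'_le Sᶜ s (by simpa using hs')) (not_le.2 hs)
  obtain ⟨v, hvA, hv0, hvn, hvp, hxv⟩ := h.exists_first hP ha hmin
  have hvU : v ∉ pairSpan B S e f := fun hmem => hv0 (h.eq_zero_of_mem_of_perp hP hmem hvp)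
  have hA0 : A 0 = ⊥ := Submodule.finrank_eq_zero.1 (by rw [h.finrank]; simp)
  by_cases h1 : v ∈ LinearMap.range x ⊔ pairSpan B S e f
  swap
  · exact h.extends_free hP ha hmin hvA hvp hxv h1
  by_cases h2 : v ∈ (A l).map x ⊔ pairSpan B S e f
  · have hex : ∃ j, v ∈ (A j).map x ⊔ pairSpan B S e f := ⟨l, h2⟩
    have hle := Nat.find_min' hex h2
    have hspec := Nat.find_spec hex
    have hmin' : ∀ i < Nat.find hex, _ := fun i hi => Nat.find_min hex hi
    generalize Nat.find hex = j at *
    cases j with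
    | zero => rw [hA0, Submodule.map_bot, bot_sup_eq] at hspec; exact absurd hspec hvU
    | succ t =>
      exact h.extends_plain hP ha hmin hvA hvn hvp hxv (by omega) hspec (hmin' t (by omega))
  · have h3 : v ∉ (B.orthogonal (A l)).map x ⊔ pairSpan B S e f :=
      fun hmem => h2 (h.not_mem_map_orthogonal hP hvp hmem)
    have hex : ∃ j, v ∉ (B.orthogonal (A j)).map x ⊔ pairSpan B S e f := ⟨l, h3⟩
    have hle := Nat.find_min' hex h3
    have hspec := Nat.find_spec hex
    have hmin' : ∀ i < Nat.find hex, _ := fun i hi => Nat.find_min hex hi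
    generalize Nat.find hex = j at *
    cases j with
    | zero =>
      have hO : B.orthogonal (⊥ : Submodule ℂ W) = ⊤ := by
        ext u; simp
      rw [hA0, hO, Submodule.map_top] at hspec
      exact absurd h1 hspec
    | succ t =>
      exact h.extends_dot hP ha hmin hvA hvn hvp hxv (by omega)
        (not_not.1 (hmin' t (by omega))) hspec

omit hP

/-- Every `2`-nilpotent skew endomorphism stabilizing a complete isotropic flag has a normal form
given by a link pattern. -/
theorem exists_normalForm :
    ∃ (e f : Fin l → W) (m : Fin l → Fin l) (D : Set (Fin l)),
      PartialNF κ B x A Finset.univ e f m D := by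
  have main : ∀ (d : ℕ) (S : Finset (Fin l)) (e f : Fin l → W) (m : Fin l → Fin l)
      (D : Set (Fin l)), PartialNF κ B x A S e f m D → Sᶜ.card = d →
      ∃ (e f : Fin l → W) (m : Fin l → Fin l) (D : Set (Fin l)),
        PartialNF κ B x A Finset.univ e f m D := by
    intro d
    induction d using Nat.strong_induction_on with
    | _ d ih =>
      intro S e f m D hP hd
      by_cases hS : S = Finset.univ
      · subst hS; exact ⟨e, f, m, D, hP⟩
      obtain ⟨S', e', f', m', D', ⟨s, hs⟩, hdis, hP', hperp⟩ := h.extends_of_ne_univ hP hS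
      refine ih _ ?_ (S ∪ S') _ _ _ _ (PartialNF.union h hdis hP hP' hperp) rfl
      rw [← hd]
      apply Finset.card_lt_card
      rw [Finset.compl_ssubset_compl]
      refine Finset.ssubset_iff_subset_ne.2 ⟨Finset.subset_union_left, fun heq => ?_⟩
      exact Finset.disjoint_left.1 hdis (heq ▸ Finset.mem_union_right S hs) hs
  exact main _ ∅ (fun _ => 0) (fun _ => 0) id ∅ (by constructor <;> simp) rfl

end NilFlag
end Existence2
-- The standard form, its isometries and its Lie algebra.
section FormBasics

/-- The standard form as a bilinear form. -/
noncomputable def form (κ : FormKind) (n : ℕ) : LinearMap.BilinForm ℂ (Fin n → ℂ) :=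
  Matrix.toBilin' (gram κ n)

lemma form_apply (κ : FormKind) {n : ℕ} (v w : Fin n → ℂ) : form κ n v w = pairing κ v w :=
  Matrix.toBilin'_apply' _ _ _

lemma gram_rev_ne_zero (κ : FormKind) {n : ℕ} (i : Fin n) : gram κ n i i.rev ≠ 0 := by
  cases κ
  · simp only [gram, Matrix.of_apply, if_true]
    split_ifs <;> simp
  · simp [gram]

lemma gram_of_ne (κ : FormKind) {n : ℕ} {i j : Fin n} (h : j ≠ i.rev) : gram κ n i j = 0 := by
  simp [gram, h]

/-- Parity matters only for the symplectic matrix: with `n` odd the central entry would be on the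
diagonal and nonzero. -/
lemma gram_transpose (κ : FormKind) {n : ℕ} (h : κ = .symplectic → Even n) (i j : Fin n) :
    gram κ n i j = κ.sgn * gram κ n j i := by
  by_cases hij : j = i.rev
  · subst hij
    cases κ
    · have he := h rfl
      have hne : i.1 ≠ i.rev.1 := by
        rw [Fin.val_rev]; intro h1; obtain ⟨c, hc⟩ := he; omega
      simp only [gram, Matrix.of_apply, if_true, FormKind.sgn, Fin.rev_rev, Fin.lt_def]
      rcases lt_or_gt_of_ne hne with h1 | h1
      · rw [if_pos h1, if_neg h1.not_gt]; norm_num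
      · rw [if_neg h1.not_gt, if_pos h1]; norm_num
    · simp [gram, FormKind.sgn]
  · have : i ≠ j.rev := fun h => hij (by rw [h, Fin.rev_rev])
    rw [gram_of_ne κ hij, gram_of_ne κ this, mul_zero]

lemma form_symm (κ : FormKind) {n : ℕ} (h : κ = .symplectic → Even n) (v w : Fin n → ℂ) :
    form κ n v w = κ.sgn * form κ n w v := by
  rw [form, Matrix.toBilin'_apply, Matrix.toBilin'_apply, Finset.sum_comm, Finset.mul_sum]
  refine Finset.sum_congr rfl fun i _ => ?_
  rw [Finset.mul_sum]
  refine Finset.sum_congr rfl fun j _ => ?_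
  rw [gram_transpose κ h j i]
  ring

lemma form_single (κ : FormKind) {n : ℕ} (i j : Fin n) :
    form κ n (Pi.single i 1) (Pi.single j 1) = gram κ n i j :=
  Matrix.toBilin'_single _ _ _

lemma form_single_right (κ : FormKind) {n : ℕ} (v : Fin n → ℂ) (i : Fin n) :
    form κ n v (Pi.single i.rev 1) = v i * gram κ n i i.rev := by
  rw [form, Matrix.toBilin'_apply', Matrix.mulVec_single_one, dotProduct,
    Finset.sum_eq_single_of_mem i (Finset.mem_univ _)]
  · rfl
  · intro j _ hj
    rw [Matrix.col_apply, gram_of_ne κ (fun h => hj (Fin.rev_injective h.symm)), mul_zero]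

lemma form_nondegenerate (κ : FormKind) {n : ℕ} (h : κ = .symplectic → Even n) :
    (form κ n).Nondegenerate := by
  have key : ∀ v, (∀ w, form κ n v w = 0) → v = 0 := by
    intro v hv
    ext i
    have := hv (Pi.single i.rev 1)
    rw [form_single_right] at this
    exact (mul_eq_zero.1 this).resolve_right (gram_rev_ne_zero κ i)
  refine ⟨key, fun v hv => key v fun w => ?_⟩
  rw [form_symm κ h, hv w, mul_zero]

lemma mem_isometryGroup_iff (κ : FormKind) {n : ℕ} (g : GL (Fin n) ℂ) :
    g ∈ isometryGroup κ n ↔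
      ∀ v w, form κ n (g.1.mulVec v) (g.1.mulVec w) = form κ n v w := by
  have h1 : g ∈ isometryGroup κ n ↔ g.1.transpose * gram κ n * g.1 = gram κ n := Iff.rfl
  have h2 : ∀ v w, form κ n (g.1.mulVec v) (g.1.mulVec w) =
      Matrix.toBilin' (g.1.transpose * gram κ n * g.1) v w := by
    intro v w
    rw [← Matrix.toBilin'_comp]
    simp [form]
  rw [h1, ← (Matrix.toBilin' (R₁ := ℂ)).injective.eq_iff]
  constructor
  · intro h v w
    rw [h2, h]
    rfl
  · intro h
    refine LinearMap.ext fun v => LinearMap.ext fun w => ?_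
    rw [← h2, h]
    rfl

lemma mem_classicalLie_iff (κ : FormKind) {n : ℕ} (a : Matrix (Fin n) (Fin n) ℂ) :
    a ∈ classicalLie κ n ↔
      ∀ v w, form κ n (a.mulVec v) w = -form κ n v (a.mulVec w) := by
  have h1 : a ∈ classicalLie κ n ↔ a.transpose * gram κ n + gram κ n * a = 0 := Iff.rfl
  have h2 : ∀ v w, form κ n (a.mulVec v) w = Matrix.toBilin' (a.transpose * gram κ n) v w := by
    intro v w
    have := Matrix.toBilin'_comp (gram κ n) a (1 : Matrix (Fin n) (Fin n) ℂ)
    rw [Matrix.mul_one] at this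
    rw [← this]
    simp [form]
  have h3 : ∀ v w, form κ n v (a.mulVec w) = Matrix.toBilin' (gram κ n * a) v w := by
    intro v w
    have := Matrix.toBilin'_comp (gram κ n) (1 : Matrix (Fin n) (Fin n) ℂ) a
    rw [Matrix.transpose_one, Matrix.one_mul] at this
    rw [← this]
    simp [form]
  rw [h1, ← (Matrix.toBilin' (R₁ := ℂ)).injective.eq_iff, map_add, map_zero]
  constructor
  · intro h v w
    rw [h2, h3, eq_neg_iff_add_eq_zero]
    exact LinearMap.congr_fun (LinearMap.congr_fun h v) w
  · intro h
    refine LinearMap.ext fun v => LinearMap.ext fun w => ?_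
    have := h v w
    rw [h2, h3, eq_neg_iff_add_eq_zero] at this
    exact this

end FormBasics

section Frames

variable {W : Type*} [AddCommGroup W] [Module ℂ W] {l : ℕ} {B : LinearMap.BilinForm ℂ W}
  {e f : Fin l → W}

lemma form_sum_pairs (B : LinearMap.BilinForm ℂ W)
    (ee : ∀ s t, B (e s) (e t) = 0)
    (ef : ∀ s t, B (e s) (f t) = if s = t then 1 else 0) (t : Fin l) (c d : Fin l → ℂ) :
    B (e t) (∑ s, (c s • e s + d s • f s)) = d t := by
  rw [map_sum, Finset.sum_eq_single_of_mem t (Finset.mem_univ _)]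
  · simp [ee, ef]
  · intro s _ hs
    simp [ee, ef, Ne.symm hs]

lemma form_sum_pairs' (B : LinearMap.BilinForm ℂ W)
    (ff : ∀ s t, B (f s) (f t) = 0)
    (ef : ∀ s t, B (e s) (f t) = if s = t then 1 else 0) (t : Fin l) (c d : Fin l → ℂ) :
    B (∑ s, (c s • e s + d s • f s)) (f t) = c t := by
  rw [map_sum, LinearMap.sum_apply, Finset.sum_eq_single_of_mem t (Finset.mem_univ _)]
  · simp [ff, ef]
  · intro s _ hs
    simp [ff, ef, hs]

lemma linearIndependent_pairs
    (ee : ∀ s t, B (e s) (e t) = 0) (ff : ∀ s t, B (f s) (f t) = 0)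
    (ef : ∀ s t, B (e s) (f t) = if s = t then 1 else 0) :
    LinearIndependent ℂ (Sum.elim e f) := by
  rw [Fintype.linearIndependent_iff]
  intro g hg
  rw [Fintype.sum_sum_type, ← Finset.sum_add_distrib] at hg
  simp only [Sum.elim_inl, Sum.elim_inr] at hg
  rintro (t | t)
  · have := form_sum_pairs' B ff ef t (fun s => g (Sum.inl s)) (fun s => g (Sum.inr s))
    rw [hg] at this
    simpa using this.symm
  · have := form_sum_pairs B ee ef t (fun s => g (Sum.inl s)) (fun s => g (Sum.inr s))
    rw [hg] at this
    simpa using this.symm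

end Frames

/-! ### Refining a stable flag to a complete stable one. -/

section Refinement

variable {W : Type*} [AddCommGroup W] [Module ℂ W] [FiniteDimensional ℂ W] {x : W →ₗ[ℂ] W}

omit [FiniteDimensional ℂ W] in
-- One refinement step: either `z` itself works, or `x z` does, since `x (x z) = 0`.
lemma exists_stable_vector (hx : ∀ v, x (x v) = 0) {X N : Submodule ℂ W} (hXN : X < N)
    (hN : ∀ v ∈ N, x v ∈ N) : ∃ z ∈ N, z ∉ X ∧ x z ∈ X := by
  obtain ⟨z, hz, hzX⟩ := SetLike.exists_of_lt hXN
  by_cases hxz : x z ∈ X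
  · exact ⟨z, hz, hzX, hxz⟩
  · exact ⟨x z, hN z hz, hxz, by rw [hx]; exact X.zero_mem⟩

/-- A flag stabilized by a `2`-nilpotent endomorphism can be refined to a complete one. -/
lemma exists_stable_refinement {k : ℕ} {V : Fin k → Submodule ℂ W} (hV : Monotone V)
    (hx : ∀ v, x (x v) = 0) (hxV : ∀ i, ∀ v ∈ V i, x v ∈ V i) :
    ∃ A : ℕ → Submodule ℂ W, Monotone A ∧
      (∀ j, finrank ℂ (A j) = min j (finrank ℂ (⨆ i, V i : Submodule ℂ W))) ∧
      (∀ j, ∀ v ∈ A j, x v ∈ A j) ∧ (∀ j, A j ≤ ⨆ i, V i) ∧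
      ∀ i, A (finrank ℂ (V i)) = V i := by
  classical
  set T : Submodule ℂ W := ⨆ i, V i with hT
  set l := finrank ℂ T with hl
  -- Besides dimension and stability, the induction carries comparability with every `V i`, so that
  -- the flag being built passes through all of them.
  let Good : ℕ → Submodule ℂ W → Prop := fun j X => finrank ℂ X = j ∧ X ≤ T ∧
    (∀ v ∈ X, x v ∈ X) ∧ ∀ i, (finrank ℂ (V i) ≤ j → V i ≤ X) ∧ (j ≤ finrank ℂ (V i) → X ≤ V i)
  have step : ∀ j X, Good j X → j < l → ∃ Y, X ≤ Y ∧ Good (j + 1) Y := by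
    rintro j X ⟨hXj, hXT, hXx, hXV⟩ hj
    have hex : (Finset.univ.filter fun i => j < finrank ℂ (V i)).Nonempty := by
      by_contra hne
      rw [Finset.not_nonempty_iff_eq_empty, Finset.filter_eq_empty_iff] at hne
      have : T ≤ X := iSup_le fun i => (hXV i).1 (not_lt.1 (hne (Finset.mem_univ i)))
      have := Submodule.finrank_mono this
      omega
    -- The new vector is taken from the first `V i` of dimension greater than `j`; this keeps the
    -- enlarged space comparable with the whole flag.
    set i := Finset.min' _ hex with hi
    have hij : j < finrank ℂ (V i) := by
      have := Finset.min'_mem _ hex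
      simpa using this
    have himin : ∀ i', j < finrank ℂ (V i') → i ≤ i' := fun i' h' =>
      Finset.min'_le _ i' (by simpa using h')
    have hXi : X < V i := lt_of_le_of_ne ((hXV i).2 hij.le) (fun heq => by
      rw [← heq] at hij; omega)
    obtain ⟨z, hz, hzX, hxz⟩ := exists_stable_vector hx hXi (hxV i)
    have hlt : X < X ⊔ Submodule.span ℂ {z} := by
      refine lt_of_le_of_ne le_sup_left fun heq => hzX ?_
      rw [heq]
      exact Submodule.mem_sup_right (Submodule.mem_span_singleton_self z)
    have hYi : X ⊔ Submodule.span ℂ {z} ≤ V i :=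
      sup_le hXi.le ((Submodule.span_singleton_le_iff_mem _ _).2 hz)
    have hfin : finrank ℂ (X ⊔ Submodule.span ℂ {z} : Submodule ℂ W) = j + 1 := by
      have h1 := Submodule.finrank_lt_finrank_of_lt hlt
      have h2 := Submodule.finrank_add_le_finrank_add_finrank X (Submodule.span ℂ {z})
      have h3 := finrank_span_le_card (R := ℂ) ({z} : Set W)
      simp only [Set.toFinset_singleton, Finset.card_singleton] at h3
      omega
    refine ⟨_, le_sup_left, hfin, hYi.trans (le_iSup V i), ?_, fun i' => ⟨fun h' => ?_, fun h' => ?_⟩⟩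
    · intro v hv
      obtain ⟨y, hy, w, hw, rfl⟩ := Submodule.mem_sup.1 hv
      obtain ⟨c, rfl⟩ := Submodule.mem_span_singleton.1 hw
      rw [map_add, map_smul]
      exact Submodule.mem_sup_left (Submodule.add_mem _ (hXx y hy) (Submodule.smul_mem _ _ hxz))
    · rcases Nat.lt_or_ge j (finrank ℂ (V i')) with h1 | h1
      · have h2 : i ≤ i' := himin i' h1
        have h3 : V i = V i' := Submodule.eq_of_le_of_finrank_le (hV h2) (by omega)
        rw [← h3]
        refine (Submodule.eq_of_le_of_finrank_le hYi ?_).ge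
        rw [hfin, h3]; exact h'
      · exact ((hXV i').1 h1).trans le_sup_left
    · exact hYi.trans (hV (himin i' h'))
  choose! nxt hnxt using step
  let A0 : ℕ → Submodule ℂ W := fun j => Nat.rec ⊥ (fun j X => nxt j X) j
  have hA0 : ∀ j ≤ l, Good j (A0 j) := by
    intro j
    induction j with
    | zero =>
      intro _
      refine ⟨by simp [A0], bot_le, fun v hv => ?_, fun i => ⟨fun h => ?_, fun _ => bot_le⟩⟩
      · rw [(Submodule.mem_bot ℂ).1 hv, map_zero]; exact Submodule.zero_mem _
      · rw [Submodule.finrank_eq_zero.1 (Nat.le_zero.1 h)]; exact bot_le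
    | succ j ih => exact fun hj => (hnxt j (A0 j) (ih (by omega)) (by omega)).2
  have hA1 : ∀ j < l, A0 j ≤ A0 (j + 1) := fun j hj => (hnxt j (A0 j) (hA0 j hj.le) hj).1
  refine ⟨fun j => A0 (min j l), monotone_nat_of_le_succ fun j => ?_, fun j =>
    (hA0 _ (min_le_right _ _)).1, fun j => (hA0 _ (min_le_right _ _)).2.2.1, fun j =>
    (hA0 _ (min_le_right _ _)).2.1, fun i => ?_⟩
  · rcases Nat.lt_or_ge j l with h | h
    · rw [min_eq_left h.le, min_eq_left (Nat.succ_le_of_lt h)]; exact hA1 j h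
    · rw [min_eq_right h, min_eq_right (by omega)]
  · have hle : finrank ℂ (V i) ≤ l := Submodule.finrank_mono (le_iSup V i)
    have hmin : min (finrank ℂ (V i)) l = finrank ℂ (V i) := min_eq_left hle
    simp only [hmin]
    have := (hA0 _ hle).2.2.2 i
    exact le_antisymm (this.2 le_rfl) (this.1 le_rfl)

/-- The block of a point. -/
lemma exists_blockIndex {k l : ℕ} {V : Fin k → Submodule ℂ W} (hV : StrictMono V)
    (hl : finrank ℂ (⨆ i, V i : Submodule ℂ W) = l) :
    ∃ β : Fin l → Fin k, ∀ t i, β t ≤ i ↔ t.1 < finrank ℂ (V i) := by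
  classical
  have hex : ∀ t : Fin l, (Finset.univ.filter fun i => t.1 < finrank ℂ (V i)).Nonempty := by
    intro t
    have ht := t.2
    have hk : Nonempty (Fin k) := by
      by_contra hk
      rw [not_nonempty_iff] at hk
      rw [iSup_of_empty, finrank_bot] at hl
      omega
    obtain ⟨i⟩ := hk
    have hk := i.pos
    refine ⟨⟨k - 1, by omega⟩, ?_⟩
    have : (⨆ i, V i) = V ⟨k - 1, by omega⟩ :=
      le_antisymm (iSup_le fun j => hV.monotone (by rw [Fin.le_def]; simp; omega)) (le_iSup V _)
    rw [this] at hl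
    simp only [Finset.mem_filter, Finset.mem_univ, true_and]
    omega
  refine ⟨fun t => Finset.min' _ (hex t), fun t i => ⟨fun h => ?_, fun h => ?_⟩⟩
  · have := Finset.min'_mem _ (hex t)
    simp only [Finset.mem_filter, Finset.mem_univ, true_and] at this
    exact this.trans_le (Submodule.finrank_mono (hV.monotone h))
  · exact Finset.min'_le _ _ (by simpa using h)

end Refinement
-- Normal forms adapted to a partial flag; removal of symplectic dots inside blocks.
section NormalForms

variable {κ : FormKind} {l n k : ℕ}

/-- A basis adapted to the form and to the flag on which `x` acts by the link pattern given by `m`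
and `D`. -/
structure LinkBasis (κ : FormKind) {l n k : ℕ} (V : Fin k → Submodule ℂ (Fin n → ℂ))
    (x : Matrix (Fin n) (Fin n) ℂ) (e f : Fin l → Fin n → ℂ) (β : Fin l → Fin k)
    (m : Fin l → Fin l) (D : Set (Fin l)) : Prop where
  ee : ∀ s t, form κ n (e s) (e t) = 0
  ff : ∀ s t, form κ n (f s) (f t) = 0
  ef : ∀ s t, form κ n (e s) (f t) = if s = t then 1 else 0
  mono : Monotone β
  flag : ∀ i, V i = Submodule.span ℂ (e '' {t | β t ≤ i})
  m_m : ∀ t, m (m t) = t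
  m_D : ∀ t, m t ∈ D ↔ t ∈ D
  orth : κ = .orthogonal → ∀ t ∈ D, m t ≠ t
  xe : ∀ t, x.mulVec (e t) = linkE e m D t
  xf : ∀ t, x.mulVec (f t) = linkF κ e f m D t
  xz : ∀ u, (∀ t, form κ n (e t) u = 0 ∧ form κ n (f t) u = 0) → x.mulVec u = 0

/-- In the symplectic case, links with dots join different blocks. -/
def DotsSeparated (κ : FormKind) {l k : ℕ} (β : Fin l → Fin k) (m : Fin l → Fin l)
    (D : Set (Fin l)) : Prop :=
  κ = .symplectic → ∀ t ∈ D, m t ≠ t → β (m t) ≠ β t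

open Classical in
/-- The pattern obtained by gluing the points of a link pattern. -/
noncomputable def patternOf {l k : ℕ} (β : Fin l → Fin k) (m : Fin l → Fin l) (D : Set (Fin l)) :
    Pattern k where
  link a := (Finset.univ.filter fun t => t ∉ D ∧ m t < t ∧ s(β t, β (m t)) = a).card
  dotLink a := (Finset.univ.filter fun t => t ∈ D ∧ m t ≤ t ∧ s(β t, β (m t)) = a).card

lemma hasNormalForm_iff {V : Fin k → Submodule ℂ (Fin n → ℂ)} {x : Matrix (Fin n) (Fin n) ℂ}
    {q : Pattern k} :
    HasNormalForm κ l V x q ↔ ∃ (e f : Fin l → Fin n → ℂ) (β : Fin l → Fin k)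
      (m : Fin l → Fin l) (D : Set (Fin l)),
      LinkBasis κ V x e f β m D ∧ DotsSeparated κ β m D ∧ q = patternOf β m D := by
  constructor
  · rintro ⟨e, f, β, m, D, h1, h2, h3, h4, h5, h6, h7, h8, h9, h10, h11, h12, h13⟩
    refine ⟨e, f, β, m, D, ⟨?_, ?_, ?_, h4, h5, h6, h7, ?_, h9, h10, ?_⟩, ?_, ?_⟩
    · simpa only [form_apply] using h1
    · simpa only [form_apply] using h2
    · simpa only [form_apply] using h3
    · rintro rfl; exact h8
    · simpa only [form_apply] using h11
    · rintro rfl; exact h8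
    · exact Pattern.ext (funext h12) (funext h13)
  · rintro ⟨e, f, β, m, D, h, hD, rfl⟩
    refine ⟨e, f, β, m, D, ?_, ?_, ?_, h.mono, h.flag, h.m_m, h.m_D, ?_, h.xe, h.xf, ?_,
      fun _ => rfl, fun _ => rfl⟩
    · simpa only [form_apply] using h.ee
    · simpa only [form_apply] using h.ff
    · simpa only [form_apply] using h.ef
    · cases κ
      · exact hD rfl
      · exact h.orth rfl
    · simpa only [form_apply] using h.xz

lemma finrank_span_image {W ι : Type*} [AddCommGroup W] [Module ℂ W] [Finite ι] {v : ι → W}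
    (hv : LinearIndependent ℂ v) (S : Set ι) :
    finrank ℂ (Submodule.span ℂ (v '' S)) = S.ncard := by
  classical
  have := Fintype.ofFinite ι
  have h1 := finrank_span_eq_card (hv.comp (Subtype.val : S → ι) Subtype.val_injective)
  rw [Set.range_comp, Subtype.range_coe] at h1
  rw [h1, Set.ncard_eq_toFinset_card', Set.toFinset_card]

lemma even_of (hκ : κ = .symplectic → n = 2 * l) : κ = .symplectic → Even n :=
  fun h => ⟨l, by rw [hκ h]; ring⟩

/-- Isotropic flags with top of dimension `l`. -/
structure IsotropicFlag (κ : FormKind) (l : ℕ) {n k : ℕ} (V : Fin k → Submodule ℂ (Fin n → ℂ)) :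
    Prop where
  dim : n = 2 * l ∨ n = 2 * l + 1
  sympl : κ = .symplectic → n = 2 * l
  strictMono : StrictMono V
  iso : ∀ i, ∀ v ∈ V i, ∀ w ∈ V i, form κ n v w = 0
  finrank : finrank ℂ (⨆ i, V i : Submodule ℂ (Fin n → ℂ)) = l

lemma IsotropicFlag.iso_iSup {V : Fin k → Submodule ℂ (Fin n → ℂ)} (hV : IsotropicFlag κ l V) :
    ∀ v ∈ ⨆ i, V i, ∀ w ∈ ⨆ i, V i, form κ n v w = 0 := by
  rcases isEmpty_or_nonempty (Fin k) with hk | hk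
  · intro v hv
    rw [iSup_of_empty, Submodule.mem_bot] at hv
    simp [hv]
  · intro v hv w hw
    have hd := hV.strictMono.monotone.directed_le
    obtain ⟨i, hi⟩ := (Submodule.mem_iSup_of_directed _ hd).1 hv
    obtain ⟨j, hj⟩ := (Submodule.mem_iSup_of_directed _ hd).1 hw
    exact hV.iso (max i j) v (hV.strictMono.monotone (le_max_left i j) hi) w
      (hV.strictMono.monotone (le_max_right i j) hj)

/-- Refine the flag and apply `exists_normalForm`. Each `V i` is the member of the refined flag of
the same dimension, hence spanned by an initial segment of the `e t`. -/
lemma exists_linkBasis {V : Fin k → Submodule ℂ (Fin n → ℂ)} (hV : IsotropicFlag κ l V)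
    {x : Matrix (Fin n) (Fin n) ℂ} (hx : x ∈ classicalLie κ n) (hx2 : x ^ 2 = 0)
    (hxV : ∀ i, ∀ v ∈ V i, x.mulVec v ∈ V i) :
    ∃ (e f : Fin l → Fin n → ℂ) (β : Fin l → Fin k) (m : Fin l → Fin l) (D : Set (Fin l)),
      LinkBasis κ V x e f β m D := by
  have hxx : ∀ v, x.mulVec (x.mulVec v) = 0 := fun v => by
    rw [Matrix.mulVec_mulVec, ← pow_two, hx2, Matrix.zero_mulVec]
  obtain ⟨A, hA1, hA2, hA3, hA4, hA5⟩ := exists_stable_refinement (x := x.mulVecLin)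
    hV.strictMono.monotone hxx hxV
  rw [hV.finrank] at hA2
  have h : NilFlag κ l (form κ n) x.mulVecLin A :=
    { symm := form_symm κ (even_of hV.sympl)
      nondeg := form_nondegenerate κ (even_of hV.sympl)
      skew := (mem_classicalLie_iff κ x).1 hx
      sq := hxx
      mono := hA1
      finrank := hA2
      iso := fun j u hu v hv => hV.iso_iSup u (hA4 j hu) v (hA4 j hv)
      stable := hA3
      card_le := by have := hV.dim; rw [finrank_fin_fun]; omega }
  obtain ⟨e, f, m, D, hP⟩ := h.exists_normalForm
  obtain ⟨β, hβ⟩ := exists_blockIndex hV.strictMono hV.finrank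
  have ee : ∀ s t, form κ n (e s) (e t) = 0 := fun s t => hP.ee s (by simp) t (by simp)
  have ff : ∀ s t, form κ n (f s) (f t) = 0 := fun s t => hP.ff s (by simp) t (by simp)
  have ef : ∀ s t, form κ n (e s) (f t) = if s = t then 1 else 0 :=
    fun s t => hP.ef s (by simp) t (by simp)
  have hli := linearIndependent_pairs ee ff ef
  have hle : LinearIndependent ℂ e := hli.comp Sum.inl Sum.inl_injective
  refine ⟨e, f, β, m, D, ee, ff, ef, fun s t hst => ?_, fun i => ?_, fun t => hP.m_m t (by simp),
    fun t => hP.m_D t (by simp), fun hκ t ht => hP.orth hκ t (by simp) ht,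
    fun t => hP.xe t (by simp), fun t => hP.xf t (by simp), fun u hu => ?_⟩
  · rw [hβ]
    have := (hβ t (β t)).1 le_rfl
    rw [Fin.le_def] at hst
    omega
  · symm
    apply Submodule.eq_of_le_of_finrank_le
    · rw [Submodule.span_le]
      rintro _ ⟨t, ht, rfl⟩
      rw [← hA5 i]
      exact hA1 (Nat.succ_le_of_lt ((hβ t i).1 ht)) (hP.e_mem t (by simp))
    · rw [finrank_span_image hle]
      have hil : Module.finrank ℂ (V i) ≤ l := by
        rw [← hV.finrank]; exact Submodule.finrank_mono (le_iSup V i)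
      have : {t : Fin l | β t ≤ i} = Set.range (Fin.castLE hil) := by
        ext t
        simp only [Set.mem_ofPred_eq, hβ, Set.mem_range]
        constructor
        · intro ht; exact ⟨⟨t, ht⟩, rfl⟩
        · rintro ⟨s, rfl⟩; exact s.2
      rw [this, ← Set.image_univ, Set.ncard_image_of_injective _ (Fin.castLE_injective hil)]
      simp
  -- The orthogonal complement of all pairs is at most a line and is stable under `x`; a nilpotent
  -- operator kills a stable line.
  · set U := Submodule.span ℂ (Set.range (Sum.elim e f)) with hU
    have hUf : Module.finrank ℂ U = 2 * l := by
      rw [hU, finrank_span_eq_card hli]; simp; ring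
    have hUO : Module.finrank ℂ ((form κ n).orthogonal U) ≤ 1 := by
      rw [LinearMap.BilinForm.finrank_orthogonal h.nondeg, hUf, finrank_fin_fun]
      have := hV.dim
      omega
    have hmem : ∀ w, (∀ v ∈ pairSpan (form κ n) Finset.univ e f, form κ n v w = 0) →
        w ∈ (form κ n).orthogonal U := by
      intro w hw
      rw [LinearMap.BilinForm.mem_orthogonal_iff]
      intro v hv
      refine hw v ?_
      have hle : U ≤ pairSpan (form κ n) Finset.univ e f := by
        rw [hU, Submodule.span_le]
        rintro _ ⟨s | s, rfl⟩
        · exact NilFlag.e_mem_pairSpan hP (by simp)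
        · exact NilFlag.f_mem_pairSpan hP (by simp)
      exact hle hv
    have hup := NilFlag.perp_of (S := Finset.univ) (fun s _ => (hu s).1) (fun s _ => (hu s).2)
    have hxup := h.x_perp hP hup
    obtain ⟨w, hw⟩ := finrank_le_one_iff.1 hUO
    obtain ⟨c, hc⟩ := hw ⟨u, hmem u hup⟩
    obtain ⟨d, hd⟩ := hw ⟨_, hmem _ hxup⟩
    have hc' : c • (w : Fin n → ℂ) = u := congrArg Subtype.val hc
    have hd' : d • (w : Fin n → ℂ) = x.mulVec u := congrArg Subtype.val hd
    by_cases hc0 : c = 0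
    · rw [← hc', hc0, zero_smul, Matrix.mulVec_zero]
    · have h1 : x.mulVec u = (d * c⁻¹) • u := by
        rw [← hd', ← hc', smul_smul, mul_assoc, inv_mul_cancel₀ hc0, mul_one]
      have h2 := hxx u
      rw [h1, Matrix.mulVec_smul, h1, smul_smul] at h2
      rcases smul_eq_zero.1 h2 with h3 | h3
      · rw [h1, mul_self_eq_zero.1 h3, zero_smul]
      · rw [h3, Matrix.mulVec_zero]

open Classical in
/-- Symplectic links with dots inside of a block can be replaced by loops. -/
lemma LinkBasis.exists_dotsSeparated {V : Fin k → Submodule ℂ (Fin n → ℂ)}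
    {x : Matrix (Fin n) (Fin n) ℂ} {e f : Fin l → Fin n → ℂ} {β : Fin l → Fin k}
    {m : Fin l → Fin l} {D : Set (Fin l)} (h : LinkBasis κ V x e f β m D) :
    ∃ (e' f' : Fin l → Fin n → ℂ) (m' : Fin l → Fin l),
      LinkBasis κ V x e' f' β m' D ∧ DotsSeparated κ β m' D := by
  by_cases hκ : κ = .symplectic
  swap
  · exact ⟨e, f, m, h, fun h' => absurd h' hκ⟩
  subst hκ
  -- On a bad pair `f_t ↦ e_{m t}` is a hyperbolic plane, to be diagonalized. For `e' = α e_t + γ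
  -- e_{m t}` and `f' = γ f_t + α f_{m t}` one has `x f' = e'`; `2αγ = 1` gives `⟨e', f'⟩ = 1`, and
  -- `α² + γ² = 0` makes the two new pairs orthogonal.
  obtain ⟨α, γ, hsum, hprod⟩ : ∃ α γ : ℂ, α * α + γ * γ = 0 ∧ 2 * (α * γ) = 1 := by
    refine ⟨(1 + Complex.I) / 2, (1 - Complex.I) / 2, ?_, ?_⟩
    · linear_combination (1/2) * Complex.I_mul_I
    · linear_combination (-1/2) * Complex.I_mul_I
  let bad : Fin l → Prop := fun t => t ∈ D ∧ m t ≠ t ∧ β (m t) = β t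
  have hbm : ∀ t, bad (m t) ↔ bad t := fun t => by
    simp only [bad, h.m_D, h.m_m]
    constructor
    · rintro ⟨h1, h2, h3⟩; exact ⟨h1, h2.symm, h3.symm⟩
    · rintro ⟨h1, h2, h3⟩; exact ⟨h1, h2.symm, h3.symm⟩
  have hbD : ∀ t, bad t → t ∈ D := fun t ht => ht.1
  have hbne : ∀ t, bad t → m t ≠ t := fun t ht => ht.2.1
  have hbβ : ∀ t, bad t → β (m t) = β t := fun t ht => ht.2.2
  have hsep : ∀ t ∈ D, ¬bad t → m t ≠ t → β (m t) ≠ β t := fun t h1 h2 h3 h4 => h2 ⟨h1, h3, h4⟩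
  clear_value bad
  have hmi : ∀ s t, m s = t ↔ s = m t := fun s t =>
    ⟨fun hst => by rw [← hst, h.m_m], fun hst => by rw [hst, h.m_m]⟩
  have hmm : ∀ s t, m s = m t ↔ s = t := fun s t => by rw [hmi, h.m_m]
  have hnD : ∀ t, t ∉ D → ¬bad t := fun t h1 h2 => h1 (hbD t h2)
  set e' : Fin l → Fin n → ℂ := fun t => if bad t then α • e t + γ • e (m t) else e t with he'
  set f' : Fin l → Fin n → ℂ := fun t => if bad t then γ • f t + α • f (m t) else f t with hf'
  -- The inverse change of basis; the two relations give `-4γ⁴ = 1`. It shows that flag and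
  -- orthogonal complement are unchanged.
  have he : ∀ t, bad t → e t = (2 * γ * γ) • (α • e' t - γ • e' (m t)) := fun t ht => by
    simp only [he', ht, (hbm t).2 ht, h.m_m, if_true]
    ext j
    simp only [Pi.smul_apply, Pi.add_apply, Pi.sub_apply, smul_eq_mul]
    linear_combination (-(2 * α * γ + 1) * hprod + 2 * γ ^ 2 * hsum) * e t j
  have hf : ∀ t, bad t → f t = (-(2 * γ * γ)) • (γ • f' t - α • f' (m t)) := fun t ht => by
    simp only [hf', ht, (hbm t).2 ht, h.m_m, if_true]
    ext j
    simp only [Pi.smul_apply, Pi.add_apply, Pi.sub_apply, smul_eq_mul]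
    linear_combination (-(2 * α * γ + 1) * hprod + 2 * γ ^ 2 * hsum) * f t j
  refine ⟨e', f', fun t => if bad t then t else m t, ⟨?_, ?_, ?_, h.mono, ?_, ?_, ?_, ?_, ?_, ?_, ?_⟩,
    ?_⟩
  · intro s t
    by_cases hs : bad s <;> by_cases ht : bad t <;> simp [he', hs, ht, h.ee]
  · intro s t
    by_cases hs : bad s <;> by_cases ht : bad t <;> simp [hf', hs, ht, h.ff]
  · intro s t
    by_cases hs : bad s <;> by_cases ht : bad t
    · simp only [he', hf', hs, ht, if_true, map_add, map_smul, LinearMap.add_apply,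
        LinearMap.smul_apply, h.ef, smul_eq_mul, hmi s t, hmm]
      by_cases hst : s = t
      · subst hst
        simp only [if_true, if_neg (Ne.symm (hbne s hs))]
        linear_combination hprod
      · by_cases hst' : s = m t
        · simp only [hst', if_true, if_neg (hbne t ht)]
          linear_combination hsum
        · simp [hst, hst']
    · have h1 : s ≠ t := fun hst => ht (hst ▸ hs)
      have h2 : m s ≠ t := fun hst => ht (hst ▸ (hbm s).2 hs)
      simp [he', hf', hs, ht, h.ef, h1, h2]
    · have h1 : s ≠ t := fun hst => hs (hst ▸ ht)
      have h2 : s ≠ m t := fun hst => hs (hst ▸ (hbm t).2 ht)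
      simp [he', hf', hs, ht, h.ef, h1, h2]
    · simp [he', hf', hs, ht, h.ef]
  · intro i
    rw [h.flag]
    apply le_antisymm
    · rw [Submodule.span_le]
      rintro _ ⟨t, ht, rfl⟩
      have hin : ∀ s, β s ≤ i → e' s ∈ Submodule.span ℂ (e' '' {t | β t ≤ i}) :=
        fun s hs => Submodule.subset_span ⟨s, hs, rfl⟩
      by_cases hb : bad t
      · rw [he t hb]
        exact Submodule.smul_mem _ _ (Submodule.sub_mem _ (Submodule.smul_mem _ _ (hin t ht))
          (Submodule.smul_mem _ _ (hin (m t) (by rw [hbβ t hb]; exact ht))))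
      · have := hin t ht
        simp only [he', hb, if_false] at this
        exact this
    · rw [Submodule.span_le]
      rintro _ ⟨t, ht, rfl⟩
      have hin : ∀ s, β s ≤ i → e s ∈ Submodule.span ℂ (e '' {t | β t ≤ i}) :=
        fun s hs => Submodule.subset_span ⟨s, hs, rfl⟩
      by_cases hb : bad t
      · simp only [he', hb, if_true]
        exact Submodule.add_mem _ (Submodule.smul_mem _ _ (hin t ht))
          (Submodule.smul_mem _ _ (hin (m t) (by rw [hbβ t hb]; exact ht)))
      · simp only [he', hb, if_false]
        exact hin t ht
  · intro t
    by_cases hb : bad t <;> simp [hb, hbm, h.m_m]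
  · intro t
    by_cases hb : bad t <;> simp [hb, h.m_D]
  · intro hκ; exact absurd hκ (by simp)
  · intro t
    by_cases hb : bad t
    · have hD := hbD t hb
      have hD' := (h.m_D t).2 hD
      simp [he', hb, Matrix.mulVec_add, Matrix.mulVec_smul, h.xe, linkE, hD, hD']
    · by_cases hD : t ∈ D
      · simp [he', hb, h.xe, linkE, hD]
      · simp [he', hb, h.xe, linkE, hD, hbm]
  · intro t
    by_cases hb : bad t
    · have hD := hbD t hb
      have hD' := (h.m_D t).2 hD
      simp [he', hf', hb, Matrix.mulVec_add, Matrix.mulVec_smul, h.xf, linkF, hD, hD', h.m_m,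
        add_comm]
    · by_cases hD : t ∈ D
      · simp [he', hf', hb, h.xf, linkF, hD, hbm]
      · simp [hf', hb, h.xf, linkF, hD, hbm]
  · intro u hu
    refine h.xz u fun t => ?_
    by_cases hb : bad t
    · rw [he t hb, hf t hb]
      simp [(hu t).1, (hu (m t)).1, (hu t).2, (hu (m t)).2]
    · have := hu t
      simpa only [he', hf', hb, if_false] using this
  · intro _ t ht hne
    by_cases hb : bad t
    · simp [hb] at hne
    · simp only [hb, if_false] at hne ⊢
      exact hsep t ht hb hne

/-- Every `2`-nilpotent element of the Lie algebra stabilizing the flag has a normal form. -/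
theorem exists_hasNormalForm {V : Fin k → Submodule ℂ (Fin n → ℂ)} (hV : IsotropicFlag κ l V)
    {x : Matrix (Fin n) (Fin n) ℂ} (hx : x ∈ classicalLie κ n) (hx2 : x ^ 2 = 0)
    (hxV : ∀ i, ∀ v ∈ V i, x.mulVec v ∈ V i) : ∃ q, HasNormalForm κ l V x q := by
  obtain ⟨e, f, β, m, D, h⟩ := exists_linkBasis hV hx hx2 hxV
  obtain ⟨e', f', m', h', hD⟩ := h.exists_dotsSeparated
  exact ⟨_, hasNormalForm_iff.2 ⟨e', f', β, m', D, h', hD, rfl⟩⟩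

end NormalForms
-- Multiplicities of a glued pattern as counts of points.
section Counting

variable {κ : FormKind} {l n k : ℕ}

lemma card_filter_involution {α : Type*} [Fintype α] {m : α → α} (hm : ∀ t, m (m t) = t)
    (p : α → Prop) [DecidablePred p] [DecidablePred fun t => p (m t)] :
    (Finset.univ.filter fun t => p (m t)).card = (Finset.univ.filter p).card := by
  refine Finset.card_nbij' m m ?_ ?_ ?_ ?_
  · intro t ht; simpa using ht
  · intro t ht; simpa [hm] using ht
  · intro t _; exact hm t
  · intro t _; exact hm t

open Classical in
/-- The number of links without dot from a point of the block `i` to a smaller point of the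
block `j`. -/
noncomputable def plainCount {l k : ℕ} (β : Fin l → Fin k) (m : Fin l → Fin l) (D : Set (Fin l))
    (i j : Fin k) : ℕ :=
  (Finset.univ.filter fun t => t ∉ D ∧ m t < t ∧ β t = i ∧ β (m t) = j).card

open Classical in
/-- The number of links with dot from a point of the block `i` to a smaller or equal point of the
block `j`. -/
noncomputable def dotCount {l k : ℕ} (β : Fin l → Fin k) (m : Fin l → Fin l) (D : Set (Fin l))
    (i j : Fin k) : ℕ :=
  (Finset.univ.filter fun t => t ∈ D ∧ m t ≤ t ∧ β t = i ∧ β (m t) = j).card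

variable {β : Fin l → Fin k} {m : Fin l → Fin l} {D : Set (Fin l)}

lemma sym2_eq_iff_of_le {a b i j : Fin k} (hba : b ≤ a) (hji : j ≤ i) :
    s(a, b) = s(i, j) ↔ a = i ∧ b = j := by
  rw [Sym2.eq_iff]
  constructor
  · rintro (h | ⟨rfl, rfl⟩)
    · exact h
    · have := le_antisymm hba hji
      exact ⟨this.symm, this⟩
  · exact Or.inl

/-- As `β` is monotone, the larger end of a link lies in the block of larger or equal index, so
unordered pairs of blocks can be replaced by ordered ones. -/
lemma patternOf_link (hβ : Monotone β) {i j : Fin k} (hji : j ≤ i) :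
    (patternOf β m D).link s(i, j) = plainCount β m D i j := by
  classical
  simp only [patternOf, plainCount]
  congr 1
  ext t
  simp only [Finset.mem_filter, Finset.mem_univ, true_and]
  refine and_congr_right fun _ => and_congr_right fun ht => ?_
  exact sym2_eq_iff_of_le (hβ ht.le) hji

lemma patternOf_dotLink (hβ : Monotone β) {i j : Fin k} (hji : j ≤ i) :
    (patternOf β m D).dotLink s(i, j) = dotCount β m D i j := by
  classical
  simp only [patternOf, dotCount]
  congr 1
  ext t
  simp only [Finset.mem_filter, Finset.mem_univ, true_and]
  refine and_congr_right fun _ => and_congr_right fun ht => ?_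
  exact sym2_eq_iff_of_le (hβ ht) hji

lemma Pattern.ext_of_le {p q : Pattern k} (h1 : ∀ i j, j ≤ i → p.link s(i, j) = q.link s(i, j))
    (h2 : ∀ i j, j ≤ i → p.dotLink s(i, j) = q.dotLink s(i, j)) : p = q := by
  apply Pattern.ext
  · funext a
    induction a using Sym2.ind with
    | _ i j =>
      rcases le_total j i with h | h
      · exact h1 i j h
      · rw [Sym2.eq_swap]; exact h1 j i h
  · funext a
    induction a using Sym2.ind with
    | _ i j =>
      rcases le_total j i with h | h
      · exact h2 i j h
      · rw [Sym2.eq_swap]; exact h2 j i h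

/-- Fibre cardinalities are determined by the cardinalities of quadrants. -/
lemma card_fibre_eq {α : Type*} [DecidableEq α] {X X' : Finset α} {φ ψ φ' ψ' : α → ℕ}
    (h : ∀ i j, (X.filter fun s => i ≤ φ s ∧ ψ s < j).card =
      (X'.filter fun s => i ≤ φ' s ∧ ψ' s < j).card) (i j : ℕ) :
    (X.filter fun s => φ s = i ∧ ψ s = j).card = (X'.filter fun s => φ' s = i ∧ ψ' s = j).card := by
  -- The indicator of one cell is a mixed second difference of indicators of quadrants.
  have key : ∀ (X : Finset α) (φ ψ : α → ℕ),
      (X.filter fun s => φ s = i ∧ ψ s = j).card + (X.filter fun s => i ≤ φ s ∧ ψ s < j).card +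
        (X.filter fun s => i + 1 ≤ φ s ∧ ψ s < j + 1).card =
      (X.filter fun s => i ≤ φ s ∧ ψ s < j + 1).card +
        (X.filter fun s => i + 1 ≤ φ s ∧ ψ s < j).card := by
    intro X φ ψ
    simp only [Finset.card_filter, ← Finset.sum_add_distrib]
    refine Finset.sum_congr rfl fun s _ => ?_
    split_ifs <;> omega
  have h1 := key X φ ψ
  have h2 := key X' φ' ψ'
  have h3 := h i j
  have h4 := h (i + 1) (j + 1)
  have h5 := h i (j + 1)
  have h6 := h (i + 1) j
  omega

end Counting

/-! ### Dimensions attached to `x` and the flag that count links. -/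

section Invariants

variable {κ : FormKind} {l n k : ℕ} {V : Fin k → Submodule ℂ (Fin n → ℂ)}
  {x : Matrix (Fin n) (Fin n) ℂ} {e f : Fin l → Fin n → ℂ} {β : Fin l → Fin k}
  {m : Fin l → Fin l} {D : Set (Fin l)}

/-- The sum of the first `j` steps of the flag. -/
def firstSteps (V : Fin k → Submodule ℂ (Fin n → ℂ)) (j : ℕ) : Submodule ℂ (Fin n → ℂ) :=
  ⨆ i, ⨆ _ : i.1 < j, V i

namespace LinkBasis

variable (h : LinkBasis κ V x e f β m D)
include h

lemma e_mem {t : Fin l} {i : Fin k} (hti : β t ≤ i) : e t ∈ V i := by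
  rw [h.flag]; exact Submodule.subset_span ⟨t, hti, rfl⟩

lemma firstSteps_eq (j : ℕ) : firstSteps V j = Submodule.span ℂ (e '' {t | (β t).1 < j}) := by
  apply le_antisymm
  · refine iSup₂_le fun i hi => ?_
    rw [h.flag]
    refine Submodule.span_mono (Set.image_mono fun t ht => ?_)
    have : (β t).1 ≤ i.1 := ht
    exact lt_of_le_of_lt this hi
  · rw [Submodule.span_le]
    rintro _ ⟨t, ht, rfl⟩
    exact (le_iSup₂_of_le (β t) ht le_rfl : V (β t) ≤ _) (h.e_mem le_rfl)

lemma linearIndependent : LinearIndependent ℂ (Sum.elim e f) :=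
  linearIndependent_pairs h.ee h.ff h.ef

lemma linearIndependent_e : LinearIndependent ℂ e :=
  h.linearIndependent.comp Sum.inl Sum.inl_injective

lemma form_fe (hκ : κ = .symplectic → Even n) (s t : Fin l) :
    form κ n (f s) (e t) = if s = t then κ.sgn else 0 := by
  rw [form_symm κ hκ, h.ef]
  simp [eq_comm]

/-- Decomposition of a vector with respect to the basis. -/
lemma exists_decomp (hκ : κ = .symplectic → Even n) (v : Fin n → ℂ) :
    ∃ u, (∀ t, form κ n (e t) u = 0 ∧ form κ n (f t) u = 0) ∧
      v = ∑ t, (form κ n v (f t) • e t + form κ n (e t) v • f t) + u := by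
  refine ⟨v - ∑ t, (form κ n v (f t) • e t + form κ n (e t) v • f t), fun t => ⟨?_, ?_⟩, by simp⟩
  · rw [map_sub, form_sum_pairs _ h.ee h.ef, sub_self]
  · rw [form_symm κ hκ, map_sub, LinearMap.sub_apply, form_sum_pairs' _ h.ff h.ef, sub_self,
      mul_zero]

lemma mulVec_eq (hκ : κ = .symplectic → Even n) (v : Fin n → ℂ) :
    x.mulVec v = ∑ t, (form κ n v (f t) • linkE e m D t + form κ n (e t) v • linkF κ e f m D t) := by
  obtain ⟨u, hu, hv⟩ := h.exists_decomp hκ v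
  conv_lhs => rw [hv]
  rw [Matrix.mulVec_add, h.xz u hu, add_zero, ← Matrix.mulVecLin_apply, map_sum]
  refine Finset.sum_congr rfl fun t _ => ?_
  rw [map_add, map_smul, map_smul, Matrix.mulVecLin_apply, Matrix.mulVecLin_apply, h.xe, h.xf]

open Classical in
-- The space is spanned by basis vectors: the `e s` in blocks below `i`, and `e s = x (e (m s))` for
-- the smaller ends `s` whose partner lies in a block below `j`.
lemma finrank_map_firstSteps (i j : ℕ) :
    finrank ℂ ((firstSteps V j).map x.mulVecLin ⊔ firstSteps V i : Submodule ℂ (Fin n → ℂ)) =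
      (Finset.univ.filter fun s => (β s).1 < i).card +
        (Finset.univ.filter fun s =>
          (s ∉ D ∧ s < m s) ∧ i ≤ (β s).1 ∧ (β (m s)).1 < j).card := by
  have key : (firstSteps V j).map x.mulVecLin ⊔ firstSteps V i =
      Submodule.span ℂ (e '' ((Finset.univ.filter fun s => (β s).1 < i) ∪
        (Finset.univ.filter fun s =>
          (s ∉ D ∧ s < m s) ∧ i ≤ (β s).1 ∧ (β (m s)).1 < j) : Finset (Fin l))) := by
    have hi : firstSteps V i ≤ Submodule.span ℂ (e '' ((Finset.univ.filter fun s => (β s).1 < i) ∪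
        (Finset.univ.filter fun s =>
          (s ∉ D ∧ s < m s) ∧ i ≤ (β s).1 ∧ (β (m s)).1 < j) : Finset (Fin l))) := by
      rw [h.firstSteps_eq]
      refine Submodule.span_mono (Set.image_mono fun t ht => ?_)
      have : (β t).1 < i := ht
      simp [this]
    apply le_antisymm
    · refine sup_le ?_ hi
      rw [h.firstSteps_eq, Submodule.map_span, Submodule.span_le]
      rintro _ ⟨_, ⟨t, ht, rfl⟩, rfl⟩
      have ht' : (β t).1 < j := ht
      rw [Matrix.mulVecLin_apply, h.xe, linkE]
      split_ifs with hc
      · refine Submodule.subset_span ⟨m t, ?_, rfl⟩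
        rcases lt_or_ge (β (m t)).1 i with hmi | hmi
        · simp [hmi]
        · have : m t ∉ D := fun hD => hc.1 ((h.m_D t).1 hD)
          simp [h.m_m, ht', hc.2, hmi, this]
      · exact Submodule.zero_mem _
    · rw [Submodule.span_le]
      rintro _ ⟨t, ht, rfl⟩
      rw [Finset.mem_coe, Finset.mem_union, Finset.mem_filter, Finset.mem_filter] at ht
      rcases ht with ⟨_, ht⟩ | ⟨_, ⟨ht1, ht2⟩, _, ht4⟩
      · refine Submodule.mem_sup_right ?_
        rw [h.firstSteps_eq]
        exact Submodule.subset_span ⟨t, ht, rfl⟩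
      · refine Submodule.mem_sup_left ⟨e (m t), ?_, ?_⟩
        · rw [SetLike.mem_coe, h.firstSteps_eq]
          exact Submodule.subset_span ⟨m t, ht4, rfl⟩
        · have : m t ∉ D := fun hD => ht1 ((h.m_D t).1 hD)
          rw [Matrix.mulVecLin_apply, h.xe, linkE, if_pos ⟨this, by rwa [h.m_m]⟩, h.m_m]
  rw [key, finrank_span_image h.linearIndependent_e, Set.ncard_coe_finset,
    Finset.card_union_of_disjoint]
  rw [Finset.disjoint_filter]
  intro s _ h1 h2
  omega

open Classical in
-- Up to vectors killed by `x`, the orthogonal of the first `j` steps is spanned by all `e t` and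
-- the `f t` in blocks at least `j`. The image contributes the `e s` at smaller ends of plain links,
-- the `e s` at dots with partner in a block at least `j`, and, up to sign, the `f` at larger ends
-- of plain links. The third summand is the one that sees dots.
lemma finrank_map_orthogonal (hκ : κ = .symplectic → Even n) (i j : ℕ) :
    finrank ℂ (((form κ n).orthogonal (firstSteps V j)).map x.mulVecLin ⊔ firstSteps V i :
        Submodule ℂ (Fin n → ℂ)) =
      (Finset.univ.filter fun s => (β s).1 < i).card +
        (Finset.univ.filter fun s => (s ∉ D ∧ s < m s) ∧ i ≤ (β s).1).card +
        (Finset.univ.filter fun s => s ∈ D ∧ i ≤ (β s).1 ∧ j ≤ (β (m s)).1).card +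
        (Finset.univ.filter fun s => (s ∉ D ∧ s < m s) ∧ j ≤ (β s).1).card := by
  set F1 : Finset (Fin l) := (Finset.univ.filter fun s => (β s).1 < i) ∪
        (Finset.univ.filter fun s => (s ∉ D ∧ s < m s) ∧ i ≤ (β s).1) ∪
        (Finset.univ.filter fun s => s ∈ D ∧ i ≤ (β s).1 ∧ j ≤ (β (m s)).1) with hF1
  set F2 : Finset (Fin l) :=
    Finset.univ.filter fun s => (s ∉ D ∧ m s < s) ∧ j ≤ (β (m s)).1 with hF2
  set S : Submodule ℂ (Fin n → ℂ) :=
    Submodule.span ℂ (Sum.elim e f '' (F1.disjSum F2 : Finset (Fin l ⊕ Fin l))) with hS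
  have heS : ∀ t ∈ F1, e t ∈ S := fun t ht =>
    Submodule.subset_span ⟨Sum.inl t, by simpa using ht, rfl⟩
  have hfS : ∀ t ∈ F2, f t ∈ S := fun t ht =>
    Submodule.subset_span ⟨Sum.inr t, by simpa using ht, rfl⟩
  have heO : ∀ t, e t ∈ (form κ n).orthogonal (firstSteps V j) := by
    intro t
    rw [LinearMap.BilinForm.mem_orthogonal_iff, h.firstSteps_eq]
    intro v hv
    induction hv using Submodule.span_induction with
    | mem v hv => obtain ⟨s, _, rfl⟩ := hv; exact h.ee s t
    | zero => simp
    | add u v _ _ hu hv => rw [map_add, LinearMap.add_apply, hu, hv, add_zero]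
    | smul c v _ hv => rw [map_smul, LinearMap.smul_apply, hv, smul_zero]
  have hfO : ∀ t, j ≤ (β t).1 → f t ∈ (form κ n).orthogonal (firstSteps V j) := by
    intro t ht
    rw [LinearMap.BilinForm.mem_orthogonal_iff, h.firstSteps_eq]
    intro v hv
    induction hv using Submodule.span_induction with
    | mem v hv =>
      obtain ⟨s, hs, rfl⟩ := hv
      have hs' : (β s).1 < j := hs
      have : s ≠ t := by rintro rfl; omega
      rw [h.ef, if_neg this]
    | zero => simp
    | add u v _ _ hu hv => rw [map_add, LinearMap.add_apply, hu, hv, add_zero]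
    | smul c v _ hv => rw [map_smul, LinearMap.smul_apply, hv, smul_zero]
  have hDm : ∀ t, t ∉ D → m t ∉ D := fun t ht hD => ht ((h.m_D t).1 hD)
  have key : ((form κ n).orthogonal (firstSteps V j)).map x.mulVecLin ⊔ firstSteps V i = S := by
    apply le_antisymm
    · refine sup_le ?_ ?_
      · rintro _ ⟨v, hv, rfl⟩
        rw [Matrix.mulVecLin_apply, h.mulVec_eq hκ]
        refine Submodule.sum_mem _ fun t _ => Submodule.add_mem _ (Submodule.smul_mem _ _ ?_) ?_
        · rw [linkE]
          split_ifs with hc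
          · apply heS
            rcases lt_or_ge (β (m t)).1 i with hmi | hmi
            · simp [hF1, hmi]
            · simp [hF1, hmi, h.m_m, hc.2, hDm t hc.1]
          · exact Submodule.zero_mem _
        · rcases lt_or_ge (β t).1 j with htj | htj
          · have : form κ n (e t) v = 0 := by
              refine (LinearMap.BilinForm.mem_orthogonal_iff.1 hv) _ ?_
              rw [h.firstSteps_eq]
              exact Submodule.subset_span ⟨t, htj, rfl⟩
            rw [this, zero_smul]
            exact Submodule.zero_mem _
          · refine Submodule.smul_mem _ _ ?_
            have hE : t ∈ D → e (m t) ∈ S := by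
              intro ht
              apply heS
              rcases lt_or_ge (β (m t)).1 i with hmi | hmi
              · simp [hF1, hmi]
              · simp [hF1, hmi, h.m_m, (h.m_D t).2 ht, htj]
            have hF : t ∉ D → t < m t → f (m t) ∈ S := by
              intro ht ht'
              apply hfS
              simp [hF2, h.m_m, hDm t ht, ht', htj]
            unfold linkF
            by_cases ht : t ∈ D
            · cases κ
              · simpa [ht] using hE ht
              · simp only [ht, if_true]
                split_ifs
                exacts [hE ht, Submodule.neg_mem _ (hE ht)]
            · simp only [ht, if_false]
              split_ifs with ht'
              exacts [Submodule.neg_mem _ (hF ht ht'), Submodule.zero_mem _]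
      · rw [h.firstSteps_eq, Submodule.span_le]
        rintro _ ⟨t, ht, rfl⟩
        have ht' : (β t).1 < i := ht
        exact heS t (by simp [hF1, ht'])
    · rw [hS, Submodule.span_le]
      rintro _ ⟨t | t, ht, rfl⟩
      · rw [Finset.mem_coe, Finset.inl_mem_disjSum, hF1, Finset.mem_union, Finset.mem_union,
          Finset.mem_filter, Finset.mem_filter, Finset.mem_filter] at ht
        rcases ht with (⟨_, ht⟩ | ⟨_, ⟨ht1, ht2⟩, _⟩) | ⟨_, ht1, _, ht2⟩
        · refine Submodule.mem_sup_right ?_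
          rw [h.firstSteps_eq]
          exact Submodule.subset_span ⟨t, ht, rfl⟩
        · refine Submodule.mem_sup_left ⟨e (m t), heO _, ?_⟩
          rw [Matrix.mulVecLin_apply, h.xe, linkE, if_pos ⟨hDm t ht1, by rwa [h.m_m]⟩, h.m_m]
          rfl
        · have hmt := (h.m_D t).2 ht1
          have hx : e t ∈ Submodule.map x.mulVecLin
              ((form κ n).orthogonal (firstSteps V j)) := by
            have hx' : x.mulVecLin (f (m t)) ∈ Submodule.map x.mulVecLin
              ((form κ n).orthogonal (firstSteps V j)) := ⟨f (m t), hfO _ ht2, rfl⟩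
            rw [Matrix.mulVecLin_apply, h.xf, linkF.eq_def, if_pos hmt, h.m_m] at hx'
            cases κ
            · exact hx'
            · simp only at hx'
              split_ifs at hx'
              exacts [hx', (Submodule.neg_mem_iff _).1 hx']
          exact Submodule.mem_sup_left hx
      · rw [Finset.mem_coe, Finset.inr_mem_disjSum, hF2, Finset.mem_filter] at ht
        obtain ⟨_, ⟨ht1, ht2⟩, ht3⟩ := ht
        refine Submodule.mem_sup_left ⟨-f (m t), Submodule.neg_mem _ (hfO _ ht3), ?_⟩
        rw [map_neg, Matrix.mulVecLin_apply, h.xf, linkF.eq_def, if_neg (hDm t ht1),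
          if_pos (by rwa [h.m_m]), h.m_m, neg_neg]
        rfl
  rw [key, hS, finrank_span_image h.linearIndependent, Set.ncard_coe_finset,
    Finset.card_disjSum]
  congr 1
  · rw [hF1, Finset.card_union_of_disjoint, Finset.card_union_of_disjoint]
    · rw [Finset.disjoint_filter]
      intro s _ h1 h2
      omega
    · rw [Finset.disjoint_union_left, Finset.disjoint_filter, Finset.disjoint_filter]
      exact ⟨fun s _ h1 h2 => absurd h1 (by omega), fun s _ h1 h2 => h1.1.1 h2.1⟩
  -- Passing to partners turns the count of larger ends into a count of smaller ends.
  · rw [hF2, ← card_filter_involution h.m_m]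
    congr 1
    ext t
    simp only [Finset.mem_filter, Finset.mem_univ, true_and, h.m_m, h.m_D]

end LinkBasis

end Invariants
-- The matrix determines its pattern.
section Uniqueness

variable {κ : FormKind} {l n k : ℕ}

section Matchings

variable {β : Fin l → Fin k} {m : Fin l → Fin l} {D : Set (Fin l)}

open Classical in
-- Counts plain links by their smaller end, the form in which they occur in the dimension formulas.
lemma plainCount_eq_flip (hm : ∀ t, m (m t) = t) (hD : ∀ t, m t ∈ D ↔ t ∈ D) (i j : Fin k) :
    plainCount β m D i j = ((Finset.univ.filter fun s => s ∉ D ∧ s < m s).filter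
      fun s => (β s).1 = j.1 ∧ (β (m s)).1 = i.1).card := by
  rw [plainCount, Finset.filter_filter, ← card_filter_involution hm]
  congr 1
  ext t
  simp only [Finset.mem_filter, Finset.mem_univ, true_and, hm, hD, Fin.ext_iff]
  tauto

lemma plainCount_eq_zero (hβ : Monotone β) {i j : Fin k} (hij : i < j) :
    plainCount β m D i j = 0 := by
  classical
  rw [plainCount, Finset.card_eq_zero, Finset.filter_eq_empty_iff]
  rintro t _ ⟨_, h1, rfl, rfl⟩
  exact absurd (hβ h1.le) (not_le.2 hij)

lemma dotCount_eq_zero (hβ : Monotone β) {i j : Fin k} (hij : i < j) :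
    dotCount β m D i j = 0 := by
  classical
  rw [dotCount, Finset.card_eq_zero, Finset.filter_eq_empty_iff]
  rintro t _ ⟨_, h1, rfl, rfl⟩
  exact absurd (hβ h1) (not_le.2 hij)

open Classical in
/-- The number of points of `D` in the block `i` linked to the block `j`. -/
noncomputable def dotPoints (β : Fin l → Fin k) (m : Fin l → Fin l) (D : Set (Fin l))
    (i j : Fin k) : ℕ :=
  ((Finset.univ.filter fun s => s ∈ D).filter
      fun s => (β s).1 = i.1 ∧ (β (m s)).1 = j.1).card

lemma dotPoints_eq_of_lt (hβ : Monotone β) {i j : Fin k} (hij : j < i) :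
    dotPoints β m D i j = dotCount β m D i j := by
  classical
  rw [dotPoints, dotCount, Finset.filter_filter]
  congr 1
  ext t
  simp only [Finset.mem_filter, Finset.mem_univ, true_and, ← Fin.ext_iff]
  constructor
  · rintro ⟨h1, rfl, rfl⟩
    exact ⟨h1, (hβ.reflect_lt hij).le, rfl, rfl⟩
  · rintro ⟨h1, _, h2, h3⟩; exact ⟨h1, h2, h3⟩

/-- After separation the dots inside a block are loops, for which `m t ≤ t` is automatic. -/
lemma dotPoints_self_symplectic (hsep : DotsSeparated .symplectic β m D) (i : Fin k) :
    dotPoints β m D i i = dotCount β m D i i := by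
  classical
  rw [dotPoints, dotCount, Finset.filter_filter]
  congr 1
  ext t
  simp only [Finset.mem_filter, Finset.mem_univ, true_and, ← Fin.ext_iff]
  constructor
  · rintro ⟨h1, h2, h3⟩
    refine ⟨h1, ?_, h2, h3⟩
    by_contra hne
    exact hsep rfl t h1 (fun h => hne h.le) (h3.trans h2.symm)
  · rintro ⟨h1, _, h2, h3⟩; exact ⟨h1, h2, h3⟩

/-- Without loops every dot inside a block has two distinct ends, both of which are counted on the
left. -/
lemma dotPoints_self_orthogonal (hm : ∀ t, m (m t) = t) (hD : ∀ t, m t ∈ D ↔ t ∈ D)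
    (hne : ∀ t ∈ D, m t ≠ t) (i : Fin k) :
    dotPoints β m D i i = 2 * dotCount β m D i i := by
  classical
  have h1 : dotCount β m D i i =
      (Finset.univ.filter fun t => t ∈ D ∧ t ≤ m t ∧ β t = i ∧ β (m t) = i).card := by
    rw [dotCount, ← card_filter_involution hm]
    congr 1
    ext t
    simp only [Finset.mem_filter, Finset.mem_univ, true_and, hm, hD]
    tauto
  rw [two_mul]
  conv_rhs => enter [2]; rw [h1]
  rw [dotPoints, dotCount, Finset.filter_filter, ← Finset.card_union_of_disjoint]
  · congr 1
    ext t
    simp only [Finset.mem_filter, Finset.mem_univ, true_and, ← Fin.ext_iff, Finset.mem_union]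
    have := le_total t (m t)
    tauto
  · rw [Finset.disjoint_filter]
    rintro t _ ⟨h2, h3, _⟩ ⟨_, h4, _⟩
    exact hne t h2 (le_antisymm h3 h4)

lemma dotCount_eq_of_dotPoints {β' : Fin l → Fin k} {m' : Fin l → Fin l} {D' : Set (Fin l)}
    (hβ : Monotone β) (hm : ∀ t, m (m t) = t) (hD : ∀ t, m t ∈ D ↔ t ∈ D)
    (hβ' : Monotone β') (hm' : ∀ t, m' (m' t) = t) (hD' : ∀ t, m' t ∈ D' ↔ t ∈ D')
    (horth : κ = .orthogonal → ∀ t ∈ D, m t ≠ t) (horth' : κ = .orthogonal → ∀ t ∈ D', m' t ≠ t)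
    (hsep : DotsSeparated κ β m D) (hsep' : DotsSeparated κ β' m' D')
    (h : ∀ i j, dotPoints β m D i j = dotPoints β' m' D' i j) {i j : Fin k} (hij : j ≤ i) :
    dotCount β m D i j = dotCount β' m' D' i j := by
  rcases hij.eq_or_lt with rfl | hij
  · cases κ
    · rw [← dotPoints_self_symplectic hsep, ← dotPoints_self_symplectic hsep', h]
    · have h1 := dotPoints_self_orthogonal (β := β) hm hD (horth rfl) j
      have h2 := dotPoints_self_orthogonal (β := β') hm' hD' (horth' rfl) j
      have := h j j
      omega
  · rw [← dotPoints_eq_of_lt hβ hij, ← dotPoints_eq_of_lt hβ' hij, h]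

end Matchings

variable {V : Fin k → Submodule ℂ (Fin n → ℂ)} {x : Matrix (Fin n) (Fin n) ℂ}

lemma LinkBasis.card_lt {e f : Fin l → Fin n → ℂ} {β : Fin l → Fin k}
    {m : Fin l → Fin l} {D : Set (Fin l)} (h : LinkBasis κ V x e f β m D) (i : ℕ) :
    (Finset.univ.filter fun s => (β s).1 < i).card = finrank ℂ (firstSteps V i) := by
  rw [h.firstSteps_eq, finrank_span_image h.linearIndependent_e, ← Set.ncard_coe_finset]
  congr 1
  ext t
  simp

open Classical in
-- The dimensions in `finrank_map_firstSteps` and `finrank_map_orthogonal` do not depend on the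
-- basis. Hence the numbers of points in all quadrants agree, and `card_fibre_eq` passes to single
-- cells.
lemma LinkBasis.counts_eq (hκ : κ = .symplectic → Even n) {e f e' f' : Fin l → Fin n → ℂ}
    {β β' : Fin l → Fin k} {m m' : Fin l → Fin l} {D D' : Set (Fin l)}
    (h : LinkBasis κ V x e f β m D) (h' : LinkBasis κ V x e' f' β' m' D') (i j : Fin k) :
    plainCount β m D i j = plainCount β' m' D' i j ∧
      dotPoints β m D i j = dotPoints β' m' D' i j := by
  have h0 : ∀ i, (Finset.univ.filter fun s => (β s).1 < i).card =
      (Finset.univ.filter fun s => (β' s).1 < i).card := fun i => by rw [h.card_lt, h'.card_lt]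
  have h1 : ∀ i j, (Finset.univ.filter fun s =>
          (s ∉ D ∧ s < m s) ∧ i ≤ (β s).1 ∧ (β (m s)).1 < j).card =
      (Finset.univ.filter fun s =>
          (s ∉ D' ∧ s < m' s) ∧ i ≤ (β' s).1 ∧ (β' (m' s)).1 < j).card := fun i j => by
    have h2 := h.finrank_map_firstSteps i j
    rw [h'.finrank_map_firstSteps i j, h0] at h2
    omega
  have h2 : ∀ i, (Finset.univ.filter fun s => (s ∉ D ∧ s < m s) ∧ i ≤ (β s).1).card =
      (Finset.univ.filter fun s => (s ∉ D' ∧ s < m' s) ∧ i ≤ (β' s).1).card := fun i => by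
    -- With `j = k` the condition on the partner is void, which leaves the marginal count.
    have h2 := h1 i k
    simpa only [Fin.is_lt, and_true] using h2
  have h3 : ∀ i j, (Finset.univ.filter fun s => s ∈ D ∧ i ≤ (β s).1 ∧ j ≤ (β (m s)).1).card =
      (Finset.univ.filter fun s => s ∈ D' ∧ i ≤ (β' s).1 ∧ j ≤ (β' (m' s)).1).card :=
    fun i j => by
    have h4 := h.finrank_map_orthogonal hκ i j
    rw [h'.finrank_map_orthogonal hκ i j, h0, h2, h2] at h4
    omega
  constructor
  · rw [plainCount_eq_flip h.m_m h.m_D, plainCount_eq_flip h'.m_m h'.m_D]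
    apply card_fibre_eq
    intro i j
    rw [Finset.filter_filter, Finset.filter_filter]
    exact h1 i j
  · apply card_fibre_eq
    intro i j
    rw [Finset.filter_filter, Finset.filter_filter]
    -- The dimensions give quadrants with partner block at least `j`; the complementary ones follow
    -- by subtraction from the case `j = 0`.
    have key : ∀ (β : Fin l → Fin k) (m : Fin l → Fin l) (D : Set (Fin l)),
        (Finset.univ.filter fun s => s ∈ D ∧ i ≤ (β s).1 ∧ (β (m s)).1 < j).card +
        (Finset.univ.filter fun s => s ∈ D ∧ i ≤ (β s).1 ∧ j ≤ (β (m s)).1).card =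
        (Finset.univ.filter fun s => s ∈ D ∧ i ≤ (β s).1 ∧ 0 ≤ (β (m s)).1).card := by
      intro β m D
      simp only [Finset.card_filter, ← Finset.sum_add_distrib]
      refine Finset.sum_congr rfl fun s _ => ?_
      by_cases hs : s ∈ D <;> simp only [hs, true_and, false_and, if_false]
      split_ifs <;> omega
    have h4 := key β m D
    have h5 := key β' m' D'
    have h6 := h3 i j
    have h7 := h3 i 0
    omega

/-- The pattern of a normal form is determined by the matrix. -/
theorem HasNormalForm.unique (hκ : κ = .symplectic → Even n) {q q' : Pattern k}
    (h : HasNormalForm κ l V x q) (h' : HasNormalForm κ l V x q') : q = q' := by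
  obtain ⟨e, f, β, m, D, hb, hs, rfl⟩ := hasNormalForm_iff.1 h
  obtain ⟨e', f', β', m', D', hb', hs', rfl⟩ := hasNormalForm_iff.1 h'
  have hc := hb.counts_eq hκ hb'
  refine Pattern.ext_of_le (fun i j hij => ?_) fun i j hij => ?_
  · rw [patternOf_link hb.mono hij, patternOf_link hb'.mono hij, (hc i j).1]
  · rw [patternOf_dotLink hb.mono hij, patternOf_dotLink hb'.mono hij]
    exact dotCount_eq_of_dotPoints hb.mono hb.m_m hb.m_D hb'.mono hb'.m_m hb'.m_D hb.orth hb'.orth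
      hs hs' (fun i j => (hc i j).2) hij

end Uniqueness

/-! ### Link patterns with equal multiplicities are equal up to a permutation of points. -/

section Permutation

variable {κ : FormKind} {l k : ℕ}

/-- The points in blocks below `i` form an initial segment, which is determined by its size. -/
lemma monotone_lt_iff {β : Fin l → Fin k} (hβ : Monotone β) (t : Fin l) (i : ℕ) :
    (β t).1 < i ↔ t.1 < (Finset.univ.filter fun s => (β s).1 < i).card := by
  constructor
  · intro h
    have : Finset.Iic t ⊆ Finset.univ.filter fun s => (β s).1 < i := fun s hs => by
      have := hβ (Finset.mem_Iic.1 hs)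
      rw [Fin.le_def] at this
      simp only [Finset.mem_filter, Finset.mem_univ, true_and]
      omega
    have := Finset.card_le_card this
    rw [Fin.card_Iic] at this
    omega
  · intro h
    by_contra hc
    have : (Finset.univ.filter fun s => (β s).1 < i) ⊆ Finset.Iio t := fun s hs => by
      simp only [Finset.mem_filter, Finset.mem_univ, true_and] at hs
      rw [Finset.mem_Iio]
      by_contra hst
      have := hβ (not_lt.1 hst)
      rw [Fin.le_def] at this
      omega
    have := Finset.card_le_card this
    rw [Fin.card_Iio] at this
    omega

lemma monotone_ext {β β' : Fin l → Fin k} (hβ : Monotone β) (hβ' : Monotone β')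
    (h : ∀ i, (Finset.univ.filter fun s => (β s).1 < i).card =
      (Finset.univ.filter fun s => (β' s).1 < i).card) : β = β' := by
  funext t
  have key : ∀ i, (β t).1 < i ↔ (β' t).1 < i := fun i => by
    rw [monotone_lt_iff hβ, monotone_lt_iff hβ', h]
  have h1 := key ((β t).1 + 1)
  have h2 := key ((β' t).1 + 1)
  apply Fin.ext
  omega

open Classical in
/-- The type of a point in a link pattern: its own block, and, unless it is free, its kind and the
block of its partner. -/
noncomputable def pointType (β : Fin l → Fin k) (m : Fin l → Fin l) (D : Set (Fin l)) (t : Fin l) :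
    Option ((Bool × Bool × Bool) × Fin k) × Fin k :=
  (if t ∉ D ∧ m t = t then none
    else some ((decide (t ∈ D), decide (m t < t), decide (t < m t)), β (m t)), β t)

variable {β : Fin l → Fin k} {m m' : Fin l → Fin l} {D D' : Set (Fin l)}

lemma pointType_eq {s t : Fin l} (h : pointType β m D t = pointType β m' D' s) :
    β t = β s ∧ β (m t) = β (m' s) ∧ (t ∈ D ↔ s ∈ D') ∧ (m t < t ↔ m' s < s) ∧
      (t < m t ↔ s < m' s) := by
  classical
  simp only [pointType, Prod.mk.injEq] at h
  obtain ⟨h1, h2⟩ := h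
  split_ifs at h1 with h3 h4
  · simp [h2, h3, h4]
  · simp only [Option.some.injEq, Prod.mk.injEq, decide_eq_decide] at h1
    exact ⟨h2, h1.2, h1.1.1, h1.1.2.1, h1.1.2.2⟩

open Classical in
-- Separated symplectic dots on the diagonal are loops, and all other dots have two ends. Together
-- with `card_dot_eq` this recovers loops and proper links from `dotCount` alone.
lemma card_dot_lt (horth : κ = .orthogonal → ∀ t ∈ D, m t ≠ t)
    (hsep : DotsSeparated κ β m D) (i j : Fin k) :
    (Finset.univ.filter fun t => t ∈ D ∧ m t < t ∧ β t = i ∧ β (m t) = j).card =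
      if κ = .symplectic ∧ i = j then 0 else dotCount β m D i j := by
  split_ifs with h
  · rw [Finset.card_eq_zero, Finset.filter_eq_empty_iff]
    rintro t _ ⟨h1, h2, h3, h4⟩
    exact hsep h.1 t h1 h2.ne (h4.trans (h.2.symm.trans h3.symm))
  · rw [dotCount]
    congr 1
    ext t
    simp only [Finset.mem_filter, Finset.mem_univ, true_and]
    refine and_congr_right fun h1 => ⟨fun h2 => ⟨h2.1.le, h2.2⟩, fun h2 => ⟨?_, h2.2⟩⟩
    refine lt_of_le_of_ne h2.1 fun heq => ?_
    cases κ
    · exact h ⟨rfl, by rw [← h2.2.1, ← h2.2.2, heq]⟩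
    · exact horth rfl t h1 heq

open Classical in
lemma card_dot_eq (horth : κ = .orthogonal → ∀ t ∈ D, m t ≠ t)
    (hsep : DotsSeparated κ β m D) (i j : Fin k) :
    (Finset.univ.filter fun t => t ∈ D ∧ m t = t ∧ β t = i ∧ β (m t) = j).card =
      if κ = .symplectic ∧ i = j then dotCount β m D i j else 0 := by
  split_ifs with h
  · rw [dotCount]
    congr 1
    ext t
    simp only [Finset.mem_filter, Finset.mem_univ, true_and]
    refine and_congr_right fun h1 => ⟨fun h2 => ⟨h2.1.le, h2.2⟩, fun h2 => ⟨?_, h2.2⟩⟩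
    by_contra hne
    exact hsep h.1 t h1 hne (h2.2.2.trans (h.2.symm.trans h2.2.1.symm))
  · rw [Finset.card_eq_zero, Finset.filter_eq_empty_iff]
    rintro t _ ⟨h1, h2, h3, h4⟩
    cases κ
    · exact h ⟨rfl, by rw [← h3, ← h4, h2]⟩
    · exact horth rfl t h1 h2

open Classical in
-- The number of points of each non-free type depends only on multiplicities of links; larger and
-- smaller ends are exchanged by the involution, and contradictory order relations give zero.
lemma card_pointType_some (hm : ∀ t, m (m t) = t) (hD : ∀ t, m t ∈ D ↔ t ∈ D) (d a b : Bool)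
    (i j : Fin k) :
    (Finset.univ.filter fun t => pointType β m D t = (some ((d, a, b), j), i)).card =
      match d, a, b with
      | false, true, false => plainCount β m D i j
      | false, false, true => plainCount β m D j i
      | true, true, false =>
        (Finset.univ.filter fun t => t ∈ D ∧ m t < t ∧ β t = i ∧ β (m t) = j).card
      | true, false, true =>
        (Finset.univ.filter fun t => t ∈ D ∧ m t < t ∧ β t = j ∧ β (m t) = i).card
      | true, false, false =>
        (Finset.univ.filter fun t => t ∈ D ∧ m t = t ∧ β t = i ∧ β (m t) = j).card
      | _, _, _ => 0 := by
  have hset : ∀ t, pointType β m D t = (some ((d, a, b), j), i) ↔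
      ¬(t ∉ D ∧ m t = t) ∧ (decide (t ∈ D) = d ∧ decide (m t < t) = a ∧ decide (t < m t) = b) ∧
        β (m t) = j ∧ β t = i := by
    intro t
    by_cases h : t ∉ D ∧ m t = t <;> simp [pointType, h, and_assoc]
  simp only [hset]
  cases d <;> cases a <;> cases b <;>
    simp only [decide_eq_true_eq, decide_eq_false_iff_not, Finset.card_eq_zero,
      Finset.filter_eq_empty_iff]
  · intro t _; rintro ⟨h1, ⟨h2, h3, h4⟩, _⟩
    exact h1 ⟨h2, le_antisymm (not_lt.1 h4) (not_lt.1 h3)⟩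
  · rw [plainCount, ← card_filter_involution hm]
    congr 1
    ext t
    simp only [Finset.mem_filter, Finset.mem_univ, true_and, hm, hD]
    refine ⟨fun h => ⟨h.2.1.1, h.2.1.2.2, h.2.2⟩, fun h => ⟨fun h' => h.2.1.ne' h'.2,
      ⟨h.1, h.2.1.not_gt, h.2.1⟩, h.2.2⟩⟩
  · rw [plainCount]
    congr 1
    ext t
    simp only [Finset.mem_filter, Finset.mem_univ, true_and]
    refine ⟨fun h => ⟨h.2.1.1, h.2.1.2.1, h.2.2.symm⟩, fun h => ⟨fun h' => h.2.1.ne h'.2,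
      ⟨h.1, h.2.1, h.2.1.not_gt⟩, h.2.2.symm⟩⟩
  · intro t _; rintro ⟨h1, ⟨h2, h3, h4⟩, _⟩
    exact lt_asymm h3 h4
  · congr 1
    ext t
    simp only [Finset.mem_filter, Finset.mem_univ, true_and]
    refine ⟨fun h => ⟨h.2.1.1, le_antisymm (not_lt.1 h.2.1.2.2) (not_lt.1 h.2.1.2.1), h.2.2.symm⟩,
      fun h => ⟨fun h' => h'.1 h.1, ⟨h.1, h.2.1.not_lt, h.2.1.not_gt⟩, h.2.2.symm⟩⟩
  · rw [← card_filter_involution hm]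
    congr 1
    ext t
    simp only [Finset.mem_filter, Finset.mem_univ, true_and, hm, hD]
    refine ⟨fun h => ⟨h.2.1.1, h.2.1.2.2, h.2.2⟩, fun h => ⟨fun h' => h.2.1.ne' h'.2,
      ⟨h.1, h.2.1.not_gt, h.2.1⟩, h.2.2⟩⟩
  · congr 1
    ext t
    simp only [Finset.mem_filter, Finset.mem_univ, true_and]
    refine ⟨fun h => ⟨h.2.1.1, h.2.1.2.1, h.2.2.symm⟩, fun h => ⟨fun h' => h.2.1.ne h'.2,
      ⟨h.1, h.2.1, h.2.1.not_gt⟩, h.2.2.symm⟩⟩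
  · intro t _; rintro ⟨h1, ⟨h2, h3, h4⟩, _⟩
    exact lt_asymm h3 h4

open Classical in
/-- Link patterns with the same multiplicities differ by a permutation of the points. -/
lemma exists_perm (hβ : Monotone β) (hm : ∀ t, m (m t) = t) (hD : ∀ t, m t ∈ D ↔ t ∈ D)
    (hm' : ∀ t, m' (m' t) = t) (hD' : ∀ t, m' t ∈ D' ↔ t ∈ D')
    (horth : κ = .orthogonal → ∀ t ∈ D, m t ≠ t) (horth' : κ = .orthogonal → ∀ t ∈ D', m' t ≠ t)
    (hsep : DotsSeparated κ β m D) (hsep' : DotsSeparated κ β m' D')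
    (h : patternOf β m D = patternOf β m' D') :
    ∃ σ : Equiv.Perm (Fin l), (∀ t, β (σ t) = β t) ∧ (∀ t, σ t ∈ D' ↔ t ∈ D) ∧
      (∀ t, m' (σ t) = σ (m t)) ∧ (∀ t, m' (σ t) < σ t ↔ m t < t) ∧
      (∀ t, σ t < m' (σ t) ↔ t < m t) := by
  have hP : ∀ i j, plainCount β m D i j = plainCount β m' D' i j := fun i j => by
    rcases le_or_gt j i with hij | hij
    · rw [← patternOf_link hβ hij, ← patternOf_link hβ hij, h]
    · rw [plainCount_eq_zero hβ hij, plainCount_eq_zero hβ hij]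
  have hQ : ∀ i j, dotCount β m D i j = dotCount β m' D' i j := fun i j => by
    rcases le_or_gt j i with hij | hij
    · rw [← patternOf_dotLink hβ hij, ← patternOf_dotLink hβ hij, h]
    · rw [dotCount_eq_zero hβ hij, dotCount_eq_zero hβ hij]
  have hsome : ∀ y i, (Finset.univ.filter fun t => pointType β m D t = (some y, i)).card =
      (Finset.univ.filter fun t => pointType β m' D' t = (some y, i)).card := by
    rintro ⟨⟨d, a, b⟩, j⟩ i
    rw [card_pointType_some hm hD, card_pointType_some hm' hD', hP, hP, card_dot_lt horth hsep,
      card_dot_lt horth' hsep', card_dot_lt horth hsep, card_dot_lt horth' hsep',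
      card_dot_eq horth hsep, card_dot_eq horth' hsep', hQ, hQ]
  have htot : ∀ (m : Fin l → Fin l) (D : Set (Fin l)) (i : Fin k),
      ∑ y, (Finset.univ.filter fun t => pointType β m D t = (y, i)).card =
        (Finset.univ.filter fun t => β t = i).card := by
    intro m D i
    rw [Finset.card_eq_sum_card_fiberwise (f := fun t => (pointType β m D t).1)
      (t := Finset.univ) (fun _ _ => Finset.mem_coe.2 (Finset.mem_univ _))]
    refine Finset.sum_congr rfl fun y _ => ?_
    rw [Finset.filter_filter]
    congr 1
    ext t
    simp only [Finset.mem_filter, Finset.mem_univ, true_and, Prod.ext_iff]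
    exact and_comm
  have hall : ∀ c, (Finset.univ.filter fun t => pointType β m D t = c).card =
      (Finset.univ.filter fun t => pointType β m' D' t = c).card := by
    rintro ⟨y, i⟩
    cases y with
    | some y => exact hsome y i
    -- Free points are the rest of the block, so their number agrees by subtraction.
    | none =>
      have h1 := (htot m D i).trans (htot m' D' i).symm
      rw [Fintype.sum_option, Fintype.sum_option,
        Finset.sum_congr rfl fun y _ => hsome y i] at h1
      omega
  have hequiv : ∀ c, Nonempty ({t // pointType β m D t = c} ≃ {t // pointType β m' D' t = c}) :=
    fun c => ⟨Fintype.equivOfCardEq (by rw [Fintype.card_subtype, Fintype.card_subtype, hall])⟩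
  let τ : Fin l ≃ Fin l := Equiv.ofFiberEquiv fun c => (hequiv c).some
  have hτ : ∀ t, pointType β m D t = pointType β m' D' (τ t) := fun t =>
    (Equiv.ofFiberEquiv_map _ t).symm
  clear_value τ
  have hτ' := fun t => pointType_eq (hτ t)
  -- The bijection `τ` matches types but need not respect partners. It is kept on larger ends and
  -- fixed points, and smaller ends are sent to the partner of the image of their larger end.
  set σ : Fin l → Fin l := fun t => if m t ≤ t then τ t else m' (τ (m t)) with hσ
  have h1 : ∀ t, m t ≤ t → σ t = τ t := fun t ht => if_pos ht
  have h2 : ∀ t, t < m t → σ t = m' (τ (m t)) := fun t ht => if_neg (not_le.2 ht)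
  have hmσ : ∀ t, m' (σ t) = σ (m t) := by
    intro t
    rcases lt_trichotomy (m t) t with ht | ht | ht
    · rw [h1 t ht.le, h2 (m t) (by rwa [hm]), hm]
    · rw [ht, h1 t ht.le]
      have ha := (hτ' t).2.2.2.1
      have hb := (hτ' t).2.2.2.2
      rw [ht] at ha hb
      exact le_antisymm (not_lt.1 fun h => lt_irrefl _ (hb.2 h))
        (not_lt.1 fun h => lt_irrefl _ (ha.2 h))
    · rw [h2 t ht, hm', h1 (m t) (by rw [hm]; exact ht.le)]
  have hlt : ∀ t, (m' (σ t) < σ t ↔ m t < t) ∧ (σ t < m' (σ t) ↔ t < m t) := by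
    intro t
    rcases le_or_gt (m t) t with ht | ht
    · rw [h1 t ht]
      exact ⟨(hτ' t).2.2.2.1.symm, (hτ' t).2.2.2.2.symm⟩
    · rw [h2 t ht, hm']
      have ha := (hτ' (m t)).2.2.2.1
      have hb := (hτ' (m t)).2.2.2.2
      rw [hm] at ha hb
      exact ⟨hb.symm, ha.symm⟩
  have hinj : Function.Injective σ := by
    intro s t hst
    have h3 := (hlt s).2
    rw [hst, (hlt t).2] at h3
    rcases le_or_gt (m t) t with ht | ht
    · rw [h1 t ht, h1 s (not_lt.1 fun hs => not_lt.2 ht (h3.2 hs))] at hst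
      exact τ.injective hst
    · rw [h2 t ht, h2 s (h3.1 ht)] at hst
      have h4 := congrArg m' hst
      rw [hm', hm'] at h4
      have h5 := congrArg m (τ.injective h4)
      rwa [hm, hm] at h5
  refine ⟨Equiv.ofBijective σ (Finite.injective_iff_bijective.1 hinj), fun t => ?_, fun t => ?_,
    hmσ, fun t => (hlt t).1, fun t => (hlt t).2⟩
  · change β (σ t) = β t
    rcases le_or_gt (m t) t with ht | ht
    · rw [h1 t ht]; exact (hτ' t).1.symm
    · rw [h2 t ht, ← (hτ' (m t)).2.1, hm]
  · change σ t ∈ D' ↔ t ∈ D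
    rcases le_or_gt (m t) t with ht | ht
    · rw [h1 t ht]; exact (hτ' t).2.2.1.symm
    · rw [h2 t ht, hD', ← (hτ' (m t)).2.2.1, hD]

end Permutation
-- Equal patterns are conjugate under `P`, and patterns are constant on orbits.
section Conjugacy

variable {κ : FormKind} {l n k : ℕ} {V : Fin k → Submodule ℂ (Fin n → ℂ)}
  {x y : Matrix (Fin n) (Fin n) ℂ} {e f e' f' : Fin l → Fin n → ℂ} {β : Fin l → Fin k}
  {m m' : Fin l → Fin l} {D D' : Set (Fin l)}

/-- Completes the pairs to a basis. For `n = 2l + 1` the complement of the pairs is a line; it is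
not isotropic because the form is nondegenerate, so a spanning vector can be normalized over `ℂ`. -/
lemma LinkBasis.exists_complement (hκ : κ = .symplectic → Even n) (h : LinkBasis κ V x e f β m D)
    {r : ℕ} (hn : n = 2 * l + r) (hr : r ≤ 1) :
    ∃ z : Fin r → Fin n → ℂ, (∀ i t, form κ n (e t) (z i) = 0 ∧ form κ n (f t) (z i) = 0) ∧
      ∀ i j, form κ n (z i) (z j) = if i = j then 1 else 0 := by
  rcases Nat.le_one_iff_eq_zero_or_eq_one.1 hr with rfl | rfl
  · exact ⟨fun i => i.elim0, fun i => i.elim0, fun i => i.elim0⟩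
  set U := Submodule.span ℂ (Set.range (Sum.elim e f)) with hU
  have hUf : finrank ℂ U = 2 * l := by
    rw [hU, finrank_span_eq_card h.linearIndependent]; simp; ring
  have hUO : finrank ℂ ((form κ n).orthogonal U) = 1 := by
    rw [LinearMap.BilinForm.finrank_orthogonal (form_nondegenerate κ hκ), hUf, finrank_fin_fun]
    omega
  obtain ⟨⟨u, hu⟩, hu0, hw⟩ := finrank_eq_one_iff'.1 hUO
  have hu0' : u ≠ 0 := fun h0 => hu0 (Subtype.ext h0)
  rw [LinearMap.BilinForm.mem_orthogonal_iff] at hu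
  have hue : ∀ t, form κ n (e t) u = 0 := fun t =>
    hu _ (Submodule.subset_span ⟨Sum.inl t, rfl⟩)
  have huf : ∀ t, form κ n (f t) u = 0 := fun t =>
    hu _ (Submodule.subset_span ⟨Sum.inr t, rfl⟩)
  have huu : form κ n u u ≠ 0 := by
    intro h0
    apply hu0'
    refine (form_nondegenerate κ hκ).2 u fun v => ?_
    obtain ⟨u', hu', hv⟩ := h.exists_decomp hκ v
    have hmem : u' ∈ (form κ n).orthogonal U := by
      rw [LinearMap.BilinForm.mem_orthogonal_iff]
      intro v hv
      induction hv using Submodule.span_induction with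
      | mem v hv =>
        obtain ⟨s | s, rfl⟩ := hv
        exacts [(hu' s).1, (hu' s).2]
      | zero => simp
      | add u v _ _ hu hv => rw [map_add, LinearMap.add_apply, hu, hv, add_zero]
      | smul c v _ hv => rw [map_smul, LinearMap.smul_apply, hv, smul_zero]
    obtain ⟨c, hc⟩ := hw ⟨u', hmem⟩
    have hc' : c • u = u' := congrArg Subtype.val hc
    rw [hv, map_add, LinearMap.add_apply, ← hc', map_smul, LinearMap.smul_apply, h0, map_sum,
      LinearMap.sum_apply, Finset.sum_eq_zero]
    · simp
    · intro t _
      simp [hue, huf]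
  obtain ⟨c, hc⟩ := IsAlgClosed.exists_pow_nat_eq (form κ n u u)⁻¹ (n := 2) (by norm_num)
  refine ⟨fun _ => c • u, fun _ t => ⟨by simp [hue], by simp [huf]⟩, fun i j => ?_⟩
  rw [if_pos (Subsingleton.elim i j)]
  simp only [map_smul, LinearMap.smul_apply, smul_eq_mul]
  rw [← mul_assoc, ← pow_two, hc, inv_mul_cancel₀ huu]

lemma LinkBasis.linearIndependent_frame (h : LinkBasis κ V x e f β m D) {r : ℕ}
    {z : Fin r → Fin n → ℂ}
    (hz : ∀ i t, form κ n (e t) (z i) = 0 ∧ form κ n (f t) (z i) = 0)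
    (hzz : ∀ i j, form κ n (z i) (z j) = if i = j then 1 else 0) :
    LinearIndependent ℂ (Sum.elim (Sum.elim e f) z) := by
  rw [Fintype.linearIndependent_iff]
  intro g hg
  rw [Fintype.sum_sum_type] at hg
  simp only [Sum.elim_inl, Sum.elim_inr] at hg
  have h1 : ∀ i, g (Sum.inr i) = 0 := by
    intro i
    have h2 := congrArg (fun v => form κ n v (z i)) hg
    simp only [map_add, LinearMap.add_apply, map_sum, LinearMap.sum_apply, map_smul,
      LinearMap.smul_apply, hzz, map_zero, LinearMap.zero_apply] at h2
    rw [Finset.sum_eq_zero, zero_add] at h2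
    · simpa using h2
    · rintro (t | t) _
      · simp [(hz i t).1]
      · simp [(hz i t).2]
  have h2 : ∑ a, g (Sum.inl a) • Sum.elim e f a = 0 := by
    rw [← hg]
    simp [h1]
  rintro (a | i)
  · exact Fintype.linearIndependent_iff.1 h.linearIndependent _ h2 a
  · exact h1 i

/-- An isometry mapping a Lagrangian subspace to itself has determinant one. -/
lemma LinkBasis.det_eq_one (h : LinkBasis κ V x e f β m D) (h' : LinkBasis κ V y e' f' β m' D')
    (hκ : κ = .symplectic → Even n) (hn : n = 2 * l) (g : (Fin n → ℂ) →ₗ[ℂ] Fin n → ℂ)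
    (hge : ∀ t, g (e t) = e' t) (hgf : ∀ t, g (f t) = f' t) : LinearMap.det g = 1 := by
  have hspan := h.linearIndependent.span_eq_top_of_card_eq_finrank'
    (by rw [finrank_fin_fun, hn]; simp; ring)
  let b : Basis (Fin l ⊕ Fin l) ℂ (Fin n → ℂ) := Basis.mk h.linearIndependent hspan.ge
  have hb : ∀ a, b a = Sum.elim e f a := fun a => Basis.mk_apply _ _ a
  have hrepr : ∀ v a, b.repr v a =
      Sum.elim (fun t => form κ n v (f t)) (fun t => form κ n (e t) v) a := by
    intro v a
    have hv : v = ∑ t, (b.repr v (Sum.inl t) • e t + b.repr v (Sum.inr t) • f t) := by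
      conv_lhs => rw [← b.sum_repr v, Fintype.sum_sum_type, ← Finset.sum_add_distrib]
      simp only [hb, Sum.elim_inl, Sum.elim_inr]
    rcases a with a | a
    · conv_rhs => rw [Sum.elim_inl, hv]
      rw [form_sum_pairs' _ h.ff h.ef]
    · conv_rhs => rw [Sum.elim_inr, hv]
      rw [form_sum_pairs _ h.ee h.ef]
  have hev : ∀ s t, form κ n (e s) (e' t) = 0 := by
    intro s t
    have h1 : e' t ∈ V (β t) := h'.e_mem le_rfl
    rw [h.flag] at h1
    generalize e' t = v at h1
    induction h1 using Submodule.span_induction with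
    | mem v hv => obtain ⟨u, _, rfl⟩ := hv; exact h.ee s u
    | zero => simp
    | add u v _ _ hu hv => rw [map_add, hu, hv, add_zero]
    | smul c v _ hv => rw [map_smul, hv, smul_zero]
  set P : Matrix (Fin l) (Fin l) ℂ := Matrix.of fun s t => form κ n (e' t) (f s) with hP
  set Q : Matrix (Fin l) (Fin l) ℂ := Matrix.of fun s t => form κ n (e s) (f' t) with hQ
  -- The lower left block vanishes because the `e'` lie in the same Lagrangian as the `e`.
  have hM : LinearMap.toMatrix b b g = Matrix.fromBlocks P
      (Matrix.of fun s t => form κ n (f' t) (f s)) 0 Q := by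
    ext a c
    rw [LinearMap.toMatrix_apply, hrepr, hb]
    rcases a with a | a <;> rcases c with c | c
    · simp [hge, hP]
    · simp [hgf]
    · simp [hge, hev]
    · simp [hgf, hQ]
  -- This is `⟨e'_s, f'_t⟩ = δ_{st}` written in coordinates; it makes the determinants of the
  -- diagonal blocks inverse to each other.
  have hPQ : P.transpose * Q = 1 := by
    ext s t
    have h1 := h'.ef s t
    obtain ⟨u, hu, hv⟩ := h.exists_decomp hκ (e' s)
    have hu0 : u = 0 := by
      refine (form_nondegenerate κ hκ).2 u fun w => ?_
      have hw : w ∈ Submodule.span ℂ (Set.range (Sum.elim e f)) := by rw [hspan]; trivial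
      induction hw using Submodule.span_induction with
      | mem v hv =>
        obtain ⟨s | s, rfl⟩ := hv
        exacts [(hu s).1, (hu s).2]
      | zero => simp
      | add u v _ _ hu hv => rw [map_add, LinearMap.add_apply, hu, hv, add_zero]
      | smul c v _ hv => rw [map_smul, LinearMap.smul_apply, hv, smul_zero]
    rw [hu0, add_zero] at hv
    simp only [hev, zero_smul, add_zero] at hv
    rw [hv, map_sum, LinearMap.sum_apply] at h1
    rw [Matrix.mul_apply, Matrix.one_apply, ← h1]
    refine Finset.sum_congr rfl fun i _ => ?_
    simp [hP, hQ]
  rw [← LinearMap.det_toMatrix b, hM, Matrix.det_fromBlocks_zero₂₁]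
  have := congrArg Matrix.det hPQ
  rwa [Matrix.det_mul, Matrix.det_transpose, Matrix.det_one] at this

lemma LinkBasis.mulVec_linkE (h : LinkBasis κ V x e f β m D) (t : Fin l) (g : (Fin n → ℂ) →ₗ[ℂ] Fin n → ℂ)
    (hge : ∀ t, g (e t) = e' t) : g (x.mulVec (e t)) = linkE e' m D t := by
  rw [h.xe, linkE, linkE, apply_ite g, hge, map_zero]

lemma LinkBasis.mulVec_linkF (h : LinkBasis κ V x e f β m D) (t : Fin l) (g : (Fin n → ℂ) →ₗ[ℂ] Fin n → ℂ)
    (hge : ∀ t, g (e t) = e' t) (hgf : ∀ t, g (f t) = f' t) :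
    g (x.mulVec (f t)) = linkF κ e' f' m D t := by
  rw [h.xf]
  unfold linkF
  cases κ
  · simp only [apply_ite g, hge, hgf, map_neg, map_zero]
  · simp only [apply_ite g, hge, hgf, map_neg, map_zero]

lemma det_sq_of_mem_isometryGroup (hκ : κ = .symplectic → Even n) {g : GL (Fin n) ℂ}
    (hg : g ∈ isometryGroup κ n) : g.1.det = 1 ∨ g.1.det = -1 := by
  have h1 : g.1.transpose * gram κ n * g.1 = gram κ n := hg
  have h2 := congrArg Matrix.det h1
  rw [Matrix.det_mul, Matrix.det_mul, Matrix.det_transpose] at h2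
  have h3 : (gram κ n).det ≠ 0 :=
    Matrix.nondegenerate_iff_det_ne_zero.1
      (Matrix.nondegenerate_toBilin'_iff.1 (form_nondegenerate κ hκ))
  have h4 : g.1.det * g.1.det = 1 := by
    have : (gram κ n).det * (g.1.det * g.1.det - 1) = 0 := by linear_combination h2
    exact sub_eq_zero.1 ((mul_eq_zero.1 this).resolve_left h3)
  exact mul_self_eq_one_iff.1 h4

/-- Elements which act by the same link pattern on adapted bases are conjugate. -/
lemma LinkBasis.exists_conj (hV : IsotropicFlag κ l V) (h : LinkBasis κ V x e f β m D)
    (h' : LinkBasis κ V y e' f' β m D) :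
    ∃ g ∈ parabolic κ V, y = g.1 * x * (g⁻¹).1 := by
  have hκ := even_of hV.sympl
  obtain ⟨r, hn, hr⟩ : ∃ r, n = 2 * l + r ∧ r ≤ 1 := by
    rcases hV.dim with h | h
    exacts [⟨0, h, by norm_num⟩, ⟨1, h, le_rfl⟩]
  obtain ⟨z, hz, hzz⟩ := h.exists_complement hκ hn hr
  obtain ⟨z', hz', hzz'⟩ := h'.exists_complement hκ hn hr
  have hli := h.linearIndependent_frame hz hzz
  have hli' := h'.linearIndependent_frame hz' hzz'
  have hcard : Fintype.card ((Fin l ⊕ Fin l) ⊕ Fin r) = finrank ℂ (Fin n → ℂ) := by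
    rw [finrank_fin_fun, hn]; simp; ring
  let b : Basis ((Fin l ⊕ Fin l) ⊕ Fin r) ℂ (Fin n → ℂ) :=
    Basis.mk hli (hli.span_eq_top_of_card_eq_finrank' hcard).ge
  let b' : Basis ((Fin l ⊕ Fin l) ⊕ Fin r) ℂ (Fin n → ℂ) :=
    Basis.mk hli' (hli'.span_eq_top_of_card_eq_finrank' hcard).ge
  have hb : ∀ a, b a = Sum.elim (Sum.elim e f) z a := fun a => Basis.mk_apply _ _ a
  have hb' : ∀ a, b' a = Sum.elim (Sum.elim e' f') z' a := fun a => Basis.mk_apply _ _ a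
  -- The linear map carrying one completed basis to the other. The Gram matrices agree, the flags
  -- correspond, and both matrices act by the same pattern.
  let G : (Fin n → ℂ) ≃ₗ[ℂ] Fin n → ℂ := b.equiv b' (Equiv.refl _)
  have hG : ∀ a, G (b a) = b' a := fun a => by simp [G]
  have hGe : ∀ t, G (e t) = e' t := fun t => by
    simpa only [hb, hb', Sum.elim_inl] using hG (Sum.inl (Sum.inl t))
  have hGf : ∀ t, G (f t) = f' t := fun t => by
    simpa only [hb, hb', Sum.elim_inl, Sum.elim_inr] using hG (Sum.inl (Sum.inr t))
  have hGz : ∀ i, G (z i) = z' i := fun i => by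
    simpa only [hb, hb', Sum.elim_inr] using hG (Sum.inr i)
  clear_value G
  have hiso : ∀ v w, form κ n (G v) (G w) = form κ n v w := by
    have : (form κ n).comp G.toLinearMap G.toLinearMap = form κ n := by
      refine LinearMap.BilinForm.ext_basis b fun a c => ?_
      simp only [LinearMap.BilinForm.comp_apply, LinearEquiv.coe_coe, hb]
      have hsw : ∀ {u v}, form κ n u v = 0 → form κ n v u = 0 := fun {u v} h0 => by
        rw [form_symm κ hκ, h0, mul_zero]
      rcases a with (a | a) | a <;> rcases c with (c | c) | c <;>
        simp only [Sum.elim_inl, Sum.elim_inr, hGe, hGf, hGz, h.ee, h'.ee, h.ff, h'.ff, h.ef, h'.ef,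
          h.form_fe hκ, h'.form_fe hκ, (hz _ _).1, (hz _ _).2, (hz' _ _).1, (hz' _ _).2,
          hsw (hz _ _).1, hsw (hz _ _).2, hsw (hz' _ _).1, hsw (hz' _ _).2, hzz, hzz']
    intro v w
    exact LinearMap.congr_fun (LinearMap.congr_fun this v) w
  have hconj : ∀ v, y.mulVec (G v) = G (x.mulVec v) := by
    have : y.mulVecLin.comp G.toLinearMap = G.toLinearMap.comp x.mulVecLin := by
      refine b.ext fun a => ?_
      simp only [LinearMap.comp_apply, LinearEquiv.coe_coe, Matrix.mulVecLin_apply, hb]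
      rcases a with (a | a) | a
      · simp only [Sum.elim_inl, hGe]
        rw [h'.xe]
        exact (h.mulVec_linkE a G.toLinearMap hGe).symm
      · simp only [Sum.elim_inl, Sum.elim_inr, hGf]
        rw [h'.xf]
        exact (h.mulVec_linkF a G.toLinearMap hGe hGf).symm
      · simp only [Sum.elim_inr, hGz]
        rw [h.xz _ (hz a), h'.xz _ (hz' a), map_zero]
    intro v
    exact LinearMap.congr_fun this v
  let g : GL (Fin n) ℂ := ⟨LinearMap.toMatrix' G.toLinearMap, LinearMap.toMatrix' G.symm.toLinearMap,
    by rw [← LinearMap.toMatrix'_comp, LinearEquiv.comp_symm, LinearMap.toMatrix'_id],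
    by rw [← LinearMap.toMatrix'_comp, LinearEquiv.symm_comp, LinearMap.toMatrix'_id]⟩
  have hgv : ∀ v, g.1.mulVec v = G v := fun v => LinearMap.toMatrix'_mulVec _ _
  have hdet : g.1.det = LinearMap.det G.toLinearMap := LinearMap.det_toMatrix' _
  have hgiso : g ∈ isometryGroup κ n := by
    rw [mem_isometryGroup_iff]
    intro v w
    rw [hgv, hgv, hiso]
  have hgV : g ∈ flagStabilizer V := by
    intro i
    have h1 : Matrix.toLin' g.1 = G.toLinearMap := Matrix.toLin'_toMatrix' _
    have h2 : e' '' {t | β t ≤ i} = G.toLinearMap '' (e '' {t | β t ≤ i}) := by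
      rw [Set.image_image]
      exact Set.image_congr fun t _ => (hGe t).symm
    conv_rhs => rw [h'.flag i, h2]
    rw [h1, h.flag i, Submodule.map_span]
  have hgc : y = g.1 * x * (g⁻¹).1 := by
    have h1 : y * g.1 = g.1 * x := by
      refine Matrix.toLin'.injective (LinearMap.ext fun v => ?_)
      rw [Matrix.toLin'_apply, Matrix.toLin'_apply, ← Matrix.mulVec_mulVec, ← Matrix.mulVec_mulVec,
        hgv, hgv, hconj]
    rw [← h1, Matrix.mul_assoc, ← Units.val_mul, mul_inv_cancel, Units.val_one, Matrix.mul_one]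
  -- Determinant `-1` can occur only for odd `n`, and then `-g` has determinant `1`, stabilizes the
  -- same flag and induces the same conjugation.
  by_cases hd : g.1.det = 1
  · refine ⟨g, ⟨?_, hgV⟩, hgc⟩
    cases κ
    · exact hgiso
    · exact ⟨hgiso, Units.ext hd⟩
  · have hd' := (det_sq_of_mem_isometryGroup hκ hgiso).resolve_left hd
    have hodd : n = 2 * l + 1 := by
      rcases hV.dim with h1 | h1
      · exact absurd (hdet.trans (h.det_eq_one h' hκ h1 _ hGe hGf)) hd
      · exact h1
    have hneg : (-g).1.det = 1 := by
      rw [Units.val_neg, Matrix.det_neg, hd', Fintype.card_fin, hodd, pow_succ, pow_mul]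
      norm_num
    refine ⟨-g, ⟨?_, ?_⟩, ?_⟩
    · have hniso : -g ∈ isometryGroup κ n := by
        have h1 : g.1.transpose * gram κ n * g.1 = gram κ n := hgiso
        change (-g).1.transpose * gram κ n * (-g).1 = gram κ n
        rw [Units.val_neg, Matrix.transpose_neg]
        simpa using h1
      cases κ
      · exact hniso
      · exact ⟨hniso, Units.ext hneg⟩
    · intro i
      rw [Units.val_neg, map_neg, Submodule.map_neg]
      exact hgV i
    · rw [inv_neg, Units.val_neg, Units.val_neg]
      simpa using hgc

/-- Brings a second normal form onto the same `m` and `D`. The order conditions are needed because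
the action of a link depends on which of its ends is larger, and block preservation keeps the flag.
-/
lemma LinkBasis.reindex (h : LinkBasis κ V y e f β m' D') (σ : Equiv.Perm (Fin l))
    (h1 : ∀ t, β (σ t) = β t) (h2 : ∀ t, σ t ∈ D' ↔ t ∈ D) (h3 : ∀ t, m' (σ t) = σ (m t))
    (h4 : ∀ t, m' (σ t) < σ t ↔ m t < t) (h5 : ∀ t, σ t < m' (σ t) ↔ t < m t) :
    LinkBasis κ V y (e ∘ σ) (f ∘ σ) β m D where
  ee s t := h.ee _ _
  ff s t := h.ff _ _
  ef s t := by simp [h.ef]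
  mono := h.mono
  flag i := by
    rw [h.flag, Set.image_comp]
    congr 2
    ext t
    constructor
    · intro ht
      refine ⟨σ.symm t, ?_, by simp⟩
      have := h1 (σ.symm t)
      rw [Equiv.apply_symm_apply] at this
      change β (σ.symm t) ≤ i
      rw [← this]; exact ht
    · rintro ⟨s, hs, rfl⟩
      change β (σ s) ≤ i
      rw [h1]; exact hs
  m_m t := σ.injective (by rw [← h3, ← h3, h.m_m])
  m_D t := by rw [← h2, ← h3, h.m_D, h2]
  orth hκ t ht hmt := h.orth hκ (σ t) ((h2 t).2 ht) (by rw [h3, hmt])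
  xe t := by
    by_cases hc : t ∉ D ∧ m t < t
    · have hc' : σ t ∉ D' ∧ m' (σ t) < σ t := by rwa [h2, h4]
      simp only [Function.comp_apply, h.xe, linkE, if_pos hc, if_pos hc', h3]
    · have hc' : ¬(σ t ∉ D' ∧ m' (σ t) < σ t) := by rwa [h2, h4]
      simp only [Function.comp_apply, h.xe, linkE, if_neg hc, if_neg hc']
  xf t := by
    have h4' : ∀ t, σ (m t) < σ t ↔ m t < t := fun t => by rw [← h3]; exact h4 t
    have h5' : ∀ t, σ t < σ (m t) ↔ t < m t := fun t => by rw [← h3]; exact h5 t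
    simp only [Function.comp_apply, h.xf]
    unfold linkF
    by_cases hc : t ∈ D
    · have hc' := (h2 t).2 hc
      cases κ <;> simp only [Function.comp_apply, if_pos hc, if_pos hc', h3, h4']
    · have hc' := fun h => hc ((h2 t).1 h)
      simp only [Function.comp_apply, if_neg hc, if_neg hc', h3, h5']
  xz u hu := h.xz u fun t => by simpa using hu (σ.symm t)

/-- Two matrices with the same pattern are conjugate under the parabolic subgroup. -/
theorem HasNormalForm.exists_conj (hV : IsotropicFlag κ l V) {q : Pattern k}
    (h : HasNormalForm κ l V x q) (h' : HasNormalForm κ l V y q) :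
    ∃ g ∈ parabolic κ V, y = g.1 * x * (g⁻¹).1 := by
  obtain ⟨e, f, β, m, D, hb, hs, rfl⟩ := hasNormalForm_iff.1 h
  obtain ⟨e', f', β', m', D', hb', hs', hq⟩ := hasNormalForm_iff.1 h'
  have hβ : β = β' := monotone_ext hb.mono hb'.mono fun i => by rw [hb.card_lt, hb'.card_lt]
  subst hβ
  obtain ⟨σ, h1, h2, h3, h4, h5⟩ := exists_perm hb.mono hb.m_m hb.m_D hb'.m_m hb'.m_D hb.orth
    hb'.orth hs hs' hq
  exact hb.exists_conj hV (hb'.reindex σ h1 h2 h3 h4 h5)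

/-- The pattern is constant on orbits. -/
theorem HasNormalForm.conj {q : Pattern k} (h : HasNormalForm κ l V x q) {g : GL (Fin n) ℂ}
    (hg : g ∈ parabolic κ V) : HasNormalForm κ l V (g.1 * x * (g⁻¹).1) q := by
  obtain ⟨e, f, β, m, D, hb, hs, rfl⟩ := hasNormalForm_iff.1 h
  have hiso : g ∈ isometryGroup κ n := by
    have := hg.1
    cases κ
    exacts [this, this.1]
  rw [mem_isometryGroup_iff] at hiso
  have hcancel : ∀ v, (g⁻¹).1.mulVec (g.1.mulVec v) = v := fun v => by
    rw [Matrix.mulVec_mulVec, ← Units.val_mul, inv_mul_cancel, Units.val_one, Matrix.one_mulVec]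
  have hcancel' : ∀ v, g.1.mulVec ((g⁻¹).1.mulVec v) = v := fun v => by
    rw [Matrix.mulVec_mulVec, ← Units.val_mul, mul_inv_cancel, Units.val_one, Matrix.one_mulVec]
  have hxg : ∀ v, (g.1 * x * (g⁻¹).1).mulVec (g.1.mulVec v) = g.1.mulVec (x.mulVec v) := fun v => by
    rw [← Matrix.mulVec_mulVec, ← Matrix.mulVec_mulVec, hcancel]
  refine hasNormalForm_iff.2 ⟨fun t => g.1.mulVec (e t), fun t => g.1.mulVec (f t), β, m, D,
    ⟨?_, ?_, ?_, hb.mono, fun i => ?_, hb.m_m, hb.m_D, hb.orth, fun t => ?_, fun t => ?_,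
      fun u hu => ?_⟩, hs, rfl⟩
  · intro s t; rw [hiso, hb.ee]
  · intro s t; rw [hiso, hb.ff]
  · intro s t; rw [hiso, hb.ef]
  · have h1 : (V i).map (Matrix.toLin' g.1) = V i := hg.2 i
    conv_lhs => rw [← h1, hb.flag i, Submodule.map_span, Set.image_image]
    rfl
  · rw [hxg]
    exact hb.mulVec_linkE t g.1.mulVecLin fun _ => rfl
  · rw [hxg]
    exact hb.mulVec_linkF t g.1.mulVecLin (fun _ => rfl) fun _ => rfl
  · have h1 : x.mulVec ((g⁻¹).1.mulVec u) = 0 := by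
      refine hb.xz _ fun t => ?_
      have h2 := hu t
      rw [← hcancel' u, hiso, hiso] at h2
      exact h2
    rw [← Matrix.mulVec_mulVec, ← Matrix.mulVec_mulVec, h1, Matrix.mulVec_zero]

end Conjugacy
-- The enhanced condition as a count of points at each vertex.
section Patterns

variable {k : ℕ}

/-- The number of links without dot with larger vertex `i` and smaller vertex `j`. -/
def Pattern.plainMult (q : Pattern k) (i j : Fin k) : ℕ := if j ≤ i then q.link s(i, j) else 0

/-- The number of links with dot with larger vertex `i` and smaller vertex `j`, which are realized
by two points. -/
def Pattern.dotMult (κ : FormKind) (q : Pattern k) (i j : Fin k) : ℕ :=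
  match κ with
  | .symplectic => if j < i then q.dotLink s(i, j) else 0
  | .orthogonal => if j ≤ i then q.dotLink s(i, j) else 0

/-- The number of links with dot at `i` which are realized by one point. -/
def Pattern.loopMult (κ : FormKind) (q : Pattern k) (i : Fin k) : ℕ :=
  match κ with
  | .symplectic => q.dotLink s(i, i)
  | .orthogonal => 0

/-- The number of points needed at the vertex `i`. -/
def Pattern.valency (κ : FormKind) (q : Pattern k) (i : Fin k) : ℕ :=
  ∑ j, q.plainMult i j + ∑ j, q.plainMult j i + ∑ j, q.dotMult κ i j + ∑ j, q.dotMult κ j i +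
    q.loopMult κ i

namespace OrientedPattern

lemma forget_link_self (p : OrientedPattern k) (i : Fin k) :
    p.forget.link s(i, i) = p.loop i := by
  simp [forget]

lemma forget_dotLink_self (p : OrientedPattern k) (i : Fin k) :
    p.forget.dotLink s(i, i) = p.dotLoops i := by
  simp [forget]

lemma forget_link (p : OrientedPattern k) {i j : Fin k} (h : i ≠ j) :
    p.forget.link s(i, j) = p.arrow i j + p.arrow j i := by
  simp [forget, h]

lemma forget_dotLink (p : OrientedPattern k) {i j : Fin k} (h : i ≠ j) :
    p.forget.dotLink s(i, j) = p.dotArrow i j + p.dotArrow j i := by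
  simp [forget, h]

variable {p : OrientedPattern k} (hp : p.IsRightToLeft)
include hp

lemma IsRightToLeft.arrow_eq_zero {i j : Fin k} (h : i ≤ j) : p.arrow i j = 0 := by
  by_contra hne
  exact absurd (hp.1 i j hne) (not_lt.2 h)

lemma IsRightToLeft.dotArrow_eq_zero {i j : Fin k} (h : i ≤ j) : p.dotArrow i j = 0 := by
  by_contra hne
  exact absurd (hp.2.1 i j hne) (not_lt.2 h)

lemma IsRightToLeft.plainMult_forget (i j : Fin k) :
    p.forget.plainMult i j = p.arrow i j + if i = j then p.loop i else 0 := by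
  unfold Pattern.plainMult
  rcases lt_trichotomy i j with h | rfl | h
  · rw [if_neg (not_le.2 h), if_neg h.ne, hp.arrow_eq_zero h.le]
  · rw [if_pos le_rfl, if_pos rfl, p.arrow_self, forget_link_self, zero_add]
  · rw [if_pos h.le, if_neg h.ne', forget_link p h.ne', hp.arrow_eq_zero h.le]

lemma IsRightToLeft.dotMult_forget_symplectic (i j : Fin k) :
    p.forget.dotMult .symplectic i j = p.dotArrow i j := by
  unfold Pattern.dotMult
  rcases le_or_gt i j with h | h
  · simp only [if_neg (not_lt.2 h), hp.dotArrow_eq_zero h]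
  · simp only [if_pos h, forget_dotLink p h.ne', hp.dotArrow_eq_zero h.le, add_zero]

lemma IsRightToLeft.dotMult_forget_orthogonal (i j : Fin k) :
    p.forget.dotMult .orthogonal i j = p.dotArrow i j + if i = j then p.dotLoops i else 0 := by
  unfold Pattern.dotMult
  rcases lt_trichotomy i j with h | rfl | h
  · simp only [if_neg (not_le.2 h), if_neg h.ne, hp.dotArrow_eq_zero h.le]
  · simp only [if_pos le_rfl, if_true, p.dotArrow_self, forget_dotLink_self, zero_add]
  · simp only [if_pos h.le, if_neg h.ne', forget_dotLink p h.ne', hp.dotArrow_eq_zero h.le]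

/-- Every end of a link uses one point. A loop without dot uses two; a loop with dot uses two in the
orthogonal case and one in the symplectic case, which is what the term `l_i` corrects. -/
lemma IsRightToLeft.isEnhanced_iff {κ : FormKind} {b : Fin k → ℕ} :
    p.IsEnhanced κ b ↔ ∀ i, p.forget.valency κ i ≤ b i := by
  refine forall_congr' fun i => ?_
  unfold Pattern.valency Pattern.loopMult
  cases κ <;>
    simp only [hp.plainMult_forget, hp.dotMult_forget_symplectic, hp.dotMult_forget_orthogonal,
      Finset.sum_add_distrib, Finset.sum_ite_eq, Finset.sum_ite_eq', Finset.mem_univ, if_true,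
      forget_dotLink_self, sources, targets] <;> omega

end OrientedPattern

/-- Every pattern can be oriented from right to left. -/
lemma Pattern.exists_orientation (q : Pattern k) :
    ∃ p : OrientedPattern k, p.IsRightToLeft ∧ p.forget = q := by
  refine ⟨⟨fun i j => if j < i then q.link s(i, j) else 0, fun i => by simp,
    fun i => q.link s(i, i), fun i j => if j < i then q.dotLink s(i, j) else 0, fun i => by simp,
    fun i => q.dotLink s(i, i), fun _ => 0⟩, ⟨fun i j h => ?_, fun i j h => ?_, fun _ => rfl⟩,
    Pattern.ext_of_le (fun i j h => ?_) fun i j h => ?_⟩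
  · by_contra hc; simp [hc] at h
  · by_contra hc; simp [hc] at h
  · rcases h.eq_or_lt with rfl | h
    · rw [OrientedPattern.forget_link_self]
    · rw [OrientedPattern.forget_link _ h.ne']
      simp [h, h.not_gt]
  · rcases h.eq_or_lt with rfl | h
    · rw [OrientedPattern.forget_dotLink_self]
      simp [OrientedPattern.dotLoops]
    · rw [OrientedPattern.forget_dotLink _ h.ne']
      simp [h, h.not_gt]

lemma mem_linkPatterns_iff {κ : FormKind} {b : Fin k → ℕ} {q : Pattern k} :
    q ∈ linkPatterns κ b ↔ ∀ i, q.valency κ i ≤ b i := by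
  constructor
  · rintro ⟨p, ⟨h1, h2⟩, rfl⟩
    exact h2.isEnhanced_iff.1 h1
  · intro h
    obtain ⟨p, hp, rfl⟩ := q.exists_orientation
    exact ⟨p, ⟨hp.isEnhanced_iff.2 h, hp⟩, rfl⟩

lemma mem_linkPatternsNoPlainLoops_iff {κ : FormKind} {b : Fin k → ℕ} {q : Pattern k} :
    q ∈ linkPatternsNoPlainLoops κ b ↔ q ∈ linkPatterns κ b ∧ ∀ i, q.link s(i, i) = 0 := by
  rw [mem_linkPatterns_iff]
  constructor
  · rintro ⟨p, ⟨h1, h2, h3⟩, rfl⟩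
    exact ⟨h2.isEnhanced_iff.1 h1, fun i => by rw [OrientedPattern.forget_link_self, h3]⟩
  · rintro ⟨h, h'⟩
    obtain ⟨p, hp, rfl⟩ := q.exists_orientation
    exact ⟨p, ⟨hp.isEnhanced_iff.2 h, hp, fun i => by
      rw [← OrientedPattern.forget_link_self, h']⟩, rfl⟩

end Patterns

/-! ### Matchings with prescribed multiplicities. -/

section Realization

variable {l k : ℕ} {β : Fin l → Fin k}

lemma card_sigma_filter {ι : Type*} [Fintype ι] (N : ι → ℕ) (p : ι → Prop) [DecidablePred p] :
    (Finset.univ.filter fun a : (Σ c, Fin (N c)) => p a.1).card =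
      ∑ c, if p c then N c else 0 := by
  rw [Finset.card_filter, Fintype.sum_sigma]
  refine Finset.sum_congr rfl fun c _ => ?_
  split_ifs <;> simp

/-- Embeddings are chosen fibre by fibre; images of different fibres lie in different blocks, so the
union is injective. -/
lemma exists_injective_over {A : Type*} [Fintype A] (v : A → Fin k)
    (h : ∀ i, (Finset.univ.filter fun a => v a = i).card ≤
      (Finset.univ.filter fun t => β t = i).card) :
    ∃ ι : A → Fin l, Function.Injective ι ∧ ∀ a, β (ι a) = v a := by
  have hne : ∀ i, Nonempty ({a // v a = i} ↪ {t // β t = i}) := fun i =>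
    Function.Embedding.nonempty_of_card_le (by
      rw [Fintype.card_subtype, Fintype.card_subtype]; exact h i)
  let E := fun i => (hne i).some
  refine ⟨fun a => (E (v a) ⟨a, rfl⟩).1, fun a b hab => ?_, fun a => (E (v a) ⟨a, rfl⟩).2⟩
  have hv : v a = v b := by
    rw [← (E (v a) ⟨a, rfl⟩).2, ← (E (v b) ⟨b, rfl⟩).2]
    exact congrArg β hab
  have key : ∀ i (hi : v b = i), (E (v b) ⟨b, rfl⟩).1 = (E i ⟨b, hi⟩).1 := by
    rintro i rfl; rfl
  have h1 := hab.trans (key (v a) hv.symm)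
  exact congrArg Subtype.val ((E (v a)).injective (Subtype.ext h1))

open Classical in
/-- Link patterns with prescribed multiplicities exist as soon as there are enough points. -/
lemma exists_matching (hβ : Monotone β) {P Q : Fin k → Fin k → ℕ} {L : Fin k → ℕ}
    (hP : ∀ i j, P i j ≠ 0 → j ≤ i) (hQ : ∀ i j, Q i j ≠ 0 → j ≤ i)
    (hb : ∀ i, ∑ j, P i j + ∑ j, P j i + ∑ j, Q i j + ∑ j, Q j i + L i ≤
      (Finset.univ.filter fun t => β t = i).card) :
    ∃ (m : Fin l → Fin l) (D : Set (Fin l)), (∀ t, m (m t) = t) ∧ (∀ t, m t ∈ D ↔ t ∈ D) ∧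
      (∀ i j, plainCount β m D i j = P i j) ∧
      (∀ i j, (Finset.univ.filter fun t => t ∈ D ∧ m t < t ∧ β t = i ∧ β (m t) = j).card = Q i j) ∧
      (∀ i, (Finset.univ.filter fun t => t ∈ D ∧ m t = t ∧ β t = i).card = L i) := by
  let N : Bool × Fin k × Fin k → ℕ := fun c => if c.1 then Q c.2.1 c.2.2 else P c.2.1 c.2.2
  have hN : ∀ a : (Σ c, Fin (N c)), a.1.2.2 ≤ a.1.2.1 := by
    rintro ⟨⟨d, i, j⟩, a⟩
    have ha : N (d, i, j) ≠ 0 := fun h => (Fin.cast h a).elim0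
    cases d
    exacts [hP i j (by simpa [N] using ha), hQ i j (by simpa [N] using ha)]
  -- `Λ` lists the links with two ends, indexed by `Bool` with `true` for the larger block, and `Γ`
  -- the loops with dots. The map `v` prescribes the block of every end.
  let Λ := Σ c, Fin (N c)
  let Γ := Σ i, Fin (L i)
  let v : (Λ × Bool) ⊕ Γ → Fin k :=
    Sum.elim (fun a => if a.2 then a.1.1.2.1 else a.1.1.2.2) fun a => a.1
  obtain ⟨ι, hι, hιv⟩ := exists_injective_over (β := β) v (by
    intro i
    refine le_trans (le_of_eq ?_) (hb i)
    have h1 : (Finset.univ.filter fun a : Λ => a.1.2.1 = i).card = ∑ j, Q i j + ∑ j, P i j := by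
      rw [card_sigma_filter N fun c => c.2.1 = i]
      simp [Fintype.sum_prod_type, N, Finset.sum_ite_eq']
    have h2 : (Finset.univ.filter fun a : Λ => a.1.2.2 = i).card = ∑ j, Q j i + ∑ j, P j i := by
      rw [card_sigma_filter N fun c => c.2.2 = i]
      simp [Fintype.sum_prod_type, N]
    have h3 : (Finset.univ.filter fun a : Γ => a.1 = i).card = L i := by
      rw [card_sigma_filter L fun c => c = i]
      simp
    rw [Finset.card_filter] at h1 h2 h3
    rw [Finset.card_filter, Fintype.sum_sum_type, Fintype.sum_prod_type_right, Fintype.sum_bool]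
    exact (congrArg₂ (· + ·) (congrArg₂ (· + ·) h1 h2) h3).trans (by ring))
  let partner : (Λ × Bool) ⊕ Γ → (Λ × Bool) ⊕ Γ := Sum.map (fun a => (a.1, !a.2)) id
  have hpp : ∀ a, partner (partner a) = a := by
    rintro (⟨a, b⟩ | a) <;> simp [partner]
  let dotted : (Λ × Bool) ⊕ Γ → Prop := Sum.elim (fun a => a.1.1.1 = true) fun _ => True
  have hdp : ∀ a, dotted (partner a) ↔ dotted a := by
    rintro (⟨a, b⟩ | a) <;> simp [partner, dotted]
  -- Partners are exchanged on the image of `ι`; all remaining points are free.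
  set m : Fin l → Fin l := Function.extend ι (ι ∘ partner) id with hm
  set D : Set (Fin l) := ι '' {a | dotted a} with hD
  have hmι : ∀ a, m (ι a) = ι (partner a) := fun a => hι.extend_apply _ _ a
  have hmn : ∀ t, (¬∃ a, ι a = t) → m t = t := fun t ht => Function.extend_apply' _ _ t ht
  have hDι : ∀ a, ι a ∈ D ↔ dotted a := fun a => by
    rw [hD, hι.mem_set_image]; rfl
  have hmm : ∀ t, m (m t) = t := by
    intro t
    by_cases ht : ∃ a, ι a = t
    · obtain ⟨a, rfl⟩ := ht
      rw [hmι, hmι, hpp]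
    · rw [hmn t ht, hmn t ht]
  have hmD : ∀ t, m t ∈ D ↔ t ∈ D := by
    intro t
    by_cases ht : ∃ a, ι a = t
    · obtain ⟨a, rfl⟩ := ht
      rw [hmι, hDι, hDι, hdp]
    · rw [hmn t ht]
  -- The larger end of a link. The maximum is needed when both ends lie in one block, where `ι` may
  -- place them in either order.
  let T : Λ → Fin l := fun a => max (ι (Sum.inl (a, true))) (ι (Sum.inl (a, false)))
  have hne : ∀ a, ι (Sum.inl (a, true)) ≠ ι (Sum.inl (a, false)) := fun a h => by
    have := hι h; simp at this
  have hT : ∀ a, m (T a) < T a ∧ β (T a) = a.1.2.1 ∧ β (m (T a)) = a.1.2.2 ∧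
      (T a ∈ D ↔ a.1.1 = true) := by
    intro a
    have h1 := hmι (Sum.inl (a, true))
    have h2 := hmι (Sum.inl (a, false))
    have h3 := hιv (Sum.inl (a, true))
    have h4 := hιv (Sum.inl (a, false))
    have h5 := hDι (Sum.inl (a, true))
    have h6 := hDι (Sum.inl (a, false))
    simp only [partner, Sum.map_inl, Bool.not_true, Bool.not_false, v, Sum.elim_inl, if_true,
      Bool.false_eq_true, if_false, dotted] at h1 h2 h3 h4 h5 h6
    rcases lt_or_gt_of_ne (hne a) with h | h
    · have hTa : T a = ι (Sum.inl (a, false)) := max_eq_right h.le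
      have h7 := hβ h.le
      rw [h3, h4] at h7
      have h8 := le_antisymm h7 (hN a)
      rw [hTa, h2, h3, h4]
      exact ⟨h, h8.symm, h8, h6⟩
    · have hTa : T a = ι (Sum.inl (a, true)) := max_eq_left h.le
      rw [hTa, h1, h3, h4]
      exact ⟨h, rfl, rfl, h5⟩
  have hTinj : Function.Injective T := by
    intro a b hab
    rcases max_choice (ι (Sum.inl (a, true))) (ι (Sum.inl (a, false))) with h1 | h1 <;>
    rcases max_choice (ι (Sum.inl (b, true))) (ι (Sum.inl (b, false))) with h2 | h2 <;>
    · simp only [T, h1, h2] at hab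
      have := hι hab
      simp only [Sum.inl.injEq, Prod.mk.injEq] at this
      exact this.1
  have hTsurj : ∀ t, m t < t → ∃ a, T a = t := by
    intro t ht
    by_cases hr : ∃ a, ι a = t
    · obtain ⟨a, rfl⟩ := hr
      rw [hmι] at ht
      rcases a with ⟨a, _ | _⟩ | a
      · exact ⟨a, max_eq_right ht.le⟩
      · exact ⟨a, max_eq_left ht.le⟩
      · exact absurd ht (lt_irrefl _)
    · exact absurd ht (by rw [hmn t hr]; exact lt_irrefl _)
  have hcount : ∀ d i j, (Finset.univ.filter fun t => (t ∈ D ↔ d = true) ∧ m t < t ∧ β t = i ∧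
      β (m t) = j).card = N (d, i, j) := by
    intro d i j
    have h1 : (Finset.univ.filter fun a : Λ => a.1 = (d, i, j)).card = N (d, i, j) := by
      rw [card_sigma_filter N fun c => c = (d, i, j)]
      simp
    rw [← h1]
    symm
    refine Finset.card_nbij T ?_ hTinj.injOn ?_
    · intro a ha
      have ha' : a.1 = (d, i, j) := by simpa using ha
      simp [hT a, ha']
    · intro t ht
      simp only [Finset.coe_filter, Finset.mem_univ, true_and, Set.mem_ofPred_eq] at ht
      obtain ⟨a, rfl⟩ := hTsurj t ht.2.1
      refine ⟨a, ?_, rfl⟩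
      simp only [Finset.coe_filter, Finset.mem_univ, true_and, Set.mem_ofPred_eq]
      refine Prod.ext ?_ (Prod.ext ?_ ?_)
      · have := (hT a).2.2.2.symm.trans ht.1
        exact Bool.eq_iff_iff.2 this
      · exact (hT a).2.1.symm.trans ht.2.2.1
      · exact (hT a).2.2.1.symm.trans ht.2.2.2
  refine ⟨m, D, hmm, hmD, fun i j => ?_, fun i j => ?_, fun i => ?_⟩
  · have := hcount false i j
    simpa [N, plainCount] using this
  · have := hcount true i j
    simpa [N] using this
  · have h1 : (Finset.univ.filter fun a : Γ => a.1 = i).card = L i := by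
      rw [card_sigma_filter L fun c => c = i]
      simp
    rw [← h1]
    symm
    refine Finset.card_nbij (fun a => ι (Sum.inr a)) ?_
      (fun a _ b _ hab => by simpa using hι hab) ?_
    · intro a ha
      have ha' : a.1 = i := by simpa using ha
      simp [hDι, hmι, hιv, dotted, partner, v, ha']
    · intro t ht
      simp only [Finset.coe_filter, Finset.mem_univ, true_and, Set.mem_ofPred_eq] at ht
      obtain ⟨⟨a, _, rfl⟩, h2, h3⟩ := ht
      rcases a with ⟨a, b⟩ | a
      · rw [hmι] at h2
        have := hι h2
        simp [partner] at this
      · refine ⟨a, ?_, rfl⟩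
        rw [hιv] at h3
        simpa [v] using h3

variable {κ : FormKind}

open Classical in
lemma dotCount_eq_add {m : Fin l → Fin l} {D : Set (Fin l)} (i j : Fin k) :
    dotCount β m D i j =
      (Finset.univ.filter fun t => t ∈ D ∧ m t < t ∧ β t = i ∧ β (m t) = j).card +
        if i = j then (Finset.univ.filter fun t => t ∈ D ∧ m t = t ∧ β t = i).card else 0 := by
  split_ifs with hij
  · subst hij
    rw [dotCount, ← Finset.card_union_of_disjoint]
    · congr 1
      ext t
      simp only [Finset.mem_filter, Finset.mem_univ, true_and, Finset.mem_union, le_iff_lt_or_eq]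
      constructor
      · rintro ⟨h1, h2 | h2, h3⟩
        exacts [Or.inl ⟨h1, h2, h3⟩, Or.inr ⟨h1, h2, h3.1⟩]
      · rintro (⟨h1, h2, h3⟩ | ⟨h1, h2, h3⟩)
        exacts [⟨h1, Or.inl h2, h3⟩, ⟨h1, Or.inr h2, h3, by rw [h2, h3]⟩]
    · rw [Finset.disjoint_filter]
      rintro t _ ⟨_, h2, _⟩ ⟨_, h3, _⟩
      exact h2.ne h3
  · rw [dotCount, add_zero]
    congr 1
    ext t
    simp only [Finset.mem_filter, Finset.mem_univ, true_and, le_iff_lt_or_eq]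
    constructor
    · rintro ⟨h1, h2 | h2, h3⟩
      · exact ⟨h1, h2, h3⟩
      · exact absurd (h3.1.symm.trans (by rw [← h3.2, h2])) hij
    · rintro ⟨h1, h2, h3⟩; exact ⟨h1, Or.inl h2, h3⟩

open Classical in
/-- Every pattern with enough points at every vertex arises by gluing. -/
lemma exists_patternOf_eq (hβ : Monotone β) {q : Pattern k}
    (hq : ∀ i, q.valency κ i ≤ (Finset.univ.filter fun t => β t = i).card) :
    ∃ (m : Fin l → Fin l) (D : Set (Fin l)), (∀ t, m (m t) = t) ∧ (∀ t, m t ∈ D ↔ t ∈ D) ∧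
      (κ = .orthogonal → ∀ t ∈ D, m t ≠ t) ∧ DotsSeparated κ β m D ∧ patternOf β m D = q := by
  obtain ⟨m, D, h1, h2, h3, h4, h5⟩ := exists_matching hβ (P := q.plainMult) (Q := q.dotMult κ)
    (L := q.loopMult κ)
    (fun i j h => by
      by_contra hc; exact h (if_neg hc))
    (fun i j h => by
      by_contra hc
      apply h
      cases κ
      · exact if_neg fun h' => hc h'.le
      · exact if_neg hc) hq
  refine ⟨m, D, h1, h2, ?_, ?_, Pattern.ext_of_le (fun i j hij => ?_) fun i j hij => ?_⟩
  · rintro rfl t ht hmt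
    have h6 : (Finset.univ.filter fun s => s ∈ D ∧ m s = s ∧ β s = β t).card = 0 := h5 (β t)
    rw [Finset.card_eq_zero, Finset.filter_eq_empty_iff] at h6
    exact h6 (Finset.mem_univ t) ⟨ht, hmt, rfl⟩
  · rintro rfl t ht hmt hβt
    have h6 := h4 (β t) (β t)
    have h7 : q.dotMult .symplectic (β t) (β t) = 0 := if_neg (lt_irrefl _)
    rw [h7, Finset.card_eq_zero, Finset.filter_eq_empty_iff] at h6
    rcases lt_or_gt_of_ne hmt with h | h
    · exact h6 (Finset.mem_univ t) ⟨ht, h, rfl, hβt⟩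
    · exact h6 (Finset.mem_univ (m t)) ⟨(h2 t).2 ht, by rwa [h1], hβt, by rw [h1]⟩
  · rw [patternOf_link hβ hij, h3, Pattern.plainMult, if_pos hij]
  · rw [patternOf_dotLink hβ hij, dotCount_eq_add, h4, h5]
    cases κ
    · rcases hij.eq_or_lt with rfl | hij
      · simp [Pattern.dotMult, Pattern.loopMult]
      · simp [Pattern.dotMult, hij, hij.ne']
    · simp [Pattern.dotMult, Pattern.loopMult, hij]

open Classical in
/-- The pattern obtained by gluing needs at most as many points as there are. -/
lemma valency_patternOf_le (hβ : Monotone β) {m : Fin l → Fin l} {D : Set (Fin l)}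
    (hm : ∀ t, m (m t) = t) (hD : ∀ t, m t ∈ D ↔ t ∈ D)
    (horth : κ = .orthogonal → ∀ t ∈ D, m t ≠ t) (hsep : DotsSeparated κ β m D) (i : Fin k) :
    (patternOf β m D).valency κ i ≤ (Finset.univ.filter fun t => β t = i).card := by
  have hP : ∀ i j, (patternOf β m D).plainMult i j = plainCount β m D i j := fun i j => by
    unfold Pattern.plainMult
    split_ifs with hij
    · exact patternOf_link hβ hij
    · exact (plainCount_eq_zero hβ (not_le.1 hij)).symm
  have hQ : ∀ i j, (patternOf β m D).dotMult κ i j =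
      (Finset.univ.filter fun t => t ∈ D ∧ m t < t ∧ β t = i ∧ β (m t) = j).card := fun i j => by
    rw [card_dot_lt horth hsep]
    unfold Pattern.dotMult
    cases κ
    · rcases lt_trichotomy i j with hij | rfl | hij
      · simp [hij.not_gt, hij.ne, dotCount_eq_zero hβ hij]
      · simp
      · simp [hij, hij.ne', patternOf_dotLink hβ hij.le]
    · rcases le_or_gt j i with hij | hij
      · simp [hij, patternOf_dotLink hβ hij]
      · simp [hij.not_ge, dotCount_eq_zero hβ hij]
  have hL : (patternOf β m D).loopMult κ i =
      (Finset.univ.filter fun t => t ∈ D ∧ m t = t ∧ β t = i ∧ β (m t) = i).card := by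
    rw [card_dot_eq horth hsep]
    unfold Pattern.loopMult
    cases κ
    · simp [patternOf_dotLink hβ le_rfl]
    · simp
  have hfib : ∀ (p : Fin l → Prop) [DecidablePred p],
      ∑ j, (Finset.univ.filter fun t => p t ∧ β (m t) = j).card = (Finset.univ.filter p).card := by
    intro p _
    rw [Finset.card_eq_sum_card_fiberwise (f := fun t => β (m t))
      (t := Finset.univ) (fun _ _ => Finset.mem_coe.2 (Finset.mem_univ _))]
    refine Finset.sum_congr rfl fun j _ => ?_
    rw [Finset.filter_filter]
  have hfib' : ∀ (p : Fin l → Prop) [DecidablePred p],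
      ∑ j, (Finset.univ.filter fun t => p t ∧ β t = j).card = (Finset.univ.filter p).card := by
    intro p _
    rw [Finset.card_eq_sum_card_fiberwise (f := β)
      (t := Finset.univ) (fun _ _ => Finset.mem_coe.2 (Finset.mem_univ _))]
    refine Finset.sum_congr rfl fun j _ => ?_
    rw [Finset.filter_filter]
  have e1 : ∑ j, plainCount β m D i j =
      (Finset.univ.filter fun t => t ∉ D ∧ m t < t ∧ β t = i).card := by
    rw [← hfib]
    simp only [plainCount, and_assoc]
  have e2 : ∑ j, plainCount β m D j i =
      (Finset.univ.filter fun t => t ∉ D ∧ t < m t ∧ β t = i).card := by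
    rw [← card_filter_involution hm, ← hfib']
    refine Finset.sum_congr rfl fun j _ => ?_
    rw [plainCount]
    congr 1
    ext t
    simp only [Finset.mem_filter, Finset.mem_univ, true_and, hm, hD]
    tauto
  have e3 : ∑ j, (Finset.univ.filter fun t => t ∈ D ∧ m t < t ∧ β t = i ∧ β (m t) = j).card =
      (Finset.univ.filter fun t => t ∈ D ∧ m t < t ∧ β t = i).card := by
    rw [← hfib]
    simp only [and_assoc]
  have e4 : ∑ j, (Finset.univ.filter fun t => t ∈ D ∧ m t < t ∧ β t = j ∧ β (m t) = i).card =
      (Finset.univ.filter fun t => t ∈ D ∧ t < m t ∧ β t = i).card := by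
    rw [← card_filter_involution hm, ← hfib']
    refine Finset.sum_congr rfl fun j _ => ?_
    congr 1
    ext t
    simp only [Finset.mem_filter, Finset.mem_univ, true_and, hm, hD]
    tauto
  unfold Pattern.valency
  simp only [hP, hQ, hL, e1, e2, e3, e4]
  -- The five sums now count disjoint sets of points of block `i`, so it suffices to compare the
  -- contribution of each point.
  simp only [Finset.card_filter, ← Finset.sum_add_distrib]
  refine Finset.sum_le_sum fun t _ => ?_
  by_cases h1 : t ∈ D <;> by_cases h2 : β t = i <;>
    simp only [h1, h2, true_and, false_and, and_false, and_true, not_true, not_false_iff,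
      if_true, if_false, le_refl, add_zero, zero_add]
  · rcases lt_trichotomy (m t) t with h | h | h
    · simp [h, h.not_gt, h.ne]
    · simp [h, h2]
    · simp [h, h.not_gt, h.ne']
  · rcases lt_trichotomy (m t) t with h | h | h
    · simp [h, h.not_gt]
    · simp [h]
    · simp [h, h.not_gt]

end Realization
-- Isotropic subspaces stable under the standard Borel subgroup.
section StandardFlag

variable {κ : FormKind} {l n k : ℕ}

/-- Isometries have determinant `±1`, so squares have determinant `1`. Using squares disposes of the
determinant condition in the orthogonal group. -/
lemma mem_classicalGroup_sq (hκ : κ = .symplectic → Even n) {g : GL (Fin n) ℂ}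
    (hg : g ∈ isometryGroup κ n) : g * g ∈ classicalGroup κ n := by
  have h1 := mul_mem hg hg
  cases κ
  · exact h1
  · refine ⟨h1, Units.ext ?_⟩
    have h2 : (g * g).1.det = g.1.det * g.1.det := by rw [Units.val_mul, Matrix.det_mul]
    refine h2.trans ?_
    rcases det_sq_of_mem_isometryGroup hκ hg with h | h <;> simp [h]

/-- The exponential of a nilpotent skew matrix. -/
lemma exists_exp (hκ : κ = .symplectic → Even n) {x : Matrix (Fin n) (Fin n) ℂ}
    (hx : x ∈ classicalLie κ n) (hx3 : x * x * x = 0) :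
    ∃ g ∈ classicalGroup κ n, g.1 = 1 + x + (1 / 2 : ℂ) • (x * x) := by
  have h4 : x * x * (x * x) = 0 := by rw [← Matrix.mul_assoc, hx3, Matrix.zero_mul]
  have h3' : x * (x * x) = 0 := by rw [← Matrix.mul_assoc, hx3]
  -- `a` and `b` are `exp (x/2)` and `exp (-x/2)`, truncated since `x³ = 0`; the required element is
  -- `a²`.
  let a : Matrix (Fin n) (Fin n) ℂ := 1 + (1 / 2 : ℂ) • x + (1 / 8 : ℂ) • (x * x)
  let b : Matrix (Fin n) (Fin n) ℂ := 1 - (1 / 2 : ℂ) • x + (1 / 8 : ℂ) • (x * x)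
  have hab : a * b = 1 := by
    simp only [a, b, mul_add, add_mul, mul_sub, smul_mul_assoc, mul_smul_comm, mul_one,
      one_mul, hx3, h3', h4, smul_zero]
    module
  have hba : b * a = 1 := by
    simp only [a, b, mul_add, add_mul, sub_mul, smul_mul_assoc, mul_smul_comm, mul_one,
      one_mul, hx3, h3', h4, smul_zero]
    module
  have haa : a * a = 1 + x + (1 / 2 : ℂ) • (x * x) := by
    simp only [a, mul_add, add_mul, smul_mul_assoc, mul_smul_comm, mul_one,
      one_mul, hx3, h3', h4, smul_zero]
    module
  let g : GL (Fin n) ℂ := ⟨a, b, hab, hba⟩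
  refine ⟨g * g, mem_classicalGroup_sq hκ ?_, haa⟩
  rw [mem_isometryGroup_iff]
  rw [mem_classicalLie_iff] at hx
  intro v w
  have hg : ∀ v, g.1.mulVec v = v + (1 / 2 : ℂ) • x.mulVec v + (1 / 8 : ℂ) • x.mulVec (x.mulVec v) :=
    fun v => by simp [g, a, Matrix.add_mulVec, Matrix.smul_mulVec, Matrix.mulVec_mulVec]
  have hxxx : ∀ v, x.mulVec (x.mulVec (x.mulVec v)) = 0 := fun v => by
    rw [Matrix.mulVec_mulVec, Matrix.mulVec_mulVec, hx3, Matrix.zero_mulVec]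
  rw [hg, hg]
  simp only [map_add, map_smul, LinearMap.add_apply, LinearMap.smul_apply, smul_eq_mul, hx, hxxx,
    map_zero, Matrix.mulVec_zero]
  ring

/-- A subspace stable under the standard Borel subgroup. -/
def BorelStable (κ : FormKind) (X : Submodule ℂ (Fin n → ℂ)) : Prop :=
  ∀ g ∈ classicalGroup κ n, Matrix.BlockTriangular g.1 id → ∀ v ∈ X, g.1.mulVec v ∈ X

lemma BorelStable.iSup {V : Fin k → Submodule ℂ (Fin n → ℂ)} (hV : ∀ i, BorelStable κ (V i)) :
    BorelStable κ (⨆ i, V i) := by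
  intro g hg hgt v hv
  have h : (⨆ i, V i).map g.1.mulVecLin ≤ ⨆ i, V i := by
    rw [Submodule.map_iSup]
    refine iSup_mono fun i => ?_
    rintro _ ⟨w, hw, rfl⟩
    exact hV i g hg hgt w hw
  exact h ⟨v, hv, rfl⟩

/-- `X` is stable under `exp x`, hence under `y = exp x - 1 = x + x²/2`. As `x³ = 0`, one has `y² =
x²` and `x = y - y²/2`. -/
lemma BorelStable.mulVec_mem (hκ : κ = .symplectic → Even n) {X : Submodule ℂ (Fin n → ℂ)}
    (hX : BorelStable κ X) {x : Matrix (Fin n) (Fin n) ℂ} (hx : x ∈ classicalLie κ n)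
    (hx3 : x * x * x = 0) (hxt : Matrix.BlockTriangular x id) {v : Fin n → ℂ} (hv : v ∈ X) :
    x.mulVec v ∈ X := by
  obtain ⟨g, hg, hgx⟩ := exists_exp hκ hx hx3
  have hgt : Matrix.BlockTriangular g.1 id := by
    have hxx := hxt.mul hxt
    intro i j hij
    rw [hgx]
    simp [hxt hij, hxx hij, Matrix.one_apply_ne (show i ≠ j from (ne_of_lt hij).symm)]
  have hxxx : ∀ v, x.mulVec (x.mulVec (x.mulVec v)) = 0 := fun v => by
    rw [Matrix.mulVec_mulVec, Matrix.mulVec_mulVec, hx3, Matrix.zero_mulVec]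
  have hgv : ∀ v, g.1.mulVec v = v + x.mulVec v + (1 / 2 : ℂ) • x.mulVec (x.mulVec v) :=
    fun v => by rw [hgx]; simp [Matrix.add_mulVec, Matrix.smul_mulVec, Matrix.mulVec_mulVec]
  have hy : ∀ v ∈ X, x.mulVec v + (1 / 2 : ℂ) • x.mulVec (x.mulVec v) ∈ X := fun v hv => by
    have := Submodule.sub_mem _ (hX g hg hgt v hv) hv
    rw [hgv] at this
    convert this using 1
    abel
  have h1 := hy v hv
  have h2 := hy _ h1
  rw [Matrix.mulVec_add, Matrix.mulVec_smul, hxxx, smul_zero, add_zero, hxxx, smul_zero,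
    add_zero] at h2
  have h3 := Submodule.sub_mem _ h1 (Submodule.smul_mem _ (1 / 2 : ℂ) h2)
  rwa [add_sub_cancel_right] at h3

lemma form_eq_sum (v w : Fin n → ℂ) :
    form κ n v w = ∑ i, v i * gram κ n i i.rev * w i.rev := by
  rw [form, Matrix.toBilin'_apply']
  simp only [dotProduct, Matrix.mulVec]
  refine Finset.sum_congr rfl fun i _ => ?_
  rw [Finset.sum_eq_single_of_mem i.rev (Finset.mem_univ _), mul_assoc]
  intro j _ hj
  rw [gram_of_ne κ hj, zero_mul]

/-- Stability under squares of torus elements; the condition on `a` says that the diagonal matrix is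
an isometry. -/
lemma BorelStable.diagonal_mem (hκ : κ = .symplectic → Even n) {X : Submodule ℂ (Fin n → ℂ)}
    (hX : BorelStable κ X) {a : Fin n → ℂ} (ha : ∀ i, a i * a i.rev = 1) {v : Fin n → ℂ}
    (hv : v ∈ X) : (fun i => a i * a i * v i) ∈ X := by
  let g : GL (Fin n) ℂ := ⟨Matrix.diagonal a, Matrix.diagonal fun i => a i.rev, by
    rw [Matrix.diagonal_mul_diagonal, ← Matrix.diagonal_one]
    congr 1; funext i; exact ha i, by
    rw [Matrix.diagonal_mul_diagonal, ← Matrix.diagonal_one]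
    congr 1; funext i; rw [mul_comm]; exact ha i⟩
  have hg : g ∈ isometryGroup κ n := by
    rw [mem_isometryGroup_iff]
    intro v w
    rw [form_eq_sum, form_eq_sum]
    refine Finset.sum_congr rfl fun i _ => ?_
    simp only [g, Matrix.mulVec_diagonal]
    linear_combination (v i * gram κ n i i.rev * w i.rev) * ha i
  have h1 := hX _ (mem_classicalGroup_sq hκ hg) (by
    simp only [g, Units.val_mul, Matrix.diagonal_mul_diagonal]
    exact Matrix.blockTriangular_diagonal _) v hv
  convert h1 using 1
  funext i
  simp only [g, Units.val_mul, Matrix.diagonal_mul_diagonal, Matrix.mulVec_diagonal]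

variable {X : Submodule ℂ (Fin n → ℂ)}

lemma BorelStable.single_mem_of_ne (hκ : κ = .symplectic → Even n) (hX : BorelStable κ X)
    {v : Fin n → ℂ} (hv : v ∈ X) {i : Fin n} (hi : v i ≠ 0) (hir : i ≠ i.rev) :
    (Pi.single i 1 : Fin n → ℂ) ∈ X := by
  let a : Fin n → ℂ := fun j => if j = i then 2 else if j = i.rev then 1 / 2 else 1
  have ha : ∀ j, a j * a j.rev = 1 := by
    intro j
    by_cases h1 : j = i
    · subst h1
      simp [a, hir.symm]
    · by_cases h2 : j = i.rev
      · subst h2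
        simp [a, hir.symm]
      · have h3 : j.rev ≠ i := fun h => h2 (by rw [← h, Fin.rev_rev])
        have h4 : j.rev ≠ i.rev := fun h => h1 (Fin.rev_injective h)
        simp [a, h1, h2, h3, h4]
  have hd : ∀ {w}, w ∈ X → (fun j => a j * a j * w j - w j) ∈ X := fun {w} hw =>
    Submodule.sub_mem _ (hX.diagonal_mem hκ ha hw) hw
  have h1 := hd hv
  have h2 := hd h1
  -- The torus element minus the identity has eigenvalue `3` at `i`, `-3/4` at `i.rev` and `0`
  -- elsewhere. The polynomial `(3/4) T + T²` vanishes at the last two and equals `45/4` at `3`.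
  have h3 := Submodule.smul_mem _ (4 / (45 * v i)) (Submodule.add_mem _ (Submodule.smul_mem _ (3 / 4 : ℂ) h1) h2)
  convert h3 using 1
  funext j
  simp only [Pi.smul_apply, Pi.add_apply, smul_eq_mul, a]
  by_cases hj : j = i
  · subst hj
    simp only [Pi.single_eq_same, if_true]
    field_simp
    norm_num
  · rw [Pi.single_eq_of_ne hj]
    by_cases hj' : j = i.rev
    · subst hj'
      simp only [hir.symm, if_true, if_false]
      ring
    · simp [hj, hj']

variable (hiso : ∀ v ∈ X, ∀ w ∈ X, form κ n v w = 0)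
include hiso

lemma not_single_mem_rev {i : Fin n} (h1 : (Pi.single i 1 : Fin n → ℂ) ∈ X) :
    (Pi.single i.rev 1 : Fin n → ℂ) ∉ X := fun h2 => by
  have := hiso _ h1 _ h2
  rw [form_single] at this
  exact gram_rev_ne_zero κ i this

/-- Only the central index `i = i.rev` is new. Subtracting the other coordinates would leave the
central basis vector in `X`, but that vector is not isotropic, so the case does not occur. -/
lemma BorelStable.single_mem (hκ : κ = .symplectic → Even n) (hX : BorelStable κ X)
    {v : Fin n → ℂ} (hv : v ∈ X) {i : Fin n} (hi : v i ≠ 0) :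
    (Pi.single i 1 : Fin n → ℂ) ∈ X := by
  by_cases hir : i = i.rev
  swap
  · exact hX.single_mem_of_ne hκ hv hi hir
  have h1 : v - ∑ j ∈ Finset.univ.erase i, v j • (Pi.single j 1 : Fin n → ℂ) ∈ X := by
    refine Submodule.sub_mem _ hv (Submodule.sum_mem _ fun j hj => ?_)
    by_cases hvj : v j = 0
    · rw [hvj, zero_smul]; exact Submodule.zero_mem _
    · refine Submodule.smul_mem _ _ (hX.single_mem_of_ne hκ hv hvj fun hjr => ?_)
      refine Finset.ne_of_mem_erase hj (Fin.ext ?_)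
      have h2 := congrArg Fin.val hir
      have h3 := congrArg Fin.val hjr
      rw [Fin.val_rev] at h2 h3
      omega
  have h2 : v - ∑ j ∈ Finset.univ.erase i, v j • (Pi.single j 1 : Fin n → ℂ) =
      v i • Pi.single i 1 := by
    rw [sub_eq_iff_eq_add', Finset.sum_erase_add _ _ (Finset.mem_univ i)]
    exact pi_eq_sum_univ' v
  rw [h2] at h1
  have h3 := (Submodule.smul_mem_iff _ hi).1 h1
  exact absurd (hir ▸ h3) (not_single_mem_rev hiso h3)

omit hiso

/-- A root vector of the Borel subalgebra, `⟨a, ·⟩ b - κ.sgn ⟨b, ·⟩ a` for the basis vectors `a, b`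
at `i` and `j.rev`, maps the `j`-th basis vector to a nonzero multiple of the `i`-th. For `i =
j.rev` it vanishes in the orthogonal case, hence the last hypothesis. -/
lemma BorelStable.single_mem_of_lt (hκ : κ = .symplectic → Even n) (hX : BorelStable κ X)
    {i j : Fin n} (hj : (Pi.single j 1 : Fin n → ℂ) ∈ X) (hij : i < j)
    (h : i ≠ j.rev ∨ κ = .symplectic) : (Pi.single i 1 : Fin n → ℂ) ∈ X := by
  set a : Fin n → ℂ := Pi.single i 1 with ha
  set b : Fin n → ℂ := Pi.single j.rev 1 with hb
  have hab : form κ n a b = 0 := by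
    rw [ha, hb, form_single]
    exact gram_of_ne κ fun h => hij.ne (Fin.rev_injective h).symm
  have hba : form κ n b a = 0 := by rw [form_symm κ hκ, hab, mul_zero]
  -- At most one of `i` and `j` is the central index. This product is what governs the cube of the
  -- root vector.
  have haabb : form κ n a a * form κ n b b = 0 := by
    rw [ha, hb, form_single, form_single]
    by_cases h1 : i = i.rev
    · by_cases h2 : j.rev = j.rev.rev
      · exfalso
        have h3 := congrArg Fin.val h1
        have h4 := congrArg Fin.val h2
        rw [Fin.rev_rev] at h4
        rw [Fin.val_rev] at h3 h4
        have := Fin.lt_def.1 hij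
        omega
      · rw [gram_of_ne κ h2, mul_zero]
    · rw [gram_of_ne κ h1, zero_mul]
  let x0 : (Fin n → ℂ) →ₗ[ℂ] Fin n → ℂ :=
    (form κ n a).smulRight b - κ.sgn • (form κ n b).smulRight a
  have hx0 : ∀ v, x0 v = form κ n a v • b - κ.sgn • form κ n b v • a := fun v => rfl
  set x := LinearMap.toMatrix' x0 with hx
  have hxv : ∀ v, x.mulVec v = x0 v := fun v => LinearMap.toMatrix'_mulVec _ _
  have hlie : x ∈ classicalLie κ n := by
    rw [mem_classicalLie_iff]
    intro v w
    rw [hxv, hxv, hx0, hx0]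
    simp only [map_sub, map_smul, LinearMap.sub_apply, LinearMap.smul_apply, smul_eq_mul]
    rw [form_symm κ hκ v b, form_symm κ hκ v a]
    linear_combination (-(form κ n a v * form κ n b w)) * κ.sgn_mul_self
  have hx3 : x * x * x = 0 := by
    refine Matrix.toLin'.injective (LinearMap.ext fun v => ?_)
    rw [Matrix.toLin'_apply, ← Matrix.mulVec_mulVec, ← Matrix.mulVec_mulVec, hxv, hxv, hxv]
    have h1 : x0 b = -(κ.sgn * form κ n b b) • a := by
      rw [hx0, hab]; module
    have h2 : x0 a = form κ n a a • b := by
      rw [hx0, hba]; module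
    have h3 : x0 (x0 b) = -(κ.sgn * (form κ n a a * form κ n b b)) • b := by
      rw [h1, map_smul, h2]; module
    have h4 : x0 (x0 a) = -(κ.sgn * (form κ n a a * form κ n b b)) • a := by
      rw [h2, map_smul, h1]; module
    rw [haabb, mul_zero, neg_zero, zero_smul] at h3 h4
    rw [hx0 v]
    simp only [map_sub, map_smul, h3, h4]
    simp
  have hxt : Matrix.BlockTriangular x id := by
    intro p q hpq
    have hpq' : q < p := hpq
    have h1 : x p q = form κ n a (Pi.single q 1) * b p - κ.sgn * (form κ n b (Pi.single q 1) * a p) := by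
      rw [hx, LinearMap.toMatrix'_apply]
      rfl
    rw [h1, ha, hb, form_single, form_single]
    have h2 : gram κ n i q * (Pi.single j.rev 1 : Fin n → ℂ) p = 0 := by
      by_cases hq : q = i.rev
      · rw [Pi.single_eq_of_ne, mul_zero]
        rintro rfl
        rw [hq, Fin.rev_lt_rev] at hpq'
        exact lt_asymm hij hpq'
      · rw [gram_of_ne κ hq, zero_mul]
    have h3 : gram κ n j.rev q * (Pi.single i 1 : Fin n → ℂ) p = 0 := by
      by_cases hq : q = j.rev.rev
      · rw [Pi.single_eq_of_ne, mul_zero]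
        rintro rfl
        rw [Fin.rev_rev] at hq
        rw [hq] at hpq'
        exact lt_asymm hij hpq'
      · rw [gram_of_ne κ hq, zero_mul]
    rw [h2, h3]
    simp
  have hmem := hX.mulVec_mem hκ hlie hx3 hxt hj
  have hg := gram_rev_ne_zero κ j.rev
  rw [Fin.rev_rev] at hg
  rw [hxv, hx0, ha, hb, form_single, form_single] at hmem
  by_cases hir : i = j.rev
  · have hκ' := h.resolve_left (not_not.2 hir)
    subst hκ'
    rw [ha]
    rw [hir] at hmem ⊢
    simp only [FormKind.sgn, neg_smul, one_smul, sub_neg_eq_add, ← add_smul] at hmem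
    refine (Submodule.smul_mem_iff _ ?_).1 hmem
    rw [← two_mul]
    exact mul_ne_zero two_ne_zero hg
  · have h0 : gram κ n i j = 0 := gram_of_ne κ fun h' => hir (by rw [h', Fin.rev_rev])
    rw [h0, zero_smul, zero_sub, Submodule.neg_mem_iff, smul_smul] at hmem
    exact (Submodule.smul_mem_iff _ (mul_ne_zero κ.sgn_ne_zero hg)).1 hmem

open Classical in
lemma BorelStable.eq_span (hiso : ∀ v ∈ X, ∀ w ∈ X, form κ n v w = 0)
    (hκ : κ = .symplectic → Even n) (hX : BorelStable κ X) :
    X = Submodule.span ℂ ((fun i : Fin n => (Pi.single i 1 : Fin n → ℂ)) ''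
      {i | (Pi.single i 1 : Fin n → ℂ) ∈ X}) := by
  apply le_antisymm
  · intro v hv
    rw [pi_eq_sum_univ' v]
    refine Submodule.sum_mem _ fun i _ => ?_
    by_cases hi : v i = 0
    · rw [hi, zero_smul]; exact Submodule.zero_mem _
    · exact Submodule.smul_mem _ _ (Submodule.subset_span ⟨i, hX.single_mem hiso hκ hv hi, rfl⟩)
  · rw [Submodule.span_le]
    rintro _ ⟨i, hi, rfl⟩
    exact hi

end StandardFlag
-- Every admissible pattern is realized by an upper-triangular matrix.
section Realization

variable {κ : FormKind} {l n k : ℕ} {V : Fin k → Submodule ℂ (Fin n → ℂ)}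

lemma mem_iff_lt_card {l : ℕ} {J : Set (Fin l)} (hJ : ∀ s ∈ J, ∀ t ≤ s, t ∈ J) (t : Fin l) :
    t ∈ J ↔ t.1 < J.ncard := by
  classical
  let χ : Fin l → Fin 2 := fun t => if t ∈ J then 0 else 1
  have hχ : Monotone χ := fun s t hst => by
    by_cases ht : t ∈ J
    · simp [χ, ht, hJ t ht s hst]
    · simp only [χ, ht, if_false]
      exact Fin.le_last _
  have hiff : ∀ t, (χ t).1 < 1 ↔ t ∈ J := fun t => by
    by_cases ht : t ∈ J <;> simp [χ, ht]
  have h1 := monotone_lt_iff hχ t 1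
  have h2 : (Finset.univ.filter fun s => (χ s).1 < 1).card = J.ncard := by
    rw [← Set.ncard_coe_finset]
    congr 1
    ext s
    simp [hiff]
  rw [h2, hiff] at h1
  exact h1

lemma linearIndependent_single (n : ℕ) :
    LinearIndependent ℂ fun i : Fin n => (Pi.single i 1 : Fin n → ℂ) := by
  have := (Pi.basisFun ℂ (Fin n)).linearIndependent
  convert this using 1
  funext i
  rw [Pi.basisFun_apply]

open Classical in
/-- A flag stabilized by the standard Borel subgroup is spanned by standard basis vectors. -/
lemma exists_standard_basis (hV : IsotropicFlag κ l V) (hB : ∀ i, BorelStable κ (V i)) :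
    ∃ (ε : Fin l → Fin n) (β : Fin l → Fin k), StrictMono ε ∧ (∀ s t, (ε s).rev ≠ ε t) ∧
      (∀ s t, s ≠ t ∨ κ = .symplectic → ε s < (ε t).rev) ∧ Monotone β ∧
      ∀ i, V i = Submodule.span ℂ ((fun t => (Pi.single (ε t) 1 : Fin n → ℂ)) '' {t | β t ≤ i}) := by
  have hκ := even_of hV.sympl
  have hTB : BorelStable κ (⨆ i, V i) := BorelStable.iSup hB
  have hTi := hV.iso_iSup
  have hTl := hV.finrank
  have hVT : ∀ i, V i ≤ ⨆ i, V i := fun i => le_iSup V i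
  generalize (⨆ i, V i) = T at hTB hTi hTl hVT
  set S : Finset (Fin n) := Finset.univ.filter fun i => (Pi.single i 1 : Fin n → ℂ) ∈ T with hS
  have hSl : S.card = l := by
    rw [← hTl, hTB.eq_span hTi hκ, finrank_span_image (linearIndependent_single n),
      ← Set.ncard_coe_finset]
    congr 1
    ext i
    simp [hS]
  let ε : Fin l → Fin n := S.orderEmbOfFin hSl
  have hεS : ∀ t, (Pi.single (ε t) 1 : Fin n → ℂ) ∈ T := fun t => by
    have := S.orderEmbOfFin_mem hSl t
    exact (Finset.mem_filter.1 this).2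
  have hεr : ∀ i, (Pi.single i 1 : Fin n → ℂ) ∈ T → ∃ t, ε t = i := fun i hi => by
    have h1 : i ∈ (S : Set (Fin n)) := by simpa [hS] using hi
    rw [← S.range_orderEmbOfFin hSl] at h1
    exact h1
  have hεm : StrictMono ε := (S.orderEmbOfFin hSl).strictMono
  clear_value ε
  have hrev : ∀ s t, (ε s).rev ≠ ε t := fun s t h =>
    not_single_mem_rev hTi (hεS s) (h ▸ hεS t)
  obtain ⟨β, hβ⟩ := exists_blockIndex hV.strictMono hV.finrank
  refine ⟨ε, β, hεm, hrev, fun s t hst => ?_, fun s t hst => ?_, fun i => ?_⟩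
  -- Otherwise Borel stability would put the basis vector dual to `ε t` into the isotropic space.
  -- The case `s = t` fails in the orthogonal case with even `n`, where there are two families of
  -- maximal isotropic subspaces.
  · by_contra hlt
    have h1 : (ε t).rev < ε s := lt_of_le_of_ne (not_lt.1 hlt) (hrev t s)
    refine not_single_mem_rev hTi (hεS t) (hTB.single_mem_of_lt hκ (hεS s) h1 ?_)
    exact hst.imp_left fun h h2 => h (hεm.injective (Fin.rev_injective h2)).symm
  · rw [hβ]
    have := (hβ t (β t)).1 le_rfl
    rw [Fin.le_def] at hst
    omega
  · set J : Set (Fin l) := {t | (Pi.single (ε t) 1 : Fin n → ℂ) ∈ V i} with hJ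
    have hVJ : V i = Submodule.span ℂ ((fun t => (Pi.single (ε t) 1 : Fin n → ℂ)) '' J) := by
      conv_lhs => rw [(hB i).eq_span (hV.iso i) hκ]
      congr 1
      ext v
      constructor
      · rintro ⟨j, hj, rfl⟩
        obtain ⟨t, rfl⟩ := hεr j (hVT i hj)
        exact ⟨t, hj, rfl⟩
      · rintro ⟨t, ht, rfl⟩
        exact ⟨ε t, ht, rfl⟩
    have hJl : ∀ s ∈ J, ∀ t ≤ s, t ∈ J := by
      intro s hs t hts
      rcases hts.eq_or_lt with rfl | hts
      · exact hs
      · exact (hB i).single_mem_of_lt hκ hs (hεm hts) (Or.inl fun h => hrev s t h.symm)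
    have hcard : finrank ℂ (V i) = J.ncard := by
      conv_lhs => rw [hVJ]
      exact finrank_span_image ((linearIndependent_single n).comp ε hεm.injective) J
    have hset : {t | β t ≤ i} = J := by
      ext t
      rw [mem_iff_lt_card hJl, ← hcard, ← hβ]
      rfl
    rw [hset]
    exact hVJ

/-- The endomorphism attached to a link pattern. -/
noncomputable def linkMap (κ : FormKind) (e f : Fin l → Fin n → ℂ) (m : Fin l → Fin l)
    (D : Set (Fin l)) : (Fin n → ℂ) →ₗ[ℂ] Fin n → ℂ :=
  ∑ t, (((form κ n).flip (f t)).smulRight (linkE e m D t) +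
    (form κ n (e t)).smulRight (linkF κ e f m D t))

lemma linkMap_apply (e f : Fin l → Fin n → ℂ) (m : Fin l → Fin l) (D : Set (Fin l))
    (v : Fin n → ℂ) : linkMap κ e f m D v =
      ∑ t, (form κ n v (f t) • linkE e m D t + form κ n (e t) v • linkF κ e f m D t) := by
  simp [linkMap]

variable {e f : Fin l → Fin n → ℂ} {m : Fin l → Fin l} {D : Set (Fin l)}

section

variable (hκ : κ = .symplectic → Even n)
  (ee : ∀ s t, form κ n (e s) (e t) = 0) (ff : ∀ s t, form κ n (f s) (f t) = 0)
  (ef : ∀ s t, form κ n (e s) (f t) = if s = t then 1 else 0)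

include ee ef in
lemma linkMap_e (t : Fin l) : linkMap κ e f m D (e t) = linkE e m D t := by
  rw [linkMap_apply, Finset.sum_eq_single_of_mem t (Finset.mem_univ _)]
  · simp [ee, ef]
  · intro s _ hs
    simp [ee, ef, hs.symm]

include ff ef in
lemma linkMap_f (t : Fin l) : linkMap κ e f m D (f t) = linkF κ e f m D t := by
  rw [linkMap_apply, Finset.sum_eq_single_of_mem t (Finset.mem_univ _)]
  · simp [ff, ef]
  · intro s _ hs
    simp [ff, ef, hs]

include ee ff ef in
-- The images are `e` at a dotted point or at a smaller end, or `f` at the larger end of a plain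
-- link, up to sign; all of these are killed.
lemma linkMap_linkMap (hm : ∀ t, m (m t) = t) (hD : ∀ t, m t ∈ D ↔ t ∈ D) (v : Fin n → ℂ) :
    linkMap κ e f m D (linkMap κ e f m D v) = 0 := by
  conv_lhs => rw [linkMap_apply _ _ _ _ v]
  rw [map_sum]
  refine Finset.sum_eq_zero fun t _ => ?_
  have hE : t ∈ D ∨ m t < t → linkMap κ e f m D (e (m t)) = 0 := fun h => by
    rw [linkMap_e ee ef, linkE, if_neg]
    rw [hm, hD]
    rintro ⟨h1, h2⟩
    exact h.elim h1 (lt_asymm h2)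
  have hF : t ∉ D → t < m t → linkMap κ e f m D (f (m t)) = 0 := fun h h' => by
    rw [linkMap_f ff ef]
    unfold linkF
    rw [if_neg (by rwa [hD]), hm, if_neg h'.not_gt]
  have h1 : linkMap κ e f m D (linkE e m D t) = 0 := by
    rw [linkE]
    split_ifs with h
    exacts [hE (Or.inr h.2), map_zero _]
  have h2 : linkMap κ e f m D (linkF κ e f m D t) = 0 := by
    unfold linkF
    by_cases h : t ∈ D
    · rw [if_pos h]
      cases κ
      · exact hE (Or.inl h)
      · simp only
        split_ifs
        · exact hE (Or.inl h)
        · rw [map_neg, hE (Or.inl h), neg_zero]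
    · rw [if_neg h]
      split_ifs with h'
      · rw [map_neg, hF h h', neg_zero]
      · exact map_zero _
  rw [map_add, map_smul, map_smul, h1, h2]
  simp

include hκ in
-- The contribution of `t` to the left side cancels the contribution of `m t` to the right side. The
-- orthogonal sign convention is arranged for this, as it differs at the two ends of a dot.
lemma linkMap_skew (hm : ∀ t, m (m t) = t) (hD : ∀ t, m t ∈ D ↔ t ∈ D)
    (horth : κ = .orthogonal → ∀ t ∈ D, m t ≠ t) (v w : Fin n → ℂ) :
    form κ n (linkMap κ e f m D v) w = -form κ n v (linkMap κ e f m D w) := by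
  rw [linkMap_apply, linkMap_apply, map_sum, map_sum, LinearMap.sum_apply,
    eq_neg_iff_add_eq_zero]
  have hsum : ∀ G : Fin l → ℂ, ∑ t, G t = ∑ t, G (m t) := fun G =>
    (Equiv.sum_comp (Function.Involutive.toPerm m hm) G).symm
  rw [hsum fun t => form κ n v (_ • linkE e m D t + _ • linkF κ e f m D t),
    ← Finset.sum_add_distrib]
  refine Finset.sum_eq_zero fun t _ => ?_
  simp only [map_add, map_smul, LinearMap.add_apply,
    LinearMap.smul_apply, smul_eq_mul]
  have h1 := form_symm κ hκ v (e t)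
  have h2 := form_symm κ hκ (f (m t)) w
  unfold linkE linkF
  by_cases hDt : t ∈ D
  · have hDm := (hD t).2 hDt
    cases κ
    · simp only [hDt, hDm, not_true, false_and, if_false, if_true, hm, map_zero,
        LinearMap.zero_apply, mul_zero, zero_add, h1, FormKind.sgn]
      ring
    · simp only [hDt, hDm, not_true, false_and, if_false, if_true, hm, map_zero,
        LinearMap.zero_apply, mul_zero, zero_add]
      rcases lt_or_gt_of_ne (horth rfl t hDt) with h | h
      · simp only [h, h.not_gt, if_true, if_false, map_neg, h1, FormKind.sgn]
        ring
      · simp only [h, h.not_gt, if_true, if_false, map_neg, LinearMap.neg_apply, h1, FormKind.sgn]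
        ring
  · have hDm : m t ∉ D := fun h => hDt ((hD t).1 h)
    rcases lt_trichotomy (m t) t with h | h | h
    · simp only [hDt, hDm, not_false_iff, true_and, if_false, hm, h, h.not_gt, if_true, map_zero,
        mul_zero, zero_add, LinearMap.zero_apply, map_neg]
      ring
    · simp [hDt, h]
    · simp only [hDt, hDm, not_false_iff, true_and, if_false, hm, h, h.not_gt, if_true, map_zero,
        mul_zero, zero_add, LinearMap.zero_apply, map_neg, LinearMap.neg_apply, h1, h2]
      ring

end

lemma prevStep_eq_span {e : Fin l → Fin n → ℂ} {β : Fin l → Fin k}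
    (hflag : ∀ i, V i = Submodule.span ℂ (e '' {t | β t ≤ i})) (i : Fin k) :
    prevStep V i = Submodule.span ℂ (e '' {t | β t < i}) := by
  apply le_antisymm
  · refine iSup₂_le fun j hj => ?_
    rw [hflag]
    exact Submodule.span_mono (Set.image_mono fun t ht => lt_of_le_of_lt ht hj)
  · rw [Submodule.span_le]
    rintro _ ⟨t, ht, rfl⟩
    refine (le_iSup₂_of_le (β t) ht le_rfl : V (β t) ≤ prevStep V i) ?_
    rw [hflag]
    exact Submodule.subset_span ⟨t, le_refl (β t), rfl⟩

open Classical in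
lemma blockSize_eq_card {e : Fin l → Fin n → ℂ} {β : Fin l → Fin k}
    (hli : LinearIndependent ℂ e)
    (hflag : ∀ i, V i = Submodule.span ℂ (e '' {t | β t ≤ i})) (i : Fin k) :
    blockSize V i = (Finset.univ.filter fun t => β t = i).card := by
  have h1 : finrank ℂ (V i) = (Finset.univ.filter fun t => β t ≤ i).card := by
    rw [hflag, finrank_span_image hli, ← Set.ncard_coe_finset]
    congr 1
    ext t
    simp
  have h3 : finrank ℂ (prevStep V i) = (Finset.univ.filter fun t => β t < i).card := by
    rw [prevStep_eq_span hflag, finrank_span_image hli, ← Set.ncard_coe_finset]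
    congr 1
    ext t
    simp
  have h4 : (Finset.univ.filter fun t => β t ≤ i).card =
      (Finset.univ.filter fun t => β t < i).card +
        (Finset.univ.filter fun t => β t = i).card := by
    rw [← Finset.card_union_of_disjoint]
    · congr 1
      ext t
      simp [le_iff_lt_or_eq]
    · rw [Finset.disjoint_filter]
      exact fun t _ h h' => h.ne h'
  rw [blockSize, h1, h3, h4, Nat.add_sub_cancel_left]

open Classical in
/-- Every pattern with enough points at every vertex is the pattern of an upper-triangular
matrix. -/
theorem exists_upperTriangular (hV : IsotropicFlag κ l V) (hB : ∀ i, BorelStable κ (V i))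
    {q : Pattern k} (hq : q ∈ linkPatterns κ (blockSize V)) :
    ∃ x ∈ upperTriangularTwo κ n, HasNormalForm κ l V x q := by
  have hκ := even_of hV.sympl
  obtain ⟨ε, β, hε, hrev, hlt, hβ, hflag⟩ := exists_standard_basis hV hB
  let e : Fin l → Fin n → ℂ := fun t => Pi.single (ε t) 1
  let f : Fin l → Fin n → ℂ := fun t => (gram κ n (ε t) (ε t).rev)⁻¹ • Pi.single (ε t).rev 1
  have ee : ∀ s t, form κ n (e s) (e t) = 0 := fun s t => by
    simp only [e, form_single]
    exact gram_of_ne κ (hrev s t).symm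
  have ff : ∀ s t, form κ n (f s) (f t) = 0 := fun s t => by
    simp only [f, map_smul, LinearMap.smul_apply, form_single]
    have h0 : gram κ n (ε s).rev (ε t).rev = 0 := gram_of_ne κ fun h => hrev s t <| by
      rw [Fin.rev_rev] at h
      rw [← h, Fin.rev_rev]
    rw [h0, smul_zero, smul_zero]
  have ef : ∀ s t, form κ n (e s) (f t) = if s = t then 1 else 0 := fun s t => by
    simp only [e, f, map_smul, form_single, smul_eq_mul]
    split_ifs with hst
    · subst hst
      exact inv_mul_cancel₀ (gram_rev_ne_zero κ _)
    · rw [gram_of_ne κ fun h => hst (hε.injective (Fin.rev_injective h)).symm, mul_zero]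
  have hli : LinearIndependent ℂ e := (linearIndependent_single n).comp ε hε.injective
  rw [mem_linkPatterns_iff] at hq
  obtain ⟨m, D, hm, hD, horth, hsep, hpat⟩ := exists_patternOf_eq (κ := κ) hβ fun i =>
    (hq i).trans (blockSize_eq_card hli hflag i).le
  set x := LinearMap.toMatrix' (linkMap κ e f m D) with hx
  have hxv : ∀ v, x.mulVec v = linkMap κ e f m D v := fun v => LinearMap.toMatrix'_mulVec _ _
  refine ⟨x, ⟨?_, ?_, ?_⟩, hasNormalForm_iff.2 ⟨e, f, β, m, D, ⟨ee, ff, ef, hβ, hflag, hm, hD, horth,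
    fun t => ?_, fun t => ?_, fun u hu => ?_⟩, hsep, hpat.symm⟩⟩
  · rw [mem_classicalLie_iff]
    intro v w
    rw [hxv, hxv, linkMap_skew hκ hm hD horth]
  -- Column `r` sees only `r = ε t` and `r = (ε t).rev`. The images have smaller index: plain links
  -- by monotonicity of `ε`, dots by `hlt`, where the absence of orthogonal loops is used.
  · intro p r hrp
    have hrp' : r < p := hrp
    rw [hx, LinearMap.toMatrix'_apply, linkMap_apply, Finset.sum_apply]
    refine Finset.sum_eq_zero fun t _ => ?_
    have he : ∀ s, ε s < r → e s p = 0 := fun s hs => Pi.single_eq_of_ne (hs.trans hrp').ne' _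
    have he' : ∀ s, ε s ≤ r → e s p = 0 := fun s hs => Pi.single_eq_of_ne (hs.trans_lt hrp').ne' _
    have h1 : form κ n (Pi.single r 1) (f t) * linkE e m D t p = 0 := by
      by_cases hr : r = ε t
      · subst hr
        rw [linkE]
        split_ifs with h
        · rw [he _ (hε h.2), mul_zero]
        · simp
      · simp only [f, map_smul, form_single]
        rw [gram_of_ne κ fun h => hr (Fin.rev_injective h).symm, smul_zero, zero_mul]
    have h2 : form κ n (e t) (Pi.single r 1) * linkF κ e f m D t p = 0 := by
      by_cases hr : r = (ε t).rev
      · subst hr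
        unfold linkF
        by_cases hDt : t ∈ D
        · rw [if_pos hDt]
          have h0 : e (m t) p = 0 := he _ (hlt _ _ (by
            cases κ
            · exact Or.inr rfl
            · exact Or.inl (horth rfl t hDt)))
          cases κ
          · simp [h0]
          · simp only
            split_ifs <;> simp [h0]
        · rw [if_neg hDt]
          split_ifs with h
          · have h0 : f (m t) p = 0 := by
              have h3 : p ≠ (ε (m t)).rev := fun h4 => by
                rw [h4, Fin.rev_lt_rev] at hrp'
                exact lt_asymm hrp' (hε h)
              simp [f, h3]
            simp [h0]
          · simp
      · simp only [e, form_single]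
        rw [gram_of_ne κ hr, zero_mul]
    have h3 := congrArg₂ (· + ·) h1 h2
    simpa using h3
  · refine Matrix.toLin'.injective (LinearMap.ext fun v => ?_)
    rw [Matrix.toLin'_apply, pow_two, ← Matrix.mulVec_mulVec, hxv, hxv,
      linkMap_linkMap ee ff ef hm hD]
    simp
  · rw [hxv, linkMap_e ee ef]
  · rw [hxv, linkMap_f ff ef]
  · rw [hxv, linkMap_apply]
    refine Finset.sum_eq_zero fun t _ => ?_
    rw [form_symm κ hκ u, (hu t).1, (hu t).2]
    simp

end Realization
-- From normal forms to the bijections of orbits and patterns.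
section Parametrization

variable {κ : FormKind} {l n k : ℕ} {V : Fin k → Submodule ℂ (Fin n → ℂ)}
  {x : Matrix (Fin n) (Fin n) ℂ} {q : Pattern k}

lemma IsStandardIsotropicFlag.isotropicFlag (hV : IsStandardIsotropicFlag κ V)
    (hdim : n = 2 * l ∨ n = 2 * l + 1) (hs : κ = .symplectic → n = 2 * l)
    (hl : finrank ℂ (⨆ i, V i : Submodule ℂ (Fin n → ℂ)) = l) : IsotropicFlag κ l V where
  dim := hdim
  sympl := hs
  strictMono := hV.strictMono
  iso := by simpa only [form_apply] using hV.isotropic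
  finrank := hl

lemma IsStandardIsotropicFlag.borelStable (hV : IsStandardIsotropicFlag κ V) (i : Fin k) :
    BorelStable κ (V i) := by
  intro g hg hgt v hv
  rw [← (hV.borel_le g hg hgt).2 i]
  exact ⟨v, hv, Matrix.toLin'_apply _ _⟩

lemma HasNormalForm.mem_linkPatterns (h : HasNormalForm κ l V x q) :
    q ∈ linkPatterns κ (blockSize V) := by
  obtain ⟨e, f, β, m, D, hb, hs, rfl⟩ := hasNormalForm_iff.1 h
  rw [mem_linkPatterns_iff]
  intro i
  rw [blockSize_eq_card hb.linearIndependent_e hb.flag]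
  exact valency_patternOf_le hb.mono hb.m_m hb.m_D hb.orth hs i

lemma LinkBasis.link_self_eq_zero_iff {e f : Fin l → Fin n → ℂ} {β : Fin l → Fin k}
    {m : Fin l → Fin l} {D : Set (Fin l)} (h : LinkBasis κ V x e f β m D) :
    (∀ i, (patternOf β m D).link s(i, i) = 0) ↔ ∀ t, t ∉ D → m t < t → β (m t) < β t := by
  classical
  constructor
  · intro h0 t hD ht
    refine lt_of_le_of_ne (h.mono ht.le) fun hβ => ?_
    have h1 := h0 (β t)
    rw [patternOf_link h.mono le_rfl, plainCount, Finset.card_eq_zero] at h1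
    exact Finset.notMem_empty t (h1 ▸ Finset.mem_filter.2 ⟨Finset.mem_univ t, hD, ht, rfl, hβ⟩)
  · intro h0 i
    rw [patternOf_link h.mono le_rfl, plainCount, Finset.card_eq_zero,
      Finset.filter_eq_empty_iff]
    rintro t - ⟨hD, ht, h1, h2⟩
    exact (h0 t hD ht).ne (h2.trans h1.symm)

/-- A matrix in normal form shifts the isotropic flag if and only if its pattern has no loops
without dots. -/
lemma LinkBasis.shifts_flag_iff {e f : Fin l → Fin n → ℂ} {β : Fin l → Fin k}
    {m : Fin l → Fin l} {D : Set (Fin l)} (h : LinkBasis κ V x e f β m D) :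
    (∀ i, ∀ v ∈ V i, x.mulVec v ∈ prevStep V i) ↔
      ∀ t, t ∉ D → m t < t → β (m t) < β t := by
  constructor
  · intro hx t hD ht
    have h1 := hx _ _ (h.e_mem (le_refl (β t)))
    rw [h.xe, linkE, if_pos ⟨hD, ht⟩, prevStep_eq_span h.flag] at h1
    by_contra hβ
    exact h.linearIndependent_e.notMem_span_image (s := {s | β s < β t}) hβ h1
  · intro hβ i v hv
    have hle : V i ≤ (prevStep V i).comap x.mulVecLin := by
      conv_lhs => rw [h.flag]
      rw [Submodule.span_le]
      rintro _ ⟨t, ht, rfl⟩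
      rw [SetLike.mem_coe, Submodule.mem_comap, Matrix.mulVecLin_apply, h.xe, linkE]
      split_ifs with hc
      · rw [prevStep_eq_span h.flag]
        exact Submodule.subset_span ⟨m t, (hβ t hc.1 hc.2).trans_le ht, rfl⟩
      · exact Submodule.zero_mem _
    exact hle hv

/-- Such a `v` has no `f`-components, and `x` maps the `e t` to `e`'s or zero. So for a normal form
the last condition defining the nilradical is automatic. -/
lemma LinkBasis.mulVec_mem_iSup {e f : Fin l → Fin n → ℂ} {β : Fin l → Fin k}
    {m : Fin l → Fin l} {D : Set (Fin l)} (h : LinkBasis κ V x e f β m D)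
    (hκ : κ = .symplectic → Even n) {v : Fin n → ℂ} (hv : ∀ w ∈ ⨆ i, V i, form κ n v w = 0) :
    x.mulVec v ∈ ⨆ i, V i := by
  have he : ∀ t, e t ∈ ⨆ i, V i := fun t => le_iSup V (β t) (h.e_mem le_rfl)
  rw [h.mulVec_eq hκ]
  refine Submodule.sum_mem _ fun t _ => ?_
  rw [form_symm κ hκ (e t) v, hv _ (he t), mul_zero, zero_smul, add_zero, linkE]
  split_ifs
  · exact Submodule.smul_mem _ _ (he _)
  · rw [smul_zero]; exact Submodule.zero_mem _

lemma HasNormalForm.mem_nilradicalTwo_iff (h : HasNormalForm κ l V x q)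
    (hκ : κ = .symplectic → Even n) (hx : x ∈ classicalLie κ n) (hx2 : x ^ 2 = 0) :
    x ∈ nilradicalTwo κ V ↔ q ∈ linkPatternsNoPlainLoops κ (blockSize V) := by
  rw [mem_linkPatternsNoPlainLoops_iff, and_iff_right h.mem_linkPatterns]
  obtain ⟨e, f, β, m, D, hb, hs, rfl⟩ := hasNormalForm_iff.1 h
  rw [hb.link_self_eq_zero_iff, ← hb.shifts_flag_iff]
  refine ⟨fun h => h.1.2.1, fun h => ⟨⟨hx, h, fun v hv => ?_⟩, hx2⟩⟩
  simp only [← form_apply] at hv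
  exact hb.mulVec_mem_iSup hκ hv

lemma conjOrbit_eq_of_mem {P : Subgroup (GL (Fin n) ℂ)} {x y : Matrix (Fin n) (Fin n) ℂ}
    (hy : y ∈ conjOrbit P x) : conjOrbit P y = conjOrbit P x := by
  obtain ⟨g, hg, rfl⟩ := hy
  ext z
  constructor
  · rintro ⟨a, ha, rfl⟩
    exact ⟨a * g, P.mul_mem ha hg, by simp only [mul_inv_rev, Units.val_mul, Matrix.mul_assoc]⟩
  · rintro ⟨a, ha, rfl⟩
    refine ⟨a * g⁻¹, P.mul_mem ha (P.inv_mem hg), ?_⟩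
    have h1 : (g⁻¹).1 * g.1 = 1 := by simp
    calc a.1 * x * (a⁻¹).1 = a.1 * ((g⁻¹).1 * g.1) * x * ((g⁻¹).1 * g.1) * (a⁻¹).1 := by
          rw [h1, Matrix.mul_one, Matrix.mul_one]
      _ = _ := by simp only [mul_inv_rev, inv_inv, Units.val_mul, Matrix.mul_assoc]

/-- The pattern of the normal form parametrizes the orbits as soon as all elements of `S` have
normal forms and all patterns in `Q` occur. -/
lemma naturallyParametrizedBy (hV : IsotropicFlag κ l V)
    {S : Set (Matrix (Fin n) (Fin n) ℂ)} {Q : Set (Pattern k)}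
    (hS : ∀ x ∈ S, ∃ q ∈ Q, HasNormalForm κ l V x q)
    (hQ : ∀ q ∈ Q, ∃ x ∈ S, HasNormalForm κ l V x q) : NaturallyParametrizedBy κ l V S Q := by
  have hκ := even_of hV.sympl
  have hO : ∀ O : orbitsOf (parabolic κ V) S, ∃ q : Q, ∀ x ∈ O.1, HasNormalForm κ l V x q.1 := by
    rintro ⟨_, x, hx, rfl⟩
    obtain ⟨q, hq, h⟩ := hS x hx
    refine ⟨⟨q, hq⟩, ?_⟩
    rintro _ ⟨g, hg, rfl⟩
    exact h.conj hg
  have hne : ∀ O : orbitsOf (parabolic κ V) S,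
      ∃ x ∈ S, x ∈ O.1 ∧ O.1 = conjOrbit (parabolic κ V) x := by
    rintro ⟨_, x, hx, rfl⟩
    exact ⟨x, hx, ⟨1, Subgroup.one_mem _, by simp⟩, rfl⟩
  choose φ hφ using hO
  have hinj : Function.Injective φ := by
    intro O O' h
    obtain ⟨x, -, hxO, hx⟩ := hne O
    obtain ⟨y, -, hyO, hy⟩ := hne O'
    have h' := hφ O' y hyO
    rw [← h] at h'
    obtain ⟨g, hg, hgy⟩ := (hφ O x hxO).exists_conj hV h'
    exact Subtype.ext <| by rw [hx, hy, conjOrbit_eq_of_mem ⟨g, hg, hgy⟩]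
  have hsurj : Function.Surjective φ := by
    intro q
    obtain ⟨x, hx, h⟩ := hQ q.1 q.2
    let O : orbitsOf (parabolic κ V) S := ⟨conjOrbit (parabolic κ V) x, x, hx, rfl⟩
    refine ⟨O, Subtype.ext ?_⟩
    exact (hφ O x ⟨1, Subgroup.one_mem _, by simp⟩).unique hκ h
  refine ⟨Equiv.ofBijective φ ⟨hinj, hsurj⟩, fun O q x hx => ?_⟩
  change φ O = q ↔ _
  exact ⟨fun h => h ▸ hφ O x hx, fun h => Subtype.ext ((hφ O x hx).unique hκ h)⟩

theorem IsStandardIsotropicFlag.naturallyParametrizedBy_upperTriangularTwo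
    (hV : IsStandardIsotropicFlag κ V) (hV' : IsotropicFlag κ l V) :
    NaturallyParametrizedBy κ l V (upperTriangularTwo κ n) (linkPatterns κ (blockSize V)) := by
  refine naturallyParametrizedBy hV' (fun x hx => ?_)
    fun q hq => exists_upperTriangular hV' hV.borelStable hq
  -- An upper-triangular `x` stabilizes the flag because its exponential lies in the Borel subgroup.
  obtain ⟨q, h⟩ := exists_hasNormalForm hV' hx.1 hx.2.2 fun i v hv =>
    (hV.borelStable i).mulVec_mem (even_of hV'.sympl) hx.1
      (by rw [← pow_two, hx.2.2, Matrix.zero_mul]) hx.2.1 hv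
  exact ⟨q, h.mem_linkPatterns, h⟩

theorem IsStandardIsotropicFlag.naturallyParametrizedBy_nilradicalTwo
    (hV : IsStandardIsotropicFlag κ V) (hV' : IsotropicFlag κ l V) :
    NaturallyParametrizedBy κ l V (nilradicalTwo κ V)
      (linkPatternsNoPlainLoops κ (blockSize V)) := by
  have hκ := even_of hV'.sympl
  refine naturallyParametrizedBy hV' (fun x hx => ?_) fun q hq => ?_
  · obtain ⟨q, h⟩ := exists_hasNormalForm hV' hx.1.1 hx.2 fun i v hv =>
      (iSup₂_le fun j hj => hV.strictMono.monotone hj.le : prevStep V i ≤ V i) (hx.1.2.1 i v hv)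
    exact ⟨q, (h.mem_nilradicalTwo_iff hκ hx.1.1 hx.2).1 hx, h⟩
  · obtain ⟨x, hx, h⟩ := exists_upperTriangular hV' hV.borelStable
      (mem_linkPatternsNoPlainLoops_iff.1 hq).1
    exact ⟨x, (h.mem_nilradicalTwo_iff hκ hx.1 hx.2.2).2 hq, h⟩

end Parametrization
end NilradicalOrbits

theorem mainTheorem8 (l n k : ℕ) (V : Fin k → Submodule ℂ (Fin n → ℂ))
    (hV : Module.finrank ℂ (⨆ i, V i : Submodule ℂ (Fin n → ℂ)) = l) :
    (n = 2 * l → NilradicalOrbits.IsStandardIsotropicFlag .symplectic V →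
      NilradicalOrbits.NaturallyParametrizedBy .symplectic l V
        (NilradicalOrbits.nilradicalTwo .symplectic V)
        (NilradicalOrbits.linkPatternsNoPlainLoops .symplectic (NilradicalOrbits.blockSize V)) ∧
      NilradicalOrbits.NaturallyParametrizedBy .symplectic l V
        (NilradicalOrbits.upperTriangularTwo .symplectic n)
        (NilradicalOrbits.linkPatterns .symplectic (NilradicalOrbits.blockSize V))) ∧
    (n = 2 * l ∨ n = 2 * l + 1 → NilradicalOrbits.IsStandardIsotropicFlag .orthogonal V →
      NilradicalOrbits.NaturallyParametrizedBy .orthogonal l V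
        (NilradicalOrbits.nilradicalTwo .orthogonal V)
        (NilradicalOrbits.linkPatternsNoPlainLoops .orthogonal (NilradicalOrbits.blockSize V)) ∧
      NilradicalOrbits.NaturallyParametrizedBy .orthogonal l V
        (NilradicalOrbits.upperTriangularTwo .orthogonal n)
        (NilradicalOrbits.linkPatterns .orthogonal (NilradicalOrbits.blockSize V))) := by
  refine ⟨fun hn hs => ?_, fun hn hs => ?_⟩
  · have hV' := hs.isotropicFlag (Or.inl hn) (fun _ => hn) hV
    exact ⟨hs.naturallyParametrizedBy_nilradicalTwo hV',
      hs.naturallyParametrizedBy_upperTriangularTwo hV'⟩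
  · have hV' := hs.isotropicFlag hn nofun hV
    exact ⟨hs.naturallyParametrizedBy_nilradicalTwo hV',
      hs.naturallyParametrizedBy_upperTriangularTwo hV'⟩
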